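/- Let $k,m\ge 2$ be integers with $(k,m)\neq(2,2)$, and let $\Gamma=\mathbb{Z}_m*\cdots*\mathbb{Z}_m$ ($k$ factors); $\Gamma$ also denotes the bipartite Bell scenario in which each of two parties, Alice and Bob, has $k$ measurement settings with $m$ outcomes each. For a discrete group $G$, let $C^*(G)$ be the maximal group $C^*$-algebra, and for $C^*$-algebras $A,B$ write $A\otimes_{\min}B=A\otimes_{\max}B$ if the minimal and maximal $C^*$-norms coincide on the algebraic tensor product of $A$ and $B$. Let $M_d=M_d(\mathbb{C})$. Let $\mathcal{SD}^d_\otimes(\Gamma)$ be the set of families $(\alpha^x_a,\beta^y_b)_{x,y\in[k],\,a,b\in[m]}$ of linear functionals on $M_d$ for which there are Hilbert spaces $\mathcal{H}_A,\mathcal{H}_B$, a unit vector $\psi\in\mathbb{C}^d\otimes\mathcal{H}_A\otimes\mathcal{H}_B$ and positive bounded operators $A^x_a$ on $\mathcal{H}_A$ and $B^y_b$ on $\mathcal{H}_B$ with $\sum_aA^x_a=\mathbb{1}$ for all $x$ and $\sum_bB^y_b=\mathbb{1}$ for all $y$, such that $$\alpha^x_a(V)=\langle\psi,(V\otimes A^x_a\otimes\mathbb{1})\psi\rangle,\qquad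 \beta^y_b(W)=\langle\psi,(W\otimes\mathbb{1}\otimes B^y_b)\psi\rangle\qquad(V,W\in M_d).$$ Let $\mathcal{SD}^d_c(\Gamma)$ be the set of such families for which there are one Hilbert space $\mathcal{H}$, a unit vector $\psi\in\mathbb{C}^d\otimes\mathcal{H}$ and positive bounded operators $A^x_a,B^y_b$ on $\mathcal{H}$ with $\sum_aA^x_a=\mathbb{1}$ for all $x$, $\sum_bB^y_b=\mathbb{1}$ for all $y$, and $A^x_aB^y_b=B^y_bA^x_a$ for all $x,y,a,b$, such that $$\alpha^x_a(V)=\langle\psi,(V\otimes A^x_a)\psi\rangle,\qquad \beta^y_b(W)=\langle\psi,(W\otimes B^y_b)\psi\rangle\qquad(V,W\in M_d).$$ A bipartite steering game is a family $(V^x_a,W^y_b)_{x,y\in[k],\,a,b\in[m]}$ of hermitian matrices in $M_d$. Its tensor product value $\omega_\otimes$ and its commutative value $\omega_c$ are the suprema of $$\frac1{2k}\Big(\sum_{x,a}\alpha^x_a(V^x_a)+\sum_{y,b}\beta^y_b(W^y_b)\Big)$$ over $\mathcal{SD}^d_\otimes(\Gamma)$ and over $\mathcal{SD}^d_c(\Gamma)$,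 respectively (the latter supremum is a maximum). Then the following statements are equivalent: 1. (QWEP conjecture) $C^*(\mathbb{F}_2)\otimes_{\min}C^*(\mathbb{F}_2)=C^*(\mathbb{F}_2)\otimes_{\max}C^*(\mathbb{F}_2)$, where $\mathbb{F}_2$ is the free group on two generators. 2. $C^*(\Gamma)\otimes_{\min}C^*(\Gamma)=C^*(\Gamma)\otimes_{\max}C^*(\Gamma)$. 3. $\overline{\mathcal{SD}^d_\otimes(\Gamma)}=\mathcal{SD}^d_c(\Gamma)$ for every $d\ge1$. 4. For every $d\ge1$ and every bipartite steering game $(V^x_a,W^y_b)$ on $M_d$, $\omega_\otimes(V^x_a,W^y_b)=\omega_c(V^x_a,W^y_b)$. -/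

import Mathlib

open scoped TensorProduct

noncomputable section

/-! ### The maximal group C⋆-algebra of a discrete group -/

namespace MaxGroup

universe u

/-- The complex group algebra `ℂ[G]`; it carries the involution `(∑ x_g g)⋆ = ∑ conj(x_g) g⁻¹` and
the maximal C⋆-seminorm. -/
def GroupAlgebra (G : Type u) : Type u := MonoidAlgebra ℂ G

variable {G : Type u} [Group G]

instance : Ring (GroupAlgebra G) := inferInstanceAs (Ring (MonoidAlgebra ℂ G))

instance : Algebra ℂ (GroupAlgebra G) := inferInstanceAs (Algebra ℂ (MonoidAlgebra ℂ G))

/-- The basis element `c · g` of the group algebra. -/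
def single (g : G) (c : ℂ) : GroupAlgebra G := MonoidAlgebra.single g c

theorem single_mul_single (g h : G) (c d : ℂ) :
    single g c * single h d = single (g * h) (c * d) :=
  MonoidAlgebra.single_mul_single g h c d

theorem single_add (g : G) (c d : ℂ) : single g (c + d) = single g c + single g d :=
  MonoidAlgebra.single_add g c d

theorem smul_single (c : ℂ) (g : G) (d : ℂ) : c • single g d = single g (c * d) :=
  MonoidAlgebra.smul_single' c g d

theorem induction_linear {p : GroupAlgebra G → Prop} (x : GroupAlgebra G) (h0 : p 0)
    (hadd : ∀ x y, p x → p y → p (x + y)) (hs : ∀ g c, p (single g c)) : p x :=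
  MonoidAlgebra.induction_linear x h0 hadd hs

/-- The involution of the group algebra: the additive map with `c · g ↦ conj(c) · g⁻¹`. -/
def starHom : GroupAlgebra G →+ GroupAlgebra G :=
  MonoidAlgebra.liftNC (R := MonoidAlgebra ℂ G)
    { toFun := fun c => MonoidAlgebra.single (1 : G) (star c)
      map_zero' := by simp
      map_add' := fun c d => by simp [MonoidAlgebra.single_add] }
    (fun g => MonoidAlgebra.single g⁻¹ (1 : ℂ))

theorem starHom_single (g : G) (c : ℂ) : starHom (single g c) = single g⁻¹ (star c) := by
  unfold starHom single
  refine (MonoidAlgebra.liftNC_single _ _ _ _).trans ?_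
  exact (MonoidAlgebra.single_mul_single _ _ _ _).trans (by simp)

theorem starHom_starHom (x : GroupAlgebra G) : starHom (starHom x) = x := by
  induction x using induction_linear with
  | h0 => simp
  | hadd x y hx hy => simp [hx, hy]
  | hs g c => simp [starHom_single]

theorem starHom_mul (x y : GroupAlgebra G) : starHom (x * y) = starHom y * starHom x := by
  induction x using induction_linear with
  | h0 => simp
  | hadd x x' hx hx' => simp [add_mul, mul_add, hx, hx']
  | hs g c =>
    induction y using induction_linear with
    | h0 => simp
    | hadd y y' hy hy' => simp [add_mul, mul_add, hy, hy']
    | hs h d => simp [starHom_single, single_mul_single, mul_comm]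

theorem starHom_smul (c : ℂ) (x : GroupAlgebra G) : starHom (c • x) = star c • starHom x := by
  induction x using induction_linear with
  | h0 => simp
  | hadd x y hx hy => simp [smul_add, hx, hy]
  | hs g d => simp [starHom_single, smul_single]

instance : StarRing (GroupAlgebra G) where
  star := starHom
  star_involutive := starHom_starHom
  star_mul := starHom_mul
  star_add := map_add starHom

instance : StarModule ℂ (GroupAlgebra G) where
  star_smul := starHom_smul

theorem star_single (g : G) (c : ℂ) : star (single g c) = single g⁻¹ (star c) :=
  starHom_single g c

section Lift

variable {A : Type u} [CStarAlgebra A] (π : G →* unitary A)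

/-- The linear extension `∑ x_g g ↦ ∑ x_g π(g)` of a unitary representation on a C⋆-algebra. -/
def lift : GroupAlgebra G →ₐ[ℂ] A :=
  MonoidAlgebra.lift ℂ A G ((unitary A).subtype.comp π)

theorem lift_single (g : G) (c : ℂ) : lift π (single g c) = c • (π g : A) :=
  MonoidAlgebra.lift_single _ _ _

theorem lift_star (x : GroupAlgebra G) : lift π (star x) = star (lift π x) := by
  induction x using induction_linear with
  | h0 => simp
  | hadd x y hx hy => simp [hx, hy]
  | hs g c =>
    rw [star_single, lift_single, lift_single, star_smul, map_inv]
    rfl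

end Lift

/-- All values `‖∑ x_g π(g)‖`, where `π` runs over the unitary representations of `G` on unital
C⋆-algebras. -/
def normSet (x : GroupAlgebra G) : Set ℝ :=
  {r | ∃ (A : Type u) (_ : CStarAlgebra A) (π : G →* unitary A), r = ‖lift π x‖}

theorem bddAbove_normSet (x : GroupAlgebra G) : BddAbove (normSet x) := by
  suffices h : ∃ C : ℝ, ∀ (A : Type u) (_ : CStarAlgebra A) (π : G →* unitary A),
      ‖lift π x‖ ≤ C by
    obtain ⟨C, hC⟩ := h
    exact ⟨C, by rintro r ⟨A, _, π, rfl⟩; exact hC A _ π⟩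
  induction x using induction_linear with
  | h0 => exact ⟨0, by intros; simp⟩
  | hadd x y hx hy =>
    obtain ⟨C, hC⟩ := hx
    obtain ⟨D, hD⟩ := hy
    refine ⟨C + D, fun A _ π => ?_⟩
    rw [map_add]
    exact (norm_add_le _ _).trans (add_le_add (hC A _ π) (hD A _ π))
  | hs g c =>
    refine ⟨‖c‖, fun A _ π => ?_⟩
    rw [lift_single, norm_smul]
    refine mul_le_of_le_one_right (norm_nonneg _) ?_
    rcases subsingleton_or_nontrivial A with h | h
    · rw [Subsingleton.elim ((π g : unitary A) : A) 0]; simp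
    · rw [CStarRing.norm_coe_unitary]

/-- The maximal C⋆-norm on the group algebra. -/
def maxNorm (x : GroupAlgebra G) : ℝ := sSup (normSet x)

theorem norm_lift_le {A : Type u} [CStarAlgebra A] (π : G →* unitary A) (x : GroupAlgebra G) :
    ‖lift π x‖ ≤ maxNorm x :=
  le_csSup (bddAbove_normSet x) ⟨A, _, π, rfl⟩

theorem maxNorm_le {x : GroupAlgebra G} {C : ℝ} (hC : 0 ≤ C)
    (h : ∀ (A : Type u) (_ : CStarAlgebra A) (π : G →* unitary A), ‖lift π x‖ ≤ C) :
    maxNorm x ≤ C :=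
  Real.sSup_le (by rintro r ⟨A, _, π, rfl⟩; exact h A _ π) hC

theorem maxNorm_nonneg (x : GroupAlgebra G) : 0 ≤ maxNorm x :=
  Real.sSup_nonneg (by rintro r ⟨A, _, π, rfl⟩; exact norm_nonneg _)

theorem maxNorm_zero : maxNorm (0 : GroupAlgebra G) = 0 :=
  le_antisymm (maxNorm_le le_rfl fun A _ π => by simp) (maxNorm_nonneg _)

theorem maxNorm_add_le (x y : GroupAlgebra G) : maxNorm (x + y) ≤ maxNorm x + maxNorm y :=
  maxNorm_le (add_nonneg (maxNorm_nonneg _) (maxNorm_nonneg _)) fun A _ π => by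
    rw [map_add]
    exact (norm_add_le _ _).trans (add_le_add (norm_lift_le π x) (norm_lift_le π y))

theorem maxNorm_neg (x : GroupAlgebra G) : maxNorm (-x) = maxNorm x := by
  simp [maxNorm, normSet]

theorem maxNorm_mul_le (x y : GroupAlgebra G) : maxNorm (x * y) ≤ maxNorm x * maxNorm y :=
  maxNorm_le (mul_nonneg (maxNorm_nonneg _) (maxNorm_nonneg _)) fun A _ π => by
    rw [map_mul]
    exact (norm_mul_le _ _).trans
      (mul_le_mul (norm_lift_le π x) (norm_lift_le π y) (norm_nonneg _) (maxNorm_nonneg _))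

theorem maxNorm_smul_le (c : ℂ) (x : GroupAlgebra G) : maxNorm (c • x) ≤ ‖c‖ * maxNorm x :=
  maxNorm_le (mul_nonneg (norm_nonneg _) (maxNorm_nonneg _)) fun A _ π => by
    rw [map_smul, norm_smul]
    exact mul_le_mul_of_nonneg_left (norm_lift_le π x) (norm_nonneg _)

theorem maxNorm_star (x : GroupAlgebra G) : maxNorm (star x) = maxNorm x := by
  simp [maxNorm, normSet, lift_star]

theorem maxNorm_mul_self_le (x : GroupAlgebra G) :
    maxNorm x * maxNorm x ≤ maxNorm (star x * x) := by
  have h : maxNorm x ≤ Real.sqrt (maxNorm (star x * x)) :=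
    maxNorm_le (Real.sqrt_nonneg _) fun A _ π => by
      refine Real.le_sqrt_of_sq_le ?_
      rw [sq, ← CStarRing.norm_star_mul_self, ← lift_star, ← map_mul]
      exact norm_lift_le π _
  calc maxNorm x * maxNorm x
      ≤ Real.sqrt (maxNorm (star x * x)) * Real.sqrt (maxNorm (star x * x)) :=
        mul_self_le_mul_self (maxNorm_nonneg _) h
    _ = maxNorm (star x * x) := Real.mul_self_sqrt (maxNorm_nonneg _)

instance : SeminormedAddCommGroup (GroupAlgebra G) :=
  AddGroupSeminorm.toSeminormedAddCommGroup
    { toFun := maxNorm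
      map_zero' := maxNorm_zero
      add_le' := maxNorm_add_le
      neg' := maxNorm_neg }

theorem norm_def (x : GroupAlgebra G) : ‖x‖ = maxNorm x := rfl

instance : SeminormedRing (GroupAlgebra G) where
  __ := (inferInstance : SeminormedAddCommGroup (GroupAlgebra G))
  __ := (inferInstance : Ring (GroupAlgebra G))
  norm_mul_le := maxNorm_mul_le

instance : NormedAlgebra ℂ (GroupAlgebra G) where
  norm_smul_le := maxNorm_smul_le

instance : NormedStarGroup (GroupAlgebra G) where
  norm_star_le x := (maxNorm_star x).le

variable (G) in
/-- The maximal group C⋆-algebra `C⋆(G)`: the (Hausdorff) completion of `ℂ[G]` in the maximal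
C⋆-norm. -/
abbrev GroupCStar : Type u := UniformSpace.Completion (GroupAlgebra G)

open UniformSpace

instance : Star (GroupCStar G) where
  star := Completion.map star

theorem uniformContinuous_star' : UniformContinuous (star : GroupAlgebra G → GroupAlgebra G) :=
  star_isometry.uniformContinuous

theorem coe_star (x : GroupAlgebra G) : ((star x : GroupAlgebra G) : GroupCStar G) = star ↑x :=
  (Completion.map_coe uniformContinuous_star' x).symm

theorem continuous_star' : Continuous (star : GroupCStar G → GroupCStar G) :=
  Completion.continuous_map

instance : StarRing (GroupCStar G) where
  star_involutive x := by
    induction x using Completion.induction_on with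
    | hp => exact isClosed_eq (continuous_star'.comp continuous_star') continuous_id
    | ih x => rw [← coe_star, ← coe_star, star_star]
  star_mul x y := by
    induction x, y using Completion.induction_on₂ with
    | hp =>
      exact isClosed_eq (continuous_star'.comp continuous_mul)
        ((continuous_star'.comp continuous_snd).mul (continuous_star'.comp continuous_fst))
    | ih x y =>
      rw [← Completion.coe_mul, ← coe_star, ← coe_star, ← coe_star, star_mul, Completion.coe_mul]
  star_add x y := by
    induction x, y using Completion.induction_on₂ with
    | hp =>
      exact isClosed_eq (continuous_star'.comp continuous_add)
        ((continuous_star'.comp continuous_fst).add (continuous_star'.comp continuous_snd))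
    | ih x y =>
      rw [← Completion.coe_add, ← coe_star, ← coe_star, ← coe_star, star_add, Completion.coe_add]

instance : CStarAlgebra (GroupCStar G) where
  norm_mul_self_le x := by
    induction x using Completion.induction_on with
    | hp =>
      exact isClosed_le (continuous_norm.mul continuous_norm)
        (continuous_norm.comp (continuous_star'.mul continuous_id))
    | ih x =>
      rw [← coe_star, ← Completion.coe_mul, Completion.norm_coe, Completion.norm_coe]
      exact maxNorm_mul_self_le x
  norm_smul_le := norm_smul_le
  star_smul c x := by
    induction x using Completion.induction_on with
    | hp =>
      exact isClosed_eq (continuous_star'.comp (continuous_const_smul c))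
        ((continuous_const_smul (star c)).comp continuous_star')
    | ih x => rw [← Completion.coe_smul, ← coe_star, ← coe_star, star_smul, Completion.coe_smul]

end MaxGroup

/-! ### Tensor products of Hilbert spaces and C⋆-norms on algebraic tensor products -/

namespace TensorNorm

universe u

/-- The tensor product of two Hilbert spaces: the completion of the algebraic tensor product in the
inner product with `⟪x ⊗ y, x' ⊗ y'⟫ = ⟪x, x'⟫ ⟪y, y'⟫`. -/
abbrev HilbertTensor (E F : Type*) [NormedAddCommGroup E] [InnerProductSpace ℂ E]
    [NormedAddCommGroup F] [InnerProductSpace ℂ F] : Type _ :=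
  UniformSpace.Completion (E ⊗[ℂ] F)

section OpTensor

variable {E F : Type*} [NormedAddCommGroup E] [InnerProductSpace ℂ E]
  [NormedAddCommGroup F] [InnerProductSpace ℂ F]

/-- The operator `S ⊗ T` on the tensor product of two Hilbert spaces. -/
def opTensor (S : E →L[ℂ] E) (T : F →L[ℂ] F) : HilbertTensor E F →L[ℂ] HilbertTensor E F :=
  (TensorProduct.mapL S T).completion

theorem opTensor_coe (S : E →L[ℂ] E) (T : F →L[ℂ] F) (z : E ⊗[ℂ] F) :
    opTensor S T (z : HilbertTensor E F) =
      ((TensorProduct.map S.toLinearMap T.toLinearMap z : E ⊗[ℂ] F) : HilbertTensor E F) := by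
  refine ((TensorProduct.mapL S T).completion_apply_coe z).trans ?_
  rw [TensorProduct.mapL_apply]

theorem ext_coe {P Q : HilbertTensor E F →L[ℂ] HilbertTensor E F}
    (h : ∀ z : E ⊗[ℂ] F, P z = Q z) : P = Q := by
  ext z
  induction z using UniformSpace.Completion.induction_on with
  | hp => exact isClosed_eq P.continuous Q.continuous
  | ih z => exact h z

variable (E F) in
/-- The bilinear map `(S, T) ↦ S ⊗ T`. -/
def opTensorBilin : (E →L[ℂ] E) →ₗ[ℂ] (F →L[ℂ] F) →ₗ[ℂ]
    (HilbertTensor E F →L[ℂ] HilbertTensor E F) :=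
  LinearMap.mk₂ ℂ opTensor
    (fun S S' T => ext_coe fun z => by
      simp [opTensor_coe, TensorProduct.map_add_left, UniformSpace.Completion.coe_add])
    (fun c S T => ext_coe fun z => by
      simp [opTensor_coe, TensorProduct.map_smul_left, UniformSpace.Completion.coe_smul])
    (fun S T T' => ext_coe fun z => by
      simp [opTensor_coe, TensorProduct.map_add_right, UniformSpace.Completion.coe_add])
    (fun c S T => ext_coe fun z => by
      simp [opTensor_coe, TensorProduct.map_smul_right, UniformSpace.Completion.coe_smul])

end OpTensor

variable {A B : Type u} [CStarAlgebra A] [CStarAlgebra B]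

/-- The representation `∑ aᵢ ⊗ bᵢ ↦ ∑ π(aᵢ) ⊗ σ(bᵢ)` of the algebraic tensor product on the Hilbert
space tensor product. -/
def spatialRep {H K : Type u} [NormedAddCommGroup H] [InnerProductSpace ℂ H] [CompleteSpace H]
    [NormedAddCommGroup K] [InnerProductSpace ℂ K] [CompleteSpace K]
    (π : A →⋆ₐ[ℂ] (H →L[ℂ] H)) (σ : B →⋆ₐ[ℂ] (K →L[ℂ] K)) :
    A ⊗[ℂ] B →ₗ[ℂ] (HilbertTensor H K →L[ℂ] HilbertTensor H K) :=
  TensorProduct.lift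
    ((opTensorBilin H K).compl₁₂ π.toAlgHom.toLinearMap σ.toAlgHom.toLinearMap)

/-- The minimal (spatial) C⋆-norm on `A ⊗ B`: the norm of `∑ π(aᵢ) ⊗ σ(bᵢ)` in the bounded operators
on `H ⊗ K`, for `π`, `σ` arbitrary representations; the supremum is attained at every pair of
faithful representations. -/
def minNorm (x : A ⊗[ℂ] B) : ℝ :=
  sSup {r | ∃ (H : Type u) (_ : NormedAddCommGroup H) (_ : InnerProductSpace ℂ H)
    (_ : CompleteSpace H) (K : Type u) (_ : NormedAddCommGroup K) (_ : InnerProductSpace ℂ K)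
    (_ : CompleteSpace K) (π : A →⋆ₐ[ℂ] (H →L[ℂ] H)) (σ : B →⋆ₐ[ℂ] (K →L[ℂ] K)),
    r = ‖spatialRep π σ x‖}

/-- The maximal C⋆-norm on `A ⊗ B`: the supremum of `‖∑ π(aᵢ) σ(bᵢ)‖` over all pairs of
representations `π`, `σ` on a common Hilbert space with commuting ranges. -/
def maxNorm (x : A ⊗[ℂ] B) : ℝ :=
  sSup {r | ∃ (H : Type u) (_ : NormedAddCommGroup H) (_ : InnerProductSpace ℂ H)
    (_ : CompleteSpace H) (π : A →⋆ₐ[ℂ] (H →L[ℂ] H)) (σ : B →⋆ₐ[ℂ] (H →L[ℂ] H))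
    (h : ∀ a b, Commute (π a) (σ b)),
    r = ‖Algebra.TensorProduct.lift π.toAlgHom σ.toAlgHom h x‖}

variable (A B) in
/-- `A ⊗_min B = A ⊗_max B`: the two C⋆-norms on the algebraic tensor product, whose completions are
`A ⊗_min B` and `A ⊗_max B`, coincide. -/
def MinEqMax : Prop := ∀ x : A ⊗[ℂ] B, minNorm x = maxNorm x

end TensorNorm

/-! ### Bell scenarios, bipartite steering data and steering games -/

namespace Steering

open TensorNorm

/-- The group `ℤ_m ∗ ⋯ ∗ ℤ_m` (`k` factors) of the Bell scenario with `k` settings and `m` outcomes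
per party. -/
abbrev BellGroup (k m : ℕ) : Type := Monoid.CoprodI fun _ : Fin k => Multiplicative (ZMod m)

/-- The QWEP conjecture `C⋆(𝔽₂) ⊗_min C⋆(𝔽₂) = C⋆(𝔽₂) ⊗_max C⋆(𝔽₂)`. -/
def QWEP : Prop :=
  MinEqMax (MaxGroup.GroupCStar (FreeGroup (Fin 2))) (MaxGroup.GroupCStar (FreeGroup (Fin 2)))

/-- `A x a` (`x` the setting, `a` the outcome) is a family of POVMs on `H`. -/
def IsPOVMFamily {k m : ℕ} {H : Type} [NormedAddCommGroup H] [InnerProductSpace ℂ H]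
    [CompleteSpace H] (A : Fin k → Fin m → H →L[ℂ] H) : Prop :=
  (∀ x a, (A x a).IsPositive) ∧ ∀ x, ∑ a, A x a = 1

/-- A family `(α x a)`, `(β y b)` of linear functionals on `M_d(ℂ)`, with the product of the
topologies of pointwise convergence. -/
abbrev FunctionalFamily (k m d : ℕ) : Type :=
  (Fin k → Fin m → WeakDual ℂ (Matrix (Fin d) (Fin d) ℂ)) ×
    (Fin k → Fin m → WeakDual ℂ (Matrix (Fin d) (Fin d) ℂ))

/-- Bipartite steering data on `M_d(ℂ)` with the tensor product assumption:
`α x a (V) = ⟪ψ, (V ⊗ A x a ⊗ 1) ψ⟫` and `β y b (W) = ⟪ψ, (W ⊗ 1 ⊗ B y b) ψ⟫` for a unit vector `ψ`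
of `ℂ^d ⊗ H_A ⊗ H_B`. -/
def tensorData (k m d : ℕ) : Set (FunctionalFamily k m d) :=
  {s | ∃ (HA : Type) (_ : NormedAddCommGroup HA) (_ : InnerProductSpace ℂ HA)
    (_ : CompleteSpace HA) (HB : Type) (_ : NormedAddCommGroup HB) (_ : InnerProductSpace ℂ HB)
    (_ : CompleteSpace HB) (A : Fin k → Fin m → HA →L[ℂ] HA) (B : Fin k → Fin m → HB →L[ℂ] HB)
    (ψ : HilbertTensor (EuclideanSpace ℂ (Fin d)) (HilbertTensor HA HB)),
    IsPOVMFamily A ∧ IsPOVMFamily B ∧ ‖ψ‖ = 1 ∧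
    (∀ x a (V : Matrix (Fin d) (Fin d) ℂ), s.1 x a V =
      inner ℂ ψ (opTensor (Matrix.toEuclideanCLM (𝕜 := ℂ) V) (opTensor (A x a) 1) ψ)) ∧
    (∀ y b (W : Matrix (Fin d) (Fin d) ℂ), s.2 y b W =
      inner ℂ ψ (opTensor (Matrix.toEuclideanCLM (𝕜 := ℂ) W) (opTensor 1 (B y b)) ψ))}

/-- Bipartite steering data on `M_d(ℂ)` with the commutativity assumption:
`α x a (V) = ⟪ψ, (V ⊗ A x a) ψ⟫` and `β y b (W) = ⟪ψ, (W ⊗ B y b) ψ⟫` for a unit vector `ψ` of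
`ℂ^d ⊗ H`, where every `A x a` commutes with every `B y b`. -/
def commutingData (k m d : ℕ) : Set (FunctionalFamily k m d) :=
  {s | ∃ (H : Type) (_ : NormedAddCommGroup H) (_ : InnerProductSpace ℂ H)
    (_ : CompleteSpace H) (A : Fin k → Fin m → H →L[ℂ] H) (B : Fin k → Fin m → H →L[ℂ] H)
    (ψ : HilbertTensor (EuclideanSpace ℂ (Fin d)) H),
    IsPOVMFamily A ∧ IsPOVMFamily B ∧ (∀ x y a b, A x a * B y b = B y b * A x a) ∧ ‖ψ‖ = 1 ∧
    (∀ x a (V : Matrix (Fin d) (Fin d) ℂ), s.1 x a V =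
      inner ℂ ψ (opTensor (Matrix.toEuclideanCLM (𝕜 := ℂ) V) (A x a) ψ)) ∧
    (∀ y b (W : Matrix (Fin d) (Fin d) ℂ), s.2 y b W =
      inner ℂ ψ (opTensor (Matrix.toEuclideanCLM (𝕜 := ℂ) W) (B y b) ψ))}

/-- The total score `∑ α x a (V x a) + ∑ β y b (W y b)`; it is a real number for hermitian `V`, `W`
and positive functionals. -/
def score {k m d : ℕ} (V W : Fin k → Fin m → Matrix (Fin d) (Fin d) ℂ)
    (s : FunctionalFamily k m d) : ℝ :=
  (∑ x, ∑ a, s.1 x a (V x a) + ∑ y, ∑ b, s.2 y b (W y b)).re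

/-- The tensor product value of the bipartite steering game `(V, W)`. -/
def tensorValue {k m d : ℕ} (V W : Fin k → Fin m → Matrix (Fin d) (Fin d) ℂ) : ℝ :=
  1 / (2 * (k : ℝ)) * sSup (score V W '' tensorData k m d)

/-- The commutative value of the bipartite steering game `(V, W)`; the set of scores is compact, so
the supremum is a maximum. -/
def commutativeValue {k m d : ℕ} (V W : Fin k → Fin m → Matrix (Fin d) (Fin d) ℂ) : ℝ :=
  1 / (2 * (k : ℝ)) * sSup (score V W '' commutingData k m d)

end Steering

end

/-!
The four statements are proved in a cycle: the equality of the norms for the free group gives the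
equality of the values of all steering games, this gives the density of the tensor product data in
the commuting data, this gives the equality of the norms for the group `Γ` of the Bell scenario, and
this in turn gives the equality of the norms for the free group.

Two reductions are used throughout. A vector of `ℂ^d ⊗ H` is a family of `d` vectors of `H`, so
steering data are just matrix coefficients `⟪ψ i, A x a (ψ j)⟫` (`mem_tensorData_iff`,
`mem_commutingData_iff`). And measurements can be taken projective: a Naimark dilation makes the
measurements of one party projective and extends their commutant, which contains the measurements of
the other party, to the larger space (`exists_pvm_dilation`). A projective measurement with `m`
outcomes is the same as a unitary whose `m`-th power is `1` (`pvmUnitary`, `effect`). For an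
arbitrary unitary `u` the elements `effect m u a` still form a measurement, so every representation
of a group with `k` chosen elements yields `k` measurements.

*Equal norms for the free group imply equal values* (`tensorValue_eq_of_qwep`). The words
`b⁻ˣ a bˣ` restrict to arbitrary unitaries `u x` on one of `k` copies of `H` in a suitable
representation of `𝔽₂`, so that a commuting model comes from two commuting representations of
`C⋆(𝔽₂)` (`exists_freeGroup_model`), and the score of a game is a value of the quadratic form of a
matrix over `C⋆(𝔽₂) ⊗ C⋆(𝔽₂)`. The hypothesis is about elements of the tensor product and not about
matrices, but the norm of a self-adjoint matrix is determined by the growth of the entries of its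
powers (`MinEqMax.norm_commMat_le`), hence the upper bound for the score in the spatial
representations holds in all commuting representations (`MinEqMax.numericalRange_le`).

*Equal values imply density* (`closure_tensorData_eq`). The set of commuting data is closed, because
a limit is realised in an ultraproduct of Hilbert spaces (`isClosed_commutingData`). The set of
tensor product data is convex, because of direct sums (`convex_coords_tensorData`). If a commuting
datum were not in the closure of the tensor product data, a linear functional would separate it
strictly from them; the hermitian part of the functional is a game with different values.

*Density implies equal norms for `Γ`* (`minEqMax_bellGroup_of_closure`). Given commuting
representations `π` and `σ` of `Γ` and a vector `ψ`, consider for finitely many `(g, h)` the vectors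
`π(g) σ(h) ψ` and the spectral measurements of the generators. The resulting steering data determine
the Gram matrix of these vectors and the matrix coefficients of the generators, and by density both
are approximated by those of vectors `Φ(g, h)` for a tensor product of two representations
`π'`, `σ'` of `Γ` (`exists_tensor_model_near`). Since unitaries preserve norms, the matrix
coefficients force `Φ(g, h)` to be close to `(π'(g) ⊗ σ'(h)) Φ(1, 1)`. So the norm of a linear
combination of the vectors `π(g) σ(h) ψ` is bounded through the minimal norm, and combinations of
group elements are dense (`MinEqMax.of_span`).

*Equal norms for `Γ` imply equal norms for `𝔽₂`* (`qwep_of_minEqMax_bellGroup`). The group `Γ` acts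
on `ℤ_m`-indexed copies of `H` by shifts conjugated with diagonal unitaries. As `(k, m) ≠ (2, 2)`,
there are two words in `Γ` that for a suitable choice of the diagonal unitaries restrict to two
arbitrary unitaries on the copy with index `0`; these unitaries are the images of the generators in
an arbitrary representation of `𝔽₂`, whose commutant acts diagonally. Thus every commuting pair of
representations of `𝔽₂` is contained in the restriction of a commuting pair of representations of
`Γ`, and equality of the norms passes from `Γ` to `𝔽₂` (`MinEqMax.of_extension`).
-/

noncomputable section

set_option linter.unusedSectionVars false

/-! ### Operators between tensor products of Hilbert spaces -/

namespace TensorNorm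

section TensorMap

variable {E F E' F' E'' F'' : Type*} [NormedAddCommGroup E] [InnerProductSpace ℂ E]
  [NormedAddCommGroup F] [InnerProductSpace ℂ F]
  [NormedAddCommGroup E'] [InnerProductSpace ℂ E']
  [NormedAddCommGroup F'] [InnerProductSpace ℂ F']
  [NormedAddCommGroup E''] [InnerProductSpace ℂ E'']
  [NormedAddCommGroup F''] [InnerProductSpace ℂ F'']

/-- The elementary tensor `x ⊗ y` in the tensor product of two Hilbert spaces. -/
def elemTensor (x : E) (y : F) : HilbertTensor E F := ((x ⊗ₜ[ℂ] y : E ⊗[ℂ] F) : HilbertTensor E F)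

theorem inner_elemTensor (x x' : E) (y y' : F) :
    inner ℂ (elemTensor x y) (elemTensor x' y') = inner ℂ x x' * inner ℂ y y' := by
  simp [elemTensor, UniformSpace.Completion.inner_coe]

theorem ext_elemTensor {G : Type*} [NormedAddCommGroup G] [NormedSpace ℂ G]
    {P Q : HilbertTensor E F →L[ℂ] G}
    (h : ∀ x y, P (elemTensor x y) = Q (elemTensor x y)) : P = Q := by
  ext z
  induction z using UniformSpace.Completion.induction_on with
  | hp => exact isClosed_eq P.continuous Q.continuous
  | ih z =>
    induction z using TensorProduct.induction_on with
    | zero => rw [UniformSpace.Completion.coe_zero, map_zero, map_zero]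
    | tmul x y => exact h x y
    | add z w hz hw => rw [UniformSpace.Completion.coe_add, map_add, map_add, hz, hw]

/-- The operator `S ⊗ T` between two Hilbert space tensor products. -/
def tensorMap (S : E →L[ℂ] E') (T : F →L[ℂ] F') : HilbertTensor E F →L[ℂ] HilbertTensor E' F' :=
  (TensorProduct.mapL S T).completion

theorem tensorMap_elemTensor (S : E →L[ℂ] E') (T : F →L[ℂ] F') (x : E) (y : F) :
    tensorMap S T (elemTensor x y) = elemTensor (S x) (T y) := by
  simp [tensorMap, elemTensor]

theorem opTensor_eq_tensorMap (S : E →L[ℂ] E) (T : F →L[ℂ] F) : opTensor S T = tensorMap S T := rfl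

theorem opTensor_elemTensor (S : E →L[ℂ] E) (T : F →L[ℂ] F) (x : E) (y : F) :
    opTensor S T (elemTensor x y) = elemTensor (S x) (T y) :=
  tensorMap_elemTensor S T x y

theorem tensorMap_tensorMap (S' : E' →L[ℂ] E'') (T' : F' →L[ℂ] F'') (S : E →L[ℂ] E')
    (T : F →L[ℂ] F') (z : HilbertTensor E F) :
    tensorMap S' T' (tensorMap S T z) = tensorMap (S' ∘L S) (T' ∘L T) z := by
  have : tensorMap S' T' ∘L tensorMap S T = tensorMap (S' ∘L S) (T' ∘L T) :=
    ext_elemTensor fun x y => by simp [tensorMap_elemTensor]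
  exact DFunLike.congr_fun this z

theorem opTensor_mul (S S' : E →L[ℂ] E) (T T' : F →L[ℂ] F) :
    opTensor S T * opTensor S' T' = opTensor (S * S') (T * T') := by
  ext z
  exact tensorMap_tensorMap S T S' T' z

theorem opTensor_one : opTensor (1 : E →L[ℂ] E) (1 : F →L[ℂ] F) = 1 :=
  ext_elemTensor fun x y => by simp [opTensor_elemTensor]

theorem opTensor_add_left (S S' : E →L[ℂ] E) (T : F →L[ℂ] F) :
    opTensor (S + S') T = opTensor S T + opTensor S' T :=
  (opTensorBilin E F).map_add₂ S S' T

theorem opTensor_add_right (S : E →L[ℂ] E) (T T' : F →L[ℂ] F) :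
    opTensor S (T + T') = opTensor S T + opTensor S T' :=
  (opTensorBilin E F S).map_add T T'

theorem opTensor_smul_left (c : ℂ) (S : E →L[ℂ] E) (T : F →L[ℂ] F) :
    opTensor (c • S) T = c • opTensor S T :=
  (opTensorBilin E F).map_smul₂ c S T

theorem opTensor_smul_right (c : ℂ) (S : E →L[ℂ] E) (T : F →L[ℂ] F) :
    opTensor S (c • T) = c • opTensor S T :=
  (opTensorBilin E F S).map_smul c T

variable [CompleteSpace E] [CompleteSpace F] [CompleteSpace E'] [CompleteSpace F']

theorem inner_tensorMap_left (S : E →L[ℂ] E') (T : F →L[ℂ] F') (z : HilbertTensor E F)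
    (w : HilbertTensor E' F') :
    inner ℂ (tensorMap S T z) w = inner ℂ z (tensorMap S.adjoint T.adjoint w) := by
  induction z, w using UniformSpace.Completion.induction_on₂ with
  | hp => exact isClosed_eq (by fun_prop) (by fun_prop)
  | ih z w =>
    induction z using TensorProduct.induction_on with
    | zero => rw [UniformSpace.Completion.coe_zero, map_zero, inner_zero_left, inner_zero_left]
    | add z z' hz hz' =>
      simp only [UniformSpace.Completion.coe_add, map_add, inner_add_left, hz, hz']
    | tmul x y =>
      induction w using TensorProduct.induction_on with
      | zero =>
        rw [UniformSpace.Completion.coe_zero, map_zero, inner_zero_right, inner_zero_right]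
      | add z z' hz hz' =>
        simp only [UniformSpace.Completion.coe_add, map_add, inner_add_right, hz, hz']
      | tmul x' y' =>
        change inner ℂ (tensorMap S T (elemTensor x y)) (elemTensor x' y') =
          inner ℂ (elemTensor x y) (tensorMap S.adjoint T.adjoint (elemTensor x' y'))
        simp only [tensorMap_elemTensor, inner_elemTensor, ContinuousLinearMap.adjoint_inner_right]

theorem inner_tensorMap_tensorMap (S : E →L[ℂ] E') (T : F →L[ℂ] F')
    (P : E' →L[ℂ] E') (Q : F' →L[ℂ] F') (z w : HilbertTensor E F) :
    inner ℂ (tensorMap S T z) (opTensor P Q (tensorMap S T w)) =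
      inner ℂ z (opTensor (S.adjoint ∘L P ∘L S) (T.adjoint ∘L Q ∘L T) w) := by
  rw [inner_tensorMap_left, opTensor_eq_tensorMap, tensorMap_tensorMap, tensorMap_tensorMap]
  rfl

theorem adjoint_opTensor (S : E →L[ℂ] E) (T : F →L[ℂ] F) :
    star (opTensor S T) = opTensor (star S) (star T) := by
  rw [ContinuousLinearMap.star_eq_adjoint]
  refine ((ContinuousLinearMap.eq_adjoint_iff _ _).2 fun x y => ?_).symm
  rw [opTensor_eq_tensorMap, inner_tensorMap_left]
  simp [ContinuousLinearMap.star_eq_adjoint, opTensor_eq_tensorMap]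

end TensorMap

section Ampliation

variable (H K : Type*) [NormedAddCommGroup H] [InnerProductSpace ℂ H] [CompleteSpace H]
  [NormedAddCommGroup K] [InnerProductSpace ℂ K] [CompleteSpace K]

/-- The ampliation `S ↦ S ⊗ 1`. -/
def ampLeft : (H →L[ℂ] H) →⋆ₐ[ℂ] (HilbertTensor H K →L[ℂ] HilbertTensor H K) where
  toFun S := opTensor S 1
  map_one' := opTensor_one
  map_mul' S S' := by rw [opTensor_mul, one_mul]
  map_zero' := by rw [← zero_smul ℂ (0 : H →L[ℂ] H), opTensor_smul_left, zero_smul]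
  map_add' S S' := opTensor_add_left S S' 1
  commutes' c := by
    rw [Algebra.algebraMap_eq_smul_one, opTensor_smul_left, opTensor_one,
      Algebra.algebraMap_eq_smul_one]
  map_star' S := by rw [adjoint_opTensor, star_one]

/-- The ampliation `T ↦ 1 ⊗ T`. -/
def ampRight : (K →L[ℂ] K) →⋆ₐ[ℂ] (HilbertTensor H K →L[ℂ] HilbertTensor H K) where
  toFun T := opTensor 1 T
  map_one' := opTensor_one
  map_mul' S S' := by rw [opTensor_mul, one_mul]
  map_zero' := by rw [← zero_smul ℂ (0 : K →L[ℂ] K), opTensor_smul_right, zero_smul]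
  map_add' S S' := opTensor_add_right 1 S S'
  commutes' c := by
    rw [Algebra.algebraMap_eq_smul_one, opTensor_smul_right, opTensor_one,
      Algebra.algebraMap_eq_smul_one]
  map_star' S := by rw [adjoint_opTensor, star_one]

variable {H K}

theorem ampLeft_apply (S : H →L[ℂ] H) : ampLeft H K S = opTensor S 1 := rfl

theorem ampRight_apply (T : K →L[ℂ] K) : ampRight H K T = opTensor 1 T := rfl

theorem ampLeft_mul_ampRight (S : H →L[ℂ] H) (T : K →L[ℂ] K) :
    ampLeft H K S * ampRight H K T = opTensor S T := by
  rw [ampLeft_apply, ampRight_apply, opTensor_mul, one_mul, mul_one]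

theorem commute_amp (S : H →L[ℂ] H) (T : K →L[ℂ] K) :
    Commute (ampLeft H K S) (ampRight H K T) := by
  rw [Commute, SemiconjBy, ampLeft_mul_ampRight, ampLeft_apply, ampRight_apply, opTensor_mul,
    one_mul, mul_one]

end Ampliation

/-! ### The minimal and the maximal norm on an algebraic tensor product -/

universe u

variable {A B : Type u} [CStarAlgebra A] [CStarAlgebra B]

section Rep

variable {H : Type u} [NormedAddCommGroup H] [InnerProductSpace ℂ H] [CompleteSpace H]

/-- The representation `a ⊗ b ↦ π(a) σ(b)` of the algebraic tensor product given by two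
representations with commuting ranges. -/
def commRep (π : A →⋆ₐ[ℂ] (H →L[ℂ] H)) (σ : B →⋆ₐ[ℂ] (H →L[ℂ] H))
    (h : ∀ a b, Commute (π a) (σ b)) : A ⊗[ℂ] B →ₐ[ℂ] (H →L[ℂ] H) :=
  Algebra.TensorProduct.lift π.toAlgHom σ.toAlgHom h

theorem commRep_tmul (π : A →⋆ₐ[ℂ] (H →L[ℂ] H)) (σ : B →⋆ₐ[ℂ] (H →L[ℂ] H))
    (h : ∀ a b, Commute (π a) (σ b)) (a : A) (b : B) :
    commRep π σ h (a ⊗ₜ b) = π a * σ b :=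
  Algebra.TensorProduct.lift_tmul _ _ _ _ _

theorem norm_starHom_le {C : Type u} [CStarAlgebra C] (π : C →⋆ₐ[ℂ] (H →L[ℂ] H)) (a : C) :
    ‖π a‖ ≤ ‖a‖ :=
  NonUnitalStarAlgHom.norm_apply_le π a

/-- All representations with commuting ranges are bounded on a given tensor by one constant. -/
theorem exists_commRep_bound (x : A ⊗[ℂ] B) : ∃ C : ℝ, ∀ (H : Type u) (_ : NormedAddCommGroup H)
    (_ : InnerProductSpace ℂ H) (_ : CompleteSpace H) (π : A →⋆ₐ[ℂ] (H →L[ℂ] H))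
    (σ : B →⋆ₐ[ℂ] (H →L[ℂ] H)) (h : ∀ a b, Commute (π a) (σ b)), ‖commRep π σ h x‖ ≤ C := by
  induction x using TensorProduct.induction_on with
  | zero => exact ⟨0, by intros; simp⟩
  | tmul a b =>
    refine ⟨‖a‖ * ‖b‖, fun H _ _ _ π σ h => ?_⟩
    rw [commRep_tmul]
    exact (norm_mul_le _ _).trans (mul_le_mul (norm_starHom_le π a) (norm_starHom_le σ b)
      (norm_nonneg _) (norm_nonneg _))
  | add x y hx hy =>
    obtain ⟨C, hC⟩ := hx
    obtain ⟨D, hD⟩ := hy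
    refine ⟨C + D, fun H _ _ _ π σ h => ?_⟩
    rw [map_add]
    exact (norm_add_le _ _).trans (add_le_add (hC H _ _ _ π σ h) (hD H _ _ _ π σ h))

theorem norm_commRep_le_maxNorm (π : A →⋆ₐ[ℂ] (H →L[ℂ] H)) (σ : B →⋆ₐ[ℂ] (H →L[ℂ] H))
    (h : ∀ a b, Commute (π a) (σ b)) (x : A ⊗[ℂ] B) : ‖commRep π σ h x‖ ≤ maxNorm x := by
  obtain ⟨C, hC⟩ := exists_commRep_bound x
  refine le_csSup ⟨C, ?_⟩ ⟨H, _, _, _, π, σ, h, rfl⟩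
  rintro r ⟨H, _, _, _, π, σ, h, rfl⟩
  exact hC H _ _ _ π σ h

theorem maxNorm_le {x : A ⊗[ℂ] B} {C : ℝ} (hC : 0 ≤ C) (hx : ∀ (H : Type u)
    (_ : NormedAddCommGroup H) (_ : InnerProductSpace ℂ H) (_ : CompleteSpace H)
    (π : A →⋆ₐ[ℂ] (H →L[ℂ] H)) (σ : B →⋆ₐ[ℂ] (H →L[ℂ] H)) (h : ∀ a b, Commute (π a) (σ b)),
    ‖commRep π σ h x‖ ≤ C) : maxNorm x ≤ C :=
  Real.sSup_le (by rintro r ⟨H, _, _, _, π, σ, h, rfl⟩; exact hx H _ _ _ π σ h) hC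

theorem maxNorm_nonneg (x : A ⊗[ℂ] B) : 0 ≤ maxNorm x :=
  Real.sSup_nonneg (by rintro r ⟨H, _, _, _, π, σ, h, rfl⟩; exact norm_nonneg _)

variable {K : Type u} [NormedAddCommGroup K] [InnerProductSpace ℂ K] [CompleteSpace K]

theorem commute_spatial (π : A →⋆ₐ[ℂ] (H →L[ℂ] H)) (σ : B →⋆ₐ[ℂ] (K →L[ℂ] K)) (a : A) (b : B) :
    Commute ((ampLeft H K).comp π a) ((ampRight H K).comp σ b) :=
  commute_amp _ _

/-- A spatial representation is the representation given by the two ampliations. -/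
theorem spatialRep_eq_commRep (π : A →⋆ₐ[ℂ] (H →L[ℂ] H)) (σ : B →⋆ₐ[ℂ] (K →L[ℂ] K))
    (x : A ⊗[ℂ] B) : spatialRep π σ x =
      commRep ((ampLeft H K).comp π) ((ampRight H K).comp σ) (commute_spatial π σ) x := by
  induction x using TensorProduct.induction_on with
  | zero => simp
  | add x y hx hy => rw [map_add, map_add, hx, hy]
  | tmul a b =>
    rw [commRep_tmul]
    exact (ampLeft_mul_ampRight _ _).symm

theorem norm_spatialRep_le_maxNorm (π : A →⋆ₐ[ℂ] (H →L[ℂ] H)) (σ : B →⋆ₐ[ℂ] (K →L[ℂ] K))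
    (x : A ⊗[ℂ] B) : ‖spatialRep π σ x‖ ≤ maxNorm x := by
  rw [spatialRep_eq_commRep]
  exact norm_commRep_le_maxNorm _ _ _ x

theorem norm_spatialRep_le_minNorm (π : A →⋆ₐ[ℂ] (H →L[ℂ] H)) (σ : B →⋆ₐ[ℂ] (K →L[ℂ] K))
    (x : A ⊗[ℂ] B) : ‖spatialRep π σ x‖ ≤ minNorm x := by
  refine le_csSup ⟨maxNorm x, ?_⟩ ⟨H, _, _, _, K, _, _, _, π, σ, rfl⟩
  rintro r ⟨H, _, _, _, K, _, _, _, π, σ, rfl⟩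
  exact norm_spatialRep_le_maxNorm π σ x

end Rep

theorem minNorm_le {x : A ⊗[ℂ] B} {C : ℝ} (hC : 0 ≤ C) (hx : ∀ (H : Type u)
    (_ : NormedAddCommGroup H) (_ : InnerProductSpace ℂ H) (_ : CompleteSpace H)
    (K : Type u) (_ : NormedAddCommGroup K) (_ : InnerProductSpace ℂ K) (_ : CompleteSpace K)
    (π : A →⋆ₐ[ℂ] (H →L[ℂ] H)) (σ : B →⋆ₐ[ℂ] (K →L[ℂ] K)), ‖spatialRep π σ x‖ ≤ C) :
    minNorm x ≤ C :=
  Real.sSup_le (by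
    rintro r ⟨H, _, _, _, K, _, _, _, π, σ, rfl⟩; exact hx H _ _ _ K _ _ _ π σ) hC

theorem minNorm_nonneg (x : A ⊗[ℂ] B) : 0 ≤ minNorm x :=
  Real.sSup_nonneg (by
    rintro r ⟨H, _, _, _, K, _, _, _, π, σ, rfl⟩
    exact norm_nonneg (spatialRep π σ x))

theorem minNorm_le_maxNorm (x : A ⊗[ℂ] B) : minNorm x ≤ maxNorm x :=
  minNorm_le (maxNorm_nonneg x) fun _H _ _ _ _K _ _ _ π σ => norm_spatialRep_le_maxNorm π σ x

theorem maxNorm_tmul_le (a : A) (b : B) : maxNorm (a ⊗ₜ[ℂ] b) ≤ ‖a‖ * ‖b‖ :=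
  maxNorm_le (by positivity) fun H _ _ _ π σ h => by
    rw [commRep_tmul]
    exact (norm_mul_le _ _).trans (mul_le_mul (norm_starHom_le π a) (norm_starHom_le σ b)
      (norm_nonneg _) (norm_nonneg _))

theorem maxNorm_add_le (x y : A ⊗[ℂ] B) : maxNorm (x + y) ≤ maxNorm x + maxNorm y :=
  maxNorm_le (add_nonneg (maxNorm_nonneg x) (maxNorm_nonneg y)) fun H _ _ _ π σ h => by
    rw [map_add]
    exact (norm_add_le _ _).trans
      (add_le_add (norm_commRep_le_maxNorm π σ h x) (norm_commRep_le_maxNorm π σ h y))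

theorem minNorm_add_le (x y : A ⊗[ℂ] B) : minNorm (x + y) ≤ minNorm x + minNorm y :=
  minNorm_le (add_nonneg (minNorm_nonneg x) (minNorm_nonneg y))
    fun _H _ _ _ _K _ _ _ π σ => by
    rw [map_add]
    exact (norm_add_le (spatialRep π σ x) (spatialRep π σ y)).trans
      (add_le_add (norm_spatialRep_le_minNorm π σ x) (norm_spatialRep_le_minNorm π σ y))

end TensorNorm

/-! ### Representations of group C⋆-algebras -/

namespace MaxGroup

open UniformSpace

universe u

variable {G : Type u} [Group G] {A : Type u} [CStarAlgebra A]

theorem continuous_lift (π : G →* unitary A) : Continuous (lift π) :=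
  ((lift π).toLinearMap.mkContinuous 1 fun x => by
    simpa [norm_def] using norm_lift_le π x).continuous

/-- The representation of `C⋆(G)` that integrates a unitary representation of `G`. -/
def liftCStar (π : G →* unitary A) : GroupCStar G →⋆ₐ[ℂ] A :=
  let hc : Continuous (lift π).toRingHom := continuous_lift π
  { Completion.extensionHom (lift π).toRingHom hc with
    commutes' := fun c => by
      change Completion.extensionHom (lift π).toRingHom hc
        ((algebraMap ℂ (GroupAlgebra G) c : GroupAlgebra G) : GroupCStar G) = _
      rw [Completion.extensionHom_coe]
      exact (lift π).commutes c
    map_star' := fun x => by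
      change Completion.extensionHom (lift π).toRingHom hc (star x) =
        star (Completion.extensionHom (lift π).toRingHom hc x)
      have hext : Continuous (Completion.extensionHom (lift π).toRingHom hc) :=
        Completion.continuous_extension
      induction x using Completion.induction_on with
      | hp => exact isClosed_eq (hext.comp continuous_star') (continuous_star.comp hext)
      | ih x =>
        rw [← coe_star, Completion.extensionHom_coe, Completion.extensionHom_coe]
        exact lift_star π x }

theorem liftCStar_coe (π : G →* unitary A) (x : GroupAlgebra G) :
    liftCStar π (x : GroupCStar G) = lift π x :=
  Completion.extensionHom_coe (lift π).toRingHom (continuous_lift π) x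

theorem coe_single_mem_unitary (g : G) :
    ((single g 1 : GroupAlgebra G) : GroupCStar G) ∈ unitary (GroupCStar G) := by
  have h1 : ((single (1 : G) (1 : ℂ) : GroupAlgebra G) : GroupCStar G) = 1 := rfl
  constructor
  · rw [← coe_star, ← Completion.coe_mul, star_single, single_mul_single]
    simp [h1]
  · rw [← coe_star, ← Completion.coe_mul, star_single, single_mul_single]
    simp [h1]

variable (G) in
/-- The canonical unitaries of `C⋆(G)`. -/
def of : G →* unitary (GroupCStar G) where
  toFun g := ⟨((single g 1 : GroupAlgebra G) : GroupCStar G), coe_single_mem_unitary g⟩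
  map_one' := rfl
  map_mul' g h := Subtype.ext (by
    change ((single (g * h) 1 : GroupAlgebra G) : GroupCStar G) =
      ((single g 1 : GroupAlgebra G) : GroupCStar G) *
      ((single h 1 : GroupAlgebra G) : GroupCStar G)
    rw [← Completion.coe_mul, single_mul_single, mul_one])

theorem coe_of (g : G) :
    (of G g : GroupCStar G) = ((single g 1 : GroupAlgebra G) : GroupCStar G) := rfl

theorem liftCStar_of (π : G →* unitary A) (g : G) : liftCStar π (of G g) = π g := by
  rw [coe_of, liftCStar_coe, lift_single, one_smul]

/-- A closed additive condition that holds for the multiples of the canonical unitaries holds on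
all of `C⋆(G)`. -/
theorem induction_of {p : GroupCStar G → Prop} (hp : IsClosed {x | p x})
    (hadd : ∀ x y, p x → p y → p (x + y)) (hs : ∀ (g : G) (c : ℂ), p (c • (of G g : GroupCStar G)))
    (x : GroupCStar G) : p x := by
  induction x using Completion.induction_on with
  | hp => exact hp
  | ih x =>
    induction x using induction_linear with
    | h0 => simpa [Completion.coe_zero] using hs 1 0
    | hadd x y hx hy => rw [Completion.coe_add]; exact hadd _ _ hx hy
    | hs g c =>
      have := hs g c
      rwa [coe_of, ← Completion.coe_smul, smul_single, mul_one] at this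

/-- The unitary representation of `G` underlying a representation of `C⋆(G)`. -/
def unitaryRep (π : GroupCStar G →⋆ₐ[ℂ] A) : G →* unitary A where
  toFun g := ⟨π (of G g), Unitary.map_mem π (of G g).2⟩
  map_one' := Subtype.ext (by simp)
  map_mul' g h := Subtype.ext (by simp)

theorem continuous_starHom {B : Type u} [CStarAlgebra B] (π : B →⋆ₐ[ℂ] A) : Continuous π :=
  (π.toAlgHom.toLinearMap.mkContinuous 1 fun x => by
    simpa using NonUnitalStarAlgHom.norm_apply_le π x).continuous

theorem commute_of_forall_of (π : GroupCStar G →⋆ₐ[ℂ] A) {T : A}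
    (h : ∀ g, Commute (π (of G g)) T) (x : GroupCStar G) : Commute (π x) T := by
  induction x using induction_of with
  | hp =>
    have h1 : Continuous fun x => π x * T := (continuous_starHom π).mul continuous_const
    have h2 : Continuous fun x => T * π x := continuous_const.mul (continuous_starHom π)
    exact isClosed_eq h1 h2
  | hadd x y hx hy => rw [map_add]; exact hx.add_left hy
  | hs g c => rw [map_smul]; exact (h g).smul_left c

/-- The homomorphism of group C⋆-algebras induced by a group homomorphism. -/
def mapCStar {G' : Type u} [Group G'] (f : G →* G') : GroupCStar G →⋆ₐ[ℂ] GroupCStar G' :=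
  liftCStar ((of G').comp f)

theorem mapCStar_of {G' : Type u} [Group G'] (f : G →* G') (g : G) :
    mapCStar f (of G g) = of G' (f g) :=
  liftCStar_of _ g

end MaxGroup

/-! ### Transfer of the equality of the two norms -/

namespace TensorNorm

universe u

variable {A B A' B' : Type u} [CStarAlgebra A] [CStarAlgebra B] [CStarAlgebra A'] [CStarAlgebra B']

/-- Homomorphisms do not increase the minimal norm. -/
theorem minNorm_map_le (φ : A →⋆ₐ[ℂ] A') (θ : B →⋆ₐ[ℂ] B') (x : A ⊗[ℂ] B) :
    minNorm (TensorProduct.map φ.toAlgHom.toLinearMap θ.toAlgHom.toLinearMap x) ≤ minNorm x := by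
  refine minNorm_le (minNorm_nonneg x) fun H _ _ _ K _ _ _ π σ => ?_
  have h : spatialRep π σ (TensorProduct.map φ.toAlgHom.toLinearMap θ.toAlgHom.toLinearMap x) =
      spatialRep (π.comp φ) (σ.comp θ) x := by
    induction x using TensorProduct.induction_on with
    | zero => simp
    | tmul a b => rfl
    | add x y hx hy => rw [map_add, map_add, map_add, hx, hy]
  rw [h]
  exact norm_spatialRep_le_minNorm _ _ x

/-- If every commuting pair of representations of `A` and `B` is contained in the restriction of a
commuting pair of representations of `A'` and `B'`, the equality of the minimal and the maximal
norm passes from `(A', B')` to `(A, B)`. -/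
theorem MinEqMax.of_extension (h' : MinEqMax A' B') (φ : A →⋆ₐ[ℂ] A') (θ : B →⋆ₐ[ℂ] B')
    (hext : ∀ (H : Type u) (_ : NormedAddCommGroup H) (_ : InnerProductSpace ℂ H)
      (_ : CompleteSpace H) (π : A →⋆ₐ[ℂ] (H →L[ℂ] H)) (σ : B →⋆ₐ[ℂ] (H →L[ℂ] H)),
      (∀ a b, Commute (π a) (σ b)) →
      ∃ (K : Type u) (_ : NormedAddCommGroup K) (_ : InnerProductSpace ℂ K) (_ : CompleteSpace K)
        (V : H →ₗᵢ[ℂ] K) (π' : A' →⋆ₐ[ℂ] (K →L[ℂ] K)) (σ' : B' →⋆ₐ[ℂ] (K →L[ℂ] K)),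
        (∀ a b, Commute (π' a) (σ' b)) ∧ (∀ a h, π' (φ a) (V h) = V (π a h)) ∧
        ∀ b h, σ' (θ b) (V h) = V (σ b h)) :
    MinEqMax A B := by
  intro x
  refine le_antisymm (minNorm_le_maxNorm x) ?_
  refine le_trans ?_ ((h' _).symm.le.trans (minNorm_map_le φ θ x))
  refine maxNorm_le (maxNorm_nonneg _) fun H _ _ _ π σ hc => ?_
  obtain ⟨K, _, _, _, V, π', σ', hc', hπ, hσ⟩ := hext H _ _ _ π σ hc
  have key : ∀ h, V (commRep π σ hc x h) = commRep π' σ' hc'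
      (TensorProduct.map φ.toAlgHom.toLinearMap θ.toAlgHom.toLinearMap x) (V h) := by
    intro h
    induction x using TensorProduct.induction_on with
    | zero => simp
    | tmul a b =>
      rw [TensorProduct.map_tmul, commRep_tmul, commRep_tmul]
      change V (π a (σ b h)) = π' (φ a) (σ' (θ b) (V h))
      rw [hσ, hπ]
    | add x y hx hy =>
      simp only [map_add, add_apply] at hx hy ⊢
      rw [hx, hy]
  refine ContinuousLinearMap.opNorm_le_bound _ (maxNorm_nonneg _) fun h => ?_
  rw [← V.norm_map, key, ← V.norm_map h]
  exact (ContinuousLinearMap.le_opNorm _ _).trans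
    (mul_le_mul_of_nonneg_right (norm_commRep_le_maxNorm π' σ' hc' _) (norm_nonneg _))

end TensorNorm

/-! ### Operator matrices -/

namespace OpMatrix

open ContinuousLinearMap

variable {ι : Type*} [Fintype ι] {H : Type*} [NormedAddCommGroup H] [InnerProductSpace ℂ H]

/-- The Hilbert space direct sum of copies of `H` indexed by `ι`. -/
abbrev Copies (ι H : Type*) [NormedAddCommGroup H] : Type _ := PiLp 2 fun _ : ι => H

/-- The column operator `h ↦ (S i h)ᵢ`. -/
def colOp (S : ι → H →L[ℂ] H) : H →L[ℂ] Copies ι H :=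
  (PiLp.continuousLinearEquiv 2 ℂ fun _ : ι => H).symm.toContinuousLinearMap ∘L
    ContinuousLinearMap.pi S

@[simp]
theorem colOp_apply (S : ι → H →L[ℂ] H) (h : H) (i : ι) : colOp S h i = S i h := rfl

/-- The operator on a direct sum of copies of `H` with a given matrix of operators on `H`. -/
def matOp (M : Matrix ι ι (H →L[ℂ] H)) : Copies ι H →L[ℂ] Copies ι H :=
  (PiLp.continuousLinearEquiv 2 ℂ fun _ : ι => H).symm.toContinuousLinearMap ∘L
    ContinuousLinearMap.pi fun i => ∑ j, M i j ∘L PiLp.proj 2 (fun _ : ι => H) j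

@[simp]
theorem matOp_apply (M : Matrix ι ι (H →L[ℂ] H)) (f : Copies ι H) (i : ι) :
    matOp M f i = ∑ j, M i j (f j) := by
  simp [matOp]

theorem inner_copies (f g : Copies ι H) : inner ℂ f g = ∑ i, inner ℂ (f i) (g i) :=
  PiLp.inner_apply f g

section Complete

variable [CompleteSpace H]

theorem adjoint_colOp_apply (S : ι → H →L[ℂ] H) (f : Copies ι H) :
    (colOp S).adjoint f = ∑ i, star (S i) (f i) := by
  refine ext_inner_left ℂ fun h => ?_
  rw [adjoint_inner_right, inner_copies, inner_sum]
  simp [star_eq_adjoint, adjoint_inner_right]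

variable [DecidableEq ι]

variable (ι H) in
/-- Operator matrices act on a direct sum of copies of `H` by a `⋆`-homomorphism. -/
def matOpHom : Matrix ι ι (H →L[ℂ] H) →⋆ₐ[ℂ] (Copies ι H →L[ℂ] Copies ι H) where
  toFun := matOp
  map_one' := by
    ext f i
    rw [matOp_apply, Finset.sum_eq_single i]
    · simp
    · intro j _ hj
      simp [Matrix.one_apply_ne hj.symm]
    · simp
  map_mul' M N := by
    ext f i
    change _ = matOp M (matOp N f) i
    simp only [matOp_apply, Matrix.mul_apply, sum_apply, map_sum]
    rw [Finset.sum_comm]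
    rfl
  map_zero' := by ext f i; simp
  map_add' M N := by ext f i; simp [Finset.sum_add_distrib]
  commutes' c := by
    ext f i
    rw [matOp_apply, Finset.sum_eq_single i]
    · simp [Algebra.algebraMap_eq_smul_one]
    · intro j _ hj
      simp [Algebra.algebraMap_eq_smul_one, Matrix.one_apply_ne hj.symm]
    · simp
  map_star' M := by
    rw [star_eq_adjoint]
    refine (eq_adjoint_iff _ _).2 fun f g => ?_
    simp only [inner_copies, matOp_apply, sum_inner, inner_sum, Matrix.star_apply,
      star_eq_adjoint, adjoint_inner_left]
    rw [Finset.sum_comm]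

theorem matOpHom_apply (M : Matrix ι ι (H →L[ℂ] H)) : matOpHom ι H M = matOp M := rfl

variable (ι H) in
/-- The diagonal action of families of operators. -/
def diagOp : (ι → H →L[ℂ] H) →⋆ₐ[ℂ] (Copies ι H →L[ℂ] Copies ι H) where
  toFun T := matOp (Matrix.diagonal T)
  map_one' := by
    rw [← matOpHom_apply, ← map_one (matOpHom ι H)]; congr 1
  map_mul' S T := by
    rw [← matOpHom_apply, ← matOpHom_apply, ← matOpHom_apply, ← map_mul,
      Matrix.diagonal_mul_diagonal]; rfl
  map_zero' := by
    rw [← matOpHom_apply, ← map_zero (matOpHom ι H)]; congr 1; exact Matrix.diagonal_zero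
  map_add' S T := by
    rw [← matOpHom_apply, ← matOpHom_apply, ← matOpHom_apply, ← map_add,
      Matrix.diagonal_add]; rfl
  commutes' c := by
    rw [← matOpHom_apply, ← (matOpHom ι H).commutes c]; congr 1
  map_star' S := by
    rw [← matOpHom_apply, ← matOpHom_apply, ← map_star, Matrix.star_eq_conjTranspose,
      Matrix.diagonal_conjTranspose]

@[simp]
theorem diagOp_apply (T : ι → H →L[ℂ] H) (f : Copies ι H) (i : ι) :
    diagOp ι H T f i = T i (f i) := by
  change matOp (Matrix.diagonal T) f i = _
  rw [matOp_apply, Finset.sum_eq_single i]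
  · simp
  · intro j _ hj
    simp [Matrix.diagonal_apply_ne _ hj.symm]
  · simp

variable (ι H) in
/-- The action of one operator on all copies. -/
def ampl : (H →L[ℂ] H) →⋆ₐ[ℂ] (Copies ι H →L[ℂ] Copies ι H) :=
  (diagOp ι H).comp
    { Pi.constAlgHom ℂ ι (H →L[ℂ] H) with map_star' := fun _ => rfl }

@[simp]
theorem ampl_apply (T : H →L[ℂ] H) (f : Copies ι H) (i : ι) : ampl ι H T f i = T (f i) :=
  diagOp_apply _ f i

theorem ampl_colOp (T : H →L[ℂ] H) (S : ι → H →L[ℂ] H) (hS : ∀ i, Commute T (S i)) (h : H) :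
    ampl ι H T (colOp S h) = colOp S (T h) := by
  ext i
  simpa using DFunLike.congr_fun (hS i).eq h

/-- The inclusion of the `i`-th copy. -/
def copy (i : ι) : H →ₗᵢ[ℂ] Copies ι H where
  toLinearMap := (colOp (Pi.single i (1 : H →L[ℂ] H))).toLinearMap
  norm_map' h := by
    refine (sq_eq_sq₀ (norm_nonneg _) (norm_nonneg _)).1 ?_
    rw [PiLp.norm_sq_eq_of_L2, Finset.sum_eq_single i]
    · simp
    · intro j _ hj
      simp [hj]
    · simp

@[simp]
theorem copy_apply (i : ι) (h : H) (j : ι) : copy i h j = if j = i then h else 0 := by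
  change (Pi.single i (1 : H →L[ℂ] H) : ι → _) j h = _
  by_cases hj : j = i
  · subst hj; simp
  · simp [hj]

theorem ampl_copy (T : H →L[ℂ] H) (i : ι) (h : H) : ampl ι H T (copy i h) = copy i (T h) := by
  ext j
  simp only [ampl_apply, copy_apply]
  split_ifs <;> simp

variable (ι H) in
/-- The diagonal unitaries. -/
def diagUnitary : (ι → unitary (H →L[ℂ] H)) →* unitary (Copies ι H →L[ℂ] Copies ι H) where
  toFun u := ⟨diagOp ι H fun i => u i, Unitary.map_mem (diagOp ι H)
    ⟨funext fun i => (u i).2.1, funext fun i => (u i).2.2⟩⟩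
  map_one' := Subtype.ext (map_one (diagOp ι H))
  map_mul' u v := Subtype.ext (map_mul (diagOp ι H) (fun i => (u i : H →L[ℂ] H)) fun i => v i)

theorem coe_diagUnitary (u : ι → unitary (H →L[ℂ] H)) :
    (diagUnitary ι H u : Copies ι H →L[ℂ] Copies ι H) = diagOp ι H fun i => u i := rfl

theorem diagUnitary_copy (u : ι → unitary (H →L[ℂ] H)) (i : ι) (h : H) :
    (diagUnitary ι H u : Copies ι H →L[ℂ] Copies ι H) (copy i h) =
      copy i ((u i : H →L[ℂ] H) h) := by
  ext j
  simp only [coe_diagUnitary, diagOp_apply, copy_apply]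
  split_ifs with hj
  · rw [hj]
  · simp

theorem commute_diagUnitary_ampl (u : ι → unitary (H →L[ℂ] H)) (T : H →L[ℂ] H)
    (hT : ∀ i, Commute (u i : H →L[ℂ] H) T) :
    Commute (diagUnitary ι H u : Copies ι H →L[ℂ] Copies ι H) (ampl ι H T) := by
  ext f i
  simpa [coe_diagUnitary] using DFunLike.congr_fun (hT i).eq (f i)

variable (H) in
/-- The permutation operator `(f i)ᵢ ↦ (f (e⁻¹ i))ᵢ`. -/
def permOp (e : Equiv.Perm ι) : Copies ι H →L[ℂ] Copies ι H :=
  matOp (Matrix.of fun i j => if e.symm i = j then 1 else 0)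

@[simp]
theorem permOp_apply (e : Equiv.Perm ι) (f : Copies ι H) (i : ι) :
    permOp H e f i = f (e.symm i) := by
  rw [permOp, matOp_apply, Finset.sum_eq_single (e.symm i)]
  · simp
  · intro j _ hj
    simp [hj.symm]
  · simp

theorem star_permOp (e : Equiv.Perm ι) : star (permOp H e) = permOp H e.symm := by
  rw [star_eq_adjoint]
  refine ((eq_adjoint_iff _ _).2 fun f g => ?_).symm
  simp only [inner_copies, permOp_apply, Equiv.symm_symm]
  exact Fintype.sum_equiv e _ _ fun i => by simp

variable (ι H) in
/-- The permutation operators as unitaries. -/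
def permUnitary : Equiv.Perm ι →* unitary (Copies ι H →L[ℂ] Copies ι H) where
  toFun e := ⟨permOp H e, by
    constructor <;> rw [star_permOp] <;> ext f i <;> simp⟩
  map_one' := Subtype.ext (by ext f i; simp; rfl)
  map_mul' e e' := Subtype.ext (by ext f i; simp [Equiv.Perm.mul_def])

theorem coe_permUnitary (e : Equiv.Perm ι) :
    (permUnitary ι H e : Copies ι H →L[ℂ] Copies ι H) = permOp H e := rfl

theorem permUnitary_copy (e : Equiv.Perm ι) (i : ι) (h : H) :
    (permUnitary ι H e : Copies ι H →L[ℂ] Copies ι H) (copy i h) = copy (e i) h := by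
  ext j
  simp [coe_permUnitary, Equiv.symm_apply_eq]

theorem commute_permUnitary_ampl (e : Equiv.Perm ι) (T : H →L[ℂ] H) :
    Commute (permUnitary ι H e : Copies ι H →L[ℂ] Copies ι H) (ampl ι H T) := by
  ext f i
  simp [coe_permUnitary]

/-- The entries of an operator matrix are bounded by the norm of the operator. -/
theorem norm_entry_le (M : Matrix ι ι (H →L[ℂ] H)) (i j : ι) : ‖M i j‖ ≤ ‖matOp M‖ := by
  refine opNorm_le_bound _ (norm_nonneg _) fun h => ?_
  have h1 : M i j h = matOp M (copy j h) i := by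
    rw [matOp_apply, Finset.sum_eq_single j]
    · simp
    · intro l _ hl
      simp [hl]
    · simp
  rw [h1, ← (copy j).norm_map h]
  exact (PiLp.norm_apply_le _ i).trans (le_opNorm _ _)

end Complete

/-- The norm of an operator matrix is at most the sum of the norms of its entries. -/
theorem norm_matOp_le (M : Matrix ι ι (H →L[ℂ] H)) : ‖matOp M‖ ≤ ∑ i, ∑ j, ‖M i j‖ := by
  refine opNorm_le_bound _ (by positivity) fun f => ?_
  have h1 : ‖matOp M f‖ ≤ ∑ i, ‖matOp M f i‖ := by
    rw [PiLp.norm_eq_of_L2]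
    refine Real.sqrt_le_iff.2 ⟨by positivity, ?_⟩
    exact Finset.sum_sq_le_sq_sum_of_nonneg fun i _ => norm_nonneg _
  refine h1.trans ?_
  rw [Finset.sum_mul]
  refine Finset.sum_le_sum fun i _ => ?_
  rw [matOp_apply, Finset.sum_mul]
  refine (norm_sum_le _ _).trans (Finset.sum_le_sum fun j _ => ?_)
  exact (le_opNorm _ _).trans
    (mul_le_mul_of_nonneg_left (PiLp.norm_apply_le f j) (norm_nonneg _))

end OpMatrix

/-! ### Free group representations inside representations of the Bell group -/

namespace OpMatrix

section Intertwine

variable {H K : Type*} [NormedAddCommGroup H] [InnerProductSpace ℂ H] [CompleteSpace H]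
  [NormedAddCommGroup K] [InnerProductSpace ℂ K] [CompleteSpace K] {V : H → K}
  {a a' : unitary (K →L[ℂ] K)} {b b' : unitary (H →L[ℂ] H)}

theorem unitary_inv_apply_apply (a : unitary (K →L[ℂ] K)) (z : K) :
    ((a⁻¹ : unitary (K →L[ℂ] K)) : K →L[ℂ] K) ((a : K →L[ℂ] K) z) = z :=
  DFunLike.congr_fun (congrArg Subtype.val (inv_mul_cancel a)) z

theorem unitary_apply_inv_apply (a : unitary (K →L[ℂ] K)) (z : K) :
    (a : K →L[ℂ] K) (((a⁻¹ : unitary (K →L[ℂ] K)) : K →L[ℂ] K) z) = z :=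
  DFunLike.congr_fun (congrArg Subtype.val (mul_inv_cancel a)) z

theorem intertwine_inv (h : ∀ x, (a : K →L[ℂ] K) (V x) = V ((b : H →L[ℂ] H) x)) (x : H) :
    ((a⁻¹ : unitary (K →L[ℂ] K)) : K →L[ℂ] K) (V x) =
      V (((b⁻¹ : unitary (H →L[ℂ] H)) : H →L[ℂ] H) x) := by
  conv_lhs => rw [← unitary_apply_inv_apply b x, ← h]
  exact unitary_inv_apply_apply a _

theorem intertwine_mul (h : ∀ x, (a : K →L[ℂ] K) (V x) = V ((b : H →L[ℂ] H) x))
    (h' : ∀ x, (a' : K →L[ℂ] K) (V x) = V ((b' : H →L[ℂ] H) x)) (x : H) :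
    ((a * a' : unitary (K →L[ℂ] K)) : K →L[ℂ] K) (V x) =
      V (((b * b' : unitary (H →L[ℂ] H)) : H →L[ℂ] H) x) := by
  change (a : K →L[ℂ] K) ((a' : K →L[ℂ] K) (V x)) = V ((b : H →L[ℂ] H) ((b' : H →L[ℂ] H) x))
  rw [h', h]

theorem commute_unitary_inv {T : K →L[ℂ] K} (h : Commute (a : K →L[ℂ] K) T) :
    Commute ((a⁻¹ : unitary (K →L[ℂ] K)) : K →L[ℂ] K) T := by
  ext z
  change ((a⁻¹ : unitary (K →L[ℂ] K)) : K →L[ℂ] K) (T z) =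
    T (((a⁻¹ : unitary (K →L[ℂ] K)) : K →L[ℂ] K) z)
  conv_lhs => rw [← unitary_apply_inv_apply a z]
  have hz : (a : K →L[ℂ] K) (T _) = T ((a : K →L[ℂ] K) _) := DFunLike.congr_fun h.eq
    (((a⁻¹ : unitary (K →L[ℂ] K)) : K →L[ℂ] K) z)
  rw [← hz]
  exact unitary_inv_apply_apply a _

end Intertwine

end OpMatrix

namespace Steering

open OpMatrix

variable {k m : ℕ} {H : Type} [NormedAddCommGroup H] [InnerProductSpace ℂ H] [CompleteSpace H]

/-- The translations of `ℤ_m`. -/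
def shiftPerm (m : ℕ) : Multiplicative (ZMod m) →* Equiv.Perm (ZMod m) where
  toFun z := Equiv.addRight z.toAdd
  map_one' := by ext; simp
  map_mul' z w := by ext j; simp [add_left_comm, add_comm]

/-- The representation of `ℤ_m ∗ ⋯ ∗ ℤ_m` on `ℤ_m`-indexed copies of `H` in which the `x`-th factor
acts by the shift conjugated by the diagonal unitary `D x`. -/
def shiftRep [NeZero m] (D : Fin k → ZMod m → unitary (H →L[ℂ] H)) :
    BellGroup k m →* unitary (Copies (ZMod m) H →L[ℂ] Copies (ZMod m) H) :=
  Monoid.CoprodI.lift fun x => (MulAut.conj (diagUnitary (ZMod m) H (D x))).toMonoidHom.comp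
    ((permUnitary (ZMod m) H).comp (shiftPerm m))

/-- The generator of the `x`-th factor of `ℤ_m ∗ ⋯ ∗ ℤ_m`. -/
def gen (k m : ℕ) (x : Fin k) : BellGroup k m :=
  Monoid.CoprodI.of (M := fun _ : Fin k => Multiplicative (ZMod m)) (i := x)
    (Multiplicative.ofAdd 1)

/-- The operator `U` maps the `i`-th copy of `H` to the `j`-th copy, acting as the unitary `v`. -/
def Moves {ι : Type*} [Fintype ι] [DecidableEq ι] (U : unitary (Copies ι H →L[ℂ] Copies ι H))
    (i j : ι) (v : unitary (H →L[ℂ] H)) : Prop :=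
  ∀ h, (U : Copies ι H →L[ℂ] Copies ι H) (copy i h) = copy j ((v : H →L[ℂ] H) h)

section Moves

variable {ι : Type*} [Fintype ι] [DecidableEq ι] {U U' : unitary (Copies ι H →L[ℂ] Copies ι H)}
  {i j l : ι} {v v' : unitary (H →L[ℂ] H)}

theorem Moves.mul (h : Moves U j l v) (h' : Moves U' i j v') : Moves (U * U') i l (v * v') := by
  intro x
  change (U : Copies ι H →L[ℂ] Copies ι H) ((U' : Copies ι H →L[ℂ] Copies ι H) (copy i x)) =
    copy l ((v : H →L[ℂ] H) ((v' : H →L[ℂ] H) x))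
  rw [h', h]

theorem Moves.inv (h : Moves U i j v) : Moves U⁻¹ j i v⁻¹ := by
  intro x
  conv_lhs => rw [← unitary_apply_inv_apply v x, ← h]
  exact unitary_inv_apply_apply U _

theorem Moves.congr (h : Moves U i j v) (hv : v = v') : Moves U i j v' := hv ▸ h

end Moves

theorem moves_shiftRep_gen [NeZero m] (D : Fin k → ZMod m → unitary (H →L[ℂ] H)) (x : Fin k)
    {i j : ZMod m} (hij : i + 1 = j) :
    Moves (shiftRep D (gen k m x)) i j (D x j * (D x i)⁻¹) := by
  subst hij
  have hd : ∀ j, Moves (diagUnitary (ZMod m) H (D x)) j j (D x j) := diagUnitary_copy (D x)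
  have hp : Moves (permUnitary (ZMod m) H (Equiv.addRight 1)) i (i + 1) 1 :=
    permUnitary_copy (Equiv.addRight (1 : ZMod m)) i
  rw [shiftRep, gen, Monoid.CoprodI.lift_of]
  exact (((hd (i + 1)).mul hp).mul (hd i).inv).congr (by rw [mul_one])

theorem commute_shiftRep_ampl [NeZero m] (D : Fin k → ZMod m → unitary (H →L[ℂ] H))
    (T : H →L[ℂ] H) (hT : ∀ x j, Commute (D x j : H →L[ℂ] H) T) (g : BellGroup k m) :
    Commute (shiftRep D g : Copies (ZMod m) H →L[ℂ] Copies (ZMod m) H) (ampl (ZMod m) H T) := by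
  induction g using Monoid.CoprodI.induction_on with
  | one => rw [map_one]; exact Commute.one_left _
  | of x z =>
    have hD := commute_diagUnitary_ampl (D x) T (hT x)
    rw [shiftRep, Monoid.CoprodI.lift_of]
    exact (hD.mul_left (commute_permUnitary_ampl _ T)).mul_left (commute_unitary_inv hD)
  | mul g g' hg hg' => rw [map_mul]; exact hg.mul_left hg'

/-- With three factors, the shifts can be made to differ on the edge from `0` to `1`. -/
theorem exists_words_of_three_le (hk : 3 ≤ k) (hm : 2 ≤ m) [NeZero m] :
    ∃ w : Fin 2 → BellGroup k m, ∀ (H : Type) (_ : NormedAddCommGroup H)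
      (_ : InnerProductSpace ℂ H) (_ : CompleteSpace H) (u : Fin 2 → unitary (H →L[ℂ] H)),
      ∃ D : Fin k → ZMod m → unitary (H →L[ℂ] H),
        (∀ i, Moves (shiftRep D (w i)) 0 0 (u i)) ∧
        ∀ T : H →L[ℂ] H, (∀ i, Commute (u i : H →L[ℂ] H) T) →
          ∀ x j, Commute (D x j : H →L[ℂ] H) T := by
  have h01 : (0 : ZMod m) ≠ 1 := by
    have : Fact (1 < m) := ⟨hm⟩
    exact zero_ne_one
  let x : Fin 3 → Fin k := Fin.castLE hk
  have hx : ∀ i j, x i = x j ↔ i = j := fun i j => (Fin.castLE_injective hk).eq_iff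
  -- Along the edge from `0` to `1` the three generators act as `1`, `u 0` and `u 1`.
  refine ⟨fun i => (gen k m (x 0))⁻¹ * gen k m (x i.succ), fun H _ _ _ u => ?_⟩
  let D : Fin k → ZMod m → unitary (H →L[ℂ] H) := fun y j => if j = 1 then
    (if y = x 1 then u 0 else if y = x 2 then u 1 else 1) else 1
  have hD0 : ∀ y, D y 0 = 1 := fun y => if_neg h01
  have hD1 : ∀ y, D y 1 = if y = x 1 then u 0 else if y = x 2 then u 1 else 1 :=
    fun y => if_pos rfl
  refine ⟨D, fun i => ?_, ?_⟩
  · rw [map_mul, map_inv]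
    refine ((moves_shiftRep_gen D (x 0) (zero_add 1)).inv.mul
      (moves_shiftRep_gen D (x i.succ) (zero_add 1))).congr ?_
    rw [hD0, hD0, hD1, hD1]
    fin_cases i <;> simp [hx]
  · intro T hT y j
    simp only [D]
    split_ifs
    exacts [hT 0, hT 1, Commute.one_left _, Commute.one_left _]

/-- With two factors of order at least three, the shifts can be made to differ on two consecutive
edges. -/
theorem exists_words_of_two_le (hk : 2 ≤ k) (hm : 3 ≤ m) [NeZero m] :
    ∃ w : Fin 2 → BellGroup k m, ∀ (H : Type) (_ : NormedAddCommGroup H)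
      (_ : InnerProductSpace ℂ H) (_ : CompleteSpace H) (u : Fin 2 → unitary (H →L[ℂ] H)),
      ∃ D : Fin k → ZMod m → unitary (H →L[ℂ] H),
        (∀ i, Moves (shiftRep D (w i)) 0 0 (u i)) ∧
        ∀ T : H →L[ℂ] H, (∀ i, Commute (u i : H →L[ℂ] H) T) →
          ∀ x j, Commute (D x j : H →L[ℂ] H) T := by
  have h01 : (0 : ZMod m) ≠ 1 := by
    have : Fact (1 < m) := ⟨by omega⟩
    exact zero_ne_one
  have h21 : (1 + 1 : ZMod m) ≠ 1 := by simpa using h01.symm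
  have h02 : (0 : ZMod m) ≠ 1 + 1 := by
    intro h
    have h2 : ((2 : ℕ) : ZMod m) = 0 := by push_cast; rw [h]; norm_num
    have := Nat.le_of_dvd (by norm_num) ((ZMod.natCast_eq_zero_iff 2 m).1 h2)
    omega
  let x : Fin 2 → Fin k := Fin.castLE hk
  have hx : x 0 ≠ x 1 := fun h => by simpa using Fin.castLE_injective hk h
  -- The first generator acts by pure shifts, the second one as `u 0` along the edge from `0` to `1`
  -- and as `u 1` along the edge from `1` to `2`; the second word traverses the latter edge.
  refine ⟨![(gen k m (x 0))⁻¹ * gen k m (x 1),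
    (gen k m (x 0))⁻¹ * ((gen k m (x 0))⁻¹ * (gen k m (x 1) * gen k m (x 0)))],
    fun H _ _ _ u => ?_⟩
  let D : Fin k → ZMod m → unitary (H →L[ℂ] H) := fun y j => if y = x 1 then
    (if j = 1 then u 0 else if j = 1 + 1 then u 1 * u 0 else 1) else 1
  have hD0 : ∀ j, D (x 0) j = 1 := fun j => if_neg hx
  have hD10 : D (x 1) 0 = 1 := by simp only [D, if_true, if_neg h01, if_neg h02]
  have hD11 : D (x 1) 1 = u 0 := by simp only [D, if_true]
  have hD12 : D (x 1) (1 + 1) = u 1 * u 0 := by simp only [D, if_true, if_neg h21]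
  have hA : ∀ {i j : ZMod m}, i + 1 = j → Moves (shiftRep D (gen k m (x 0))) i j 1 :=
    fun h => (moves_shiftRep_gen D (x 0) h).congr (by rw [hD0, hD0, inv_one, mul_one])
  refine ⟨D, fun i => ?_, ?_⟩
  · have h0 : Moves (shiftRep D ((gen k m (x 0))⁻¹ * gen k m (x 1))) 0 0 (u 0) := by
      rw [map_mul, map_inv]
      refine ((hA (zero_add 1)).inv.mul (moves_shiftRep_gen D (x 1) (zero_add 1))).congr ?_
      rw [hD10, hD11, inv_one, one_mul, mul_one]
    have h1 : Moves (shiftRep D ((gen k m (x 0))⁻¹ * ((gen k m (x 0))⁻¹ *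
        (gen k m (x 1) * gen k m (x 0))))) 0 0 (u 1) := by
      rw [map_mul, map_mul, map_mul, map_inv]
      refine ((hA (zero_add 1)).inv.mul ((hA rfl).inv.mul
        ((moves_shiftRep_gen D (x 1) rfl).mul (hA (zero_add 1))))).congr ?_
      rw [hD11, hD12]
      simp
    exact Fin.cases h0 (fun i => by rw [Subsingleton.elim i 0]; exact h1) i
  · intro T hT y j
    simp only [D]
    split_ifs
    exacts [hT 0, (hT 1).mul_left (hT 0), Commute.one_left _, Commute.one_left _]

open MaxGroup in
/-- The equality of the norms passes from the Bell group to the free group: every representation of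
the free group is contained in the restriction of a representation of the Bell group along a fixed
homomorphism. -/
theorem qwep_of_minEqMax_bellGroup (hk : 2 ≤ k) (hm : 2 ≤ m) (hΓ : ¬(k = 2 ∧ m = 2))
    (h : TensorNorm.MinEqMax (GroupCStar (BellGroup k m)) (GroupCStar (BellGroup k m))) :
    QWEP := by
  have : NeZero m := ⟨by omega⟩
  obtain ⟨w, hw⟩ : ∃ w : Fin 2 → BellGroup k m, ∀ (H : Type) (_ : NormedAddCommGroup H)
      (_ : InnerProductSpace ℂ H) (_ : CompleteSpace H) (u : Fin 2 → unitary (H →L[ℂ] H)),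
      ∃ D : Fin k → ZMod m → unitary (H →L[ℂ] H),
        (∀ i, Moves (shiftRep D (w i)) 0 0 (u i)) ∧
        ∀ T : H →L[ℂ] H, (∀ i, Commute (u i : H →L[ℂ] H) T) →
          ∀ x j, Commute (D x j : H →L[ℂ] H) T := by
    by_cases hk3 : 3 ≤ k
    · exact exists_words_of_three_le hk3 hm
    · exact exists_words_of_two_le hk (by omega)
  let f : FreeGroup (Fin 2) →* BellGroup k m := FreeGroup.lift w
  have ext : ∀ (H : Type) (_ : NormedAddCommGroup H) (_ : InnerProductSpace ℂ H)
      (_ : CompleteSpace H) (π : GroupCStar (FreeGroup (Fin 2)) →⋆ₐ[ℂ] (H →L[ℂ] H)),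
      ∃ π' : GroupCStar (BellGroup k m) →⋆ₐ[ℂ] (Copies (ZMod m) H →L[ℂ] Copies (ZMod m) H),
        (∀ a h, π' (mapCStar f a) (copy (0 : ZMod m) h) = copy 0 (π a h)) ∧
        ∀ T, (∀ a, Commute (π a) T) → ∀ a, Commute (π' a) (ampl (ZMod m) H T) := by
    intro H _ _ _ π
    obtain ⟨D, hD, hDT⟩ := hw H _ _ _ fun i => unitaryRep π (FreeGroup.of i)
    refine ⟨liftCStar (shiftRep D), fun a h => ?_, fun T hT => ?_⟩
    · have hg : ∀ g h, (shiftRep D (f g) : Copies (ZMod m) H →L[ℂ] Copies (ZMod m) H)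
          (copy 0 h) = copy 0 ((unitaryRep π g : H →L[ℂ] H) h) := by
        intro g
        induction g using FreeGroup.induction_on with
        | C1 => intro h; simp
        | of i => intro h; exact (by simp [f] : _ = _).trans (hD i h)
        | inv_of i hi => rw [map_inv, map_inv, map_inv]; exact intertwine_inv hi
        | mul g g' hg hg' => rw [map_mul, map_mul, map_mul]; exact intertwine_mul hg hg'
      induction a using induction_of with
      | hp =>
        refine isClosed_eq ?_ ?_
        · exact ((continuous_starHom (liftCStar (shiftRep D))).comp
            (continuous_starHom (mapCStar f))).clm_apply continuous_const
        · exact (copy (0 : ZMod m)).continuous.comp ((continuous_starHom π).clm_apply continuous_const)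
      | hadd a b ha hb => simp only [map_add, add_apply, ha, hb]
      | hs g c =>
        rw [map_smul, map_smul, map_smul, mapCStar_of, liftCStar_of]
        change c • (shiftRep D (f g) : Copies (ZMod m) H →L[ℂ] Copies (ZMod m) H) (copy 0 h) =
          copy 0 (c • π (of _ g) h)
        rw [hg, map_smul]
        rfl
    · refine fun a => commute_of_forall_of _ (fun g => ?_) a
      rw [liftCStar_of]
      exact commute_shiftRep_ampl D T (hDT T fun i => hT _) g
  refine h.of_extension (mapCStar f) (mapCStar f) fun H _ _ _ π σ hc => ?_
  -- After the extension of `π` its commutant acts diagonally, so it is the amplification of `σ` that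
  -- has to be extended in a second step.
  obtain ⟨π', hπ, hπT⟩ := ext H _ _ _ π
  obtain ⟨σ', hσ, hσT⟩ := ext _ _ _ inferInstance ((ampl (ZMod m) H).comp σ)
  have hc' : ∀ a b, Commute ((ampl (ZMod m) H).comp σ b) (π' a) :=
    fun a b => (hπT _ (fun a => hc a b) a).symm
  refine ⟨_, _, _, inferInstance, (copy 0).comp (copy 0),
    (ampl (ZMod m) (Copies (ZMod m) H)).comp π', σ', fun a b => ?_, fun a h => ?_, fun b h => ?_⟩
  · exact (hσT _ (hc' a) b).symm
  · change ampl (ZMod m) (Copies (ZMod m) H) (π' _) (copy 0 (copy 0 h)) = copy 0 (copy 0 (π a h))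
    rw [ampl_copy, hπ]
  · change σ' _ (copy 0 (copy 0 h)) = copy 0 (copy 0 (σ b h))
    rw [hσ]
    exact congrArg (copy 0) (ampl_copy (σ b) 0 h)

end Steering

/-! ### Measurements and unitaries -/

namespace Measurement

/-- The primitive `m`-th root of unity `exp(2πi/m)`. -/
def root (m : ℕ) : ℂ := Complex.exp (2 * Real.pi * Complex.I / m)

theorem root_pow (m : ℕ) (hm : m ≠ 0) : root m ^ m = 1 :=
  (Complex.isPrimitiveRoot_exp m hm).pow_eq_one

theorem star_root_mul_root (m : ℕ) (hm : m ≠ 0) : star (root m) * root m = 1 := by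
  have h : ‖root m‖ = 1 := Complex.norm_eq_one_of_pow_eq_one (root_pow m hm) hm
  have := Complex.conj_mul' (root m)
  rw [h] at this
  simpa using this

theorem root_mul_star_root (m : ℕ) (hm : m ≠ 0) : root m * star (root m) = 1 := by
  rw [mul_comm, star_root_mul_root m hm]

/-- Orthogonality of the characters of `ℤ_m`. -/
theorem sum_root_pow {m : ℕ} (i j : Fin m) :
    ∑ a : Fin m, (root m ^ (a : ℕ)) ^ (i : ℕ) * (star (root m) ^ (a : ℕ)) ^ (j : ℕ) =
      if i = j then (m : ℂ) else 0 := by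
  have hm : m ≠ 0 := fun h => by subst h; exact i.elim0
  set z : ℂ := root m ^ (i : ℕ) * star (root m) ^ (j : ℕ) with hz
  have h1 : ∀ a : Fin m, (root m ^ (a : ℕ)) ^ (i : ℕ) * (star (root m) ^ (a : ℕ)) ^ (j : ℕ) =
      z ^ (a : ℕ) := by
    intro a
    rw [hz, mul_pow, ← pow_mul, ← pow_mul, ← pow_mul, ← pow_mul, mul_comm (a : ℕ),
      mul_comm (a : ℕ)]
  simp only [h1]
  rw [Fin.sum_univ_eq_sum_range fun a => z ^ a]
  split_ifs with hij
  · subst hij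
    have : z = 1 := by rw [hz, ← mul_pow, root_mul_star_root m hm, one_pow]
    simp [this]
  · have hz1 : z ≠ 1 := by
      intro h
      have h2 : root m ^ (i : ℕ) = root m ^ (j : ℕ) := by
        calc root m ^ (i : ℕ) = root m ^ (i : ℕ) * (star (root m) * root m) ^ (j : ℕ) := by
              rw [star_root_mul_root m hm, one_pow, mul_one]
          _ = z * root m ^ (j : ℕ) := by rw [hz, mul_pow, mul_assoc]
          _ = root m ^ (j : ℕ) := by rw [h, one_mul]
      exact hij (Fin.ext ((Complex.isPrimitiveRoot_exp m hm).pow_inj i.2 j.2 h2))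
    have hzm : z ^ m = 1 := by
      have hs : star (root m) ^ m = 1 := by rw [← star_pow, root_pow m hm, star_one]
      rw [hz, mul_pow, pow_right_comm, pow_right_comm (star _), root_pow m hm, hs, one_pow,
        one_pow, one_mul]
    have := mul_geom_sum z m
    rw [hzm, sub_self] at this
    exact (mul_eq_zero.1 this).resolve_left (sub_ne_zero.2 hz1)

section Algebra

variable {A : Type*} [Ring A] [StarRing A] [Algebra ℂ A] [StarModule ℂ A] {m : ℕ}

/-- The Fourier coefficient `(1/m) ∑ⱼ ω^(-aj) wʲ`. If `w` is a unitary with `w^m = 1`, it is the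
spectral projection of `w` at `ω^a`. -/
def fourierElt (m : ℕ) (w : A) (a : Fin m) : A :=
  (m : ℂ)⁻¹ • ∑ j : Fin m, (star (root m) ^ (a : ℕ)) ^ (j : ℕ) • w ^ (j : ℕ)

/-- The effect `|fourierElt m w a|²`. For an arbitrary unitary `w` these effects are a measurement,
by Parseval's identity; if moreover `w^m = 1`, they are the spectral projections of `w`. -/
def effect (m : ℕ) (w : A) (a : Fin m) : A := star (fourierElt m w a) * fourierElt m w a

theorem map_effect {B : Type*} [Ring B] [StarRing B] [Algebra ℂ B] [StarModule ℂ B]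
    (π : A →⋆ₐ[ℂ] B) (w : A) (a : Fin m) : π (effect m w a) = effect m (π w) a := by
  simp [effect, fourierElt, map_star]

theorem sum_effect (hm : m ≠ 0) {w : A} (hw : star w * w = 1) : ∑ a, effect m w a = 1 := by
  have hm' : (m : ℂ) ≠ 0 := Nat.cast_ne_zero.2 hm
  have hpow : ∀ j : ℕ, star w ^ j * w ^ j = 1 := by
    intro j
    induction j with
    | zero => simp
    | succ j ih =>
      rw [pow_succ, pow_succ', mul_assoc, ← mul_assoc (star w), hw, one_mul, ih]
  have h1 : ∀ a : Fin m, effect m w a = ((m : ℂ)⁻¹ * (m : ℂ)⁻¹) • ∑ i : Fin m, ∑ j : Fin m,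
      ((root m ^ (a : ℕ)) ^ (i : ℕ) * (star (root m) ^ (a : ℕ)) ^ (j : ℕ)) •
        (star w ^ (i : ℕ) * w ^ (j : ℕ)) := by
    intro a
    simp only [effect, fourierElt, star_smul, star_sum, star_pow, star_star, smul_mul_smul_comm,
      Finset.sum_mul_sum]
    simp
  simp only [h1]
  rw [← Finset.smul_sum, Finset.sum_comm]
  have h2 : ∀ i : Fin m, ∑ a : Fin m, ∑ j : Fin m,
      ((root m ^ (a : ℕ)) ^ (i : ℕ) * (star (root m) ^ (a : ℕ)) ^ (j : ℕ)) •
        (star w ^ (i : ℕ) * w ^ (j : ℕ)) = (m : ℂ) • 1 := by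
    intro i
    rw [Finset.sum_comm]
    simp only [← Finset.sum_smul, sum_root_pow]
    rw [Finset.sum_eq_single i]
    · rw [if_pos rfl, hpow]
    · intro j _ hj
      rw [if_neg hj.symm, zero_smul]
    · simp
  simp only [h2, Finset.sum_const, Finset.card_univ, Fintype.card_fin]
  rw [← Nat.cast_smul_eq_nsmul ℂ, smul_smul, smul_smul]
  field_simp
  simp

/-- A unitary of order `m` is recovered from its spectral projections. -/
theorem sum_root_smul_effect (hm : m ≠ 0) {w : A} (hw : star w * w = 1) (hwm : w ^ m = 1) :
    ∑ a : Fin m, root m ^ (a : ℕ) • effect m w a = w := by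
  have hm' : (m : ℂ) ≠ 0 := Nat.cast_ne_zero.2 hm
  have h1 : ∀ a : Fin m, w * fourierElt m w a = root m ^ (a : ℕ) • fourierElt m w a := by
    intro a
    set v : A := star (root m) ^ (a : ℕ) • w with hv
    have hvm : v ^ m = 1 := by
      rw [hv, smul_pow, hwm, ← pow_mul, mul_comm, pow_mul, ← star_pow, root_pow m hm]
      simp
    have hF : fourierElt m w a = (m : ℂ)⁻¹ • ∑ j ∈ Finset.range m, v ^ j := by
      rw [← Fin.sum_univ_eq_sum_range fun j => v ^ j]
      simp only [hv, smul_pow, fourierElt]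
    have h2 : v * ∑ j ∈ Finset.range m, v ^ j = ∑ j ∈ Finset.range m, v ^ j := by
      have := mul_geom_sum v m
      rwa [hvm, sub_self, sub_mul, one_mul, sub_eq_zero] at this
    have hwv : w = root m ^ (a : ℕ) • v := by
      rw [hv, smul_smul, ← mul_pow, root_mul_star_root m hm, one_pow, one_smul]
    rw [hF, mul_smul_comm]
    conv_lhs => rw [hwv]
    rw [smul_mul_assoc, h2, smul_comm]
  have h3 : ∀ a : Fin m, star w * fourierElt m w a =
      star (root m) ^ (a : ℕ) • fourierElt m w a := by
    intro a
    have : fourierElt m w a = root m ^ (a : ℕ) • (star w * fourierElt m w a) := by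
      rw [← mul_smul_comm, ← h1, ← mul_assoc, hw, one_mul]
    conv_rhs => rw [this]
    rw [smul_smul, ← mul_pow, star_root_mul_root m hm, one_pow, one_smul]
  have h4 : ∀ (a : Fin m) (j : ℕ), star w ^ j * fourierElt m w a =
      (star (root m) ^ (a : ℕ)) ^ j • fourierElt m w a := by
    intro a j
    induction j with
    | zero => simp
    | succ j ih => rw [pow_succ', mul_assoc, ih, mul_smul_comm, h3, smul_smul, pow_succ]
  have h5 : ∀ a : Fin m, effect m w a = fourierElt m w a := by
    intro a
    have hs : star (fourierElt m w a) =
        (m : ℂ)⁻¹ • ∑ j : Fin m, (root m ^ (a : ℕ)) ^ (j : ℕ) • star w ^ (j : ℕ) := by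
      simp [fourierElt]
    rw [effect, hs, smul_mul_assoc, Finset.sum_mul]
    simp only [smul_mul_assoc, h4, smul_smul]
    simp only [← mul_pow, root_mul_star_root m hm, one_pow, one_smul, Finset.sum_const,
      Finset.card_univ, Fintype.card_fin]
    rw [← Nat.cast_smul_eq_nsmul ℂ, smul_smul, inv_mul_cancel₀ hm', one_smul]
  calc ∑ a : Fin m, root m ^ (a : ℕ) • effect m w a
      = ∑ a, w * effect m w a := by simp only [h5, h1]
    _ = w := by rw [← Finset.mul_sum, sum_effect hm hw, mul_one]

/-- A projective measurement: self-adjoint, mutually orthogonal idempotents with sum `1`. -/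
structure IsPVM (P : Fin m → A) : Prop where
  star_eq : ∀ a, star (P a) = P a
  mul_eq : ∀ a b, P a * P b = if a = b then P a else 0
  sum_eq : ∑ a, P a = 1

theorem IsPVM.map {B : Type*} [Ring B] [StarRing B] [Algebra ℂ B] [StarModule ℂ B]
    {P : Fin m → A} (hP : IsPVM P) (π : A →⋆ₐ[ℂ] B) : IsPVM fun a => π (P a) where
  star_eq a := by rw [← map_star, hP.star_eq]
  mul_eq a b := by rw [← map_mul, hP.mul_eq]; split_ifs <;> simp
  sum_eq := by rw [← map_sum, hP.sum_eq, map_one]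

/-- The unitary `∑ₐ ω^a P a` of a projective measurement. -/
def pvmUnitary (P : Fin m → A) : A := ∑ a : Fin m, root m ^ (a : ℕ) • P a

theorem IsPVM.sum_smul_mul {P : Fin m → A} (hP : IsPVM P) (f g : Fin m → ℂ) :
    (∑ a, f a • P a) * ∑ a, g a • P a = ∑ a, (f a * g a) • P a := by
  rw [Finset.sum_mul_sum]
  refine Finset.sum_congr rfl fun a _ => ?_
  rw [Finset.sum_eq_single a]
  · rw [smul_mul_smul_comm, hP.mul_eq, if_pos rfl]
  · intro b _ hb
    rw [smul_mul_smul_comm, hP.mul_eq, if_neg hb.symm, smul_zero]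
  · simp

theorem IsPVM.pvmUnitary_pow {P : Fin m → A} (hP : IsPVM P) (j : ℕ) :
    pvmUnitary P ^ j = ∑ a : Fin m, (root m ^ (a : ℕ)) ^ j • P a := by
  induction j with
  | zero => simp [hP.sum_eq]
  | succ j ih => rw [pow_succ, ih, pvmUnitary, hP.sum_smul_mul]; simp only [pow_succ]

theorem IsPVM.pvmUnitary_pow_card {P : Fin m → A} (hP : IsPVM P) (hm : m ≠ 0) :
    pvmUnitary P ^ m = 1 := by
  rw [hP.pvmUnitary_pow, ← hP.sum_eq]
  refine Finset.sum_congr rfl fun a _ => ?_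
  rw [← pow_mul, mul_comm, pow_mul, root_pow m hm, one_pow, one_smul]

theorem IsPVM.star_pvmUnitary {P : Fin m → A} (hP : IsPVM P) :
    star (pvmUnitary P) = ∑ a : Fin m, star (root m) ^ (a : ℕ) • P a := by
  simp [pvmUnitary, hP.star_eq]

theorem IsPVM.pvmUnitary_mem {P : Fin m → A} (hP : IsPVM P) (hm : m ≠ 0) :
    pvmUnitary P ∈ unitary A := by
  constructor
  · rw [hP.star_pvmUnitary, pvmUnitary, hP.sum_smul_mul, ← hP.sum_eq]
    simp only [← mul_pow, star_root_mul_root m hm, one_pow, one_smul]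
  · rw [hP.star_pvmUnitary, pvmUnitary, hP.sum_smul_mul, ← hP.sum_eq]
    simp only [← mul_pow, root_mul_star_root m hm, one_pow, one_smul]

/-- The effects of the unitary of a projective measurement are the given projections. -/
theorem IsPVM.effect_pvmUnitary {P : Fin m → A} (hP : IsPVM P) (a : Fin m) :
    effect m (pvmUnitary P) a = P a := by
  have hm : m ≠ 0 := fun h => by subst h; exact a.elim0
  have hm' : (m : ℂ) ≠ 0 := Nat.cast_ne_zero.2 hm
  have h1 : fourierElt m (pvmUnitary P) a = P a := by
    simp only [fourierElt, hP.pvmUnitary_pow, Finset.smul_sum]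
    rw [Finset.sum_comm]
    have h2 : ∀ b : Fin m, ∑ j : Fin m, (m : ℂ)⁻¹ • (star (root m) ^ (a : ℕ)) ^ (j : ℕ) •
        (root m ^ (b : ℕ)) ^ (j : ℕ) • P b = if b = a then P b else 0 := by
      intro b
      simp only [smul_smul, ← Finset.sum_smul, ← Finset.mul_sum]
      have h3 : ∑ j : Fin m, (star (root m) ^ (a : ℕ)) ^ (j : ℕ) * (root m ^ (b : ℕ)) ^ (j : ℕ) =
          if b = a then (m : ℂ) else 0 := by
        rw [← sum_root_pow]
        refine Finset.sum_congr rfl fun j _ => ?_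
        rw [mul_comm, ← pow_mul, ← pow_mul, ← pow_mul, ← pow_mul, mul_comm (j : ℕ),
          mul_comm (j : ℕ)]
      rw [h3]
      split_ifs
      · rw [inv_mul_cancel₀ hm', one_smul]
      · simp
    simp only [h2]
    simp
  rw [effect, h1, hP.star_eq, hP.mul_eq, if_pos rfl]

end Algebra

section Operators

variable {H K : Type*} [NormedAddCommGroup H] [InnerProductSpace ℂ H] [CompleteSpace H]
  [NormedAddCommGroup K] [InnerProductSpace ℂ K] [CompleteSpace K] {m : ℕ}

theorem effect_isPositive (w : H →L[ℂ] H) (a : Fin m) : (effect m w a).IsPositive :=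
  ContinuousLinearMap.isPositive_adjoint_comp_self (fourierElt m w a)

/-- Effects respect intertwiners of unitaries. -/
theorem effect_intertwine {W : unitary (K →L[ℂ] K)} {w : unitary (H →L[ℂ] H)} (V : H →L[ℂ] K)
    (h : ∀ x, (W : K →L[ℂ] K) (V x) = V ((w : H →L[ℂ] H) x)) (a : Fin m) (x : H) :
    effect m (W : K →L[ℂ] K) a (V x) = V (effect m (w : H →L[ℂ] H) a x) := by
  have hpow : ∀ (W : K →L[ℂ] K) (w : H →L[ℂ] H), (∀ x, W (V x) = V (w x)) →
      ∀ (j : ℕ) x, (W ^ j) (V x) = V ((w ^ j) x) := by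
    intro W w h j
    induction j with
    | zero => intro x; simp
    | succ j ih =>
      intro x
      rw [pow_succ, pow_succ]
      change (W ^ j) (W (V x)) = V ((w ^ j) (w x))
      rw [h, ih]
  have h' : ∀ x, star (W : K →L[ℂ] K) (V x) = V (star (w : H →L[ℂ] H) x) :=
    OpMatrix.intertwine_inv h
  have hF : ∀ x, fourierElt m (W : K →L[ℂ] K) a (V x) =
      V (fourierElt m (w : H →L[ℂ] H) a x) := by
    intro x
    simp [fourierElt, hpow _ _ h]
  have hF' : ∀ x, star (fourierElt m (W : K →L[ℂ] K) a) (V x) =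
      V (star (fourierElt m (w : H →L[ℂ] H) a) x) := by
    intro x
    simp [fourierElt, hpow _ _ h']
  change star (fourierElt m (W : K →L[ℂ] K) a) (fourierElt m (W : K →L[ℂ] K) a (V x)) =
    V (star (fourierElt m (w : H →L[ℂ] H) a) (fourierElt m (w : H →L[ℂ] H) a x))
  rw [hF, hF']

end Operators

end Measurement

/-! ### Dilation of measurements to projective measurements -/

namespace Steering

open OpMatrix Measurement ContinuousLinearMap

variable {k m : ℕ} {H : Type} [NormedAddCommGroup H] [InnerProductSpace ℂ H] [CompleteSpace H]

theorem _root_.Measurement.IsPVM.isPositive {P : Fin m → H →L[ℂ] H} (hP : IsPVM P) (a : Fin m) :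
    (P a).IsPositive := by
  have h : star (P a) * P a = P a := by rw [hP.star_eq, hP.mul_eq, if_pos rfl]
  rw [← h]
  exact isPositive_adjoint_comp_self (P a)

theorem isPVM_single (ι : Type*) [Fintype ι] [DecidableEq ι] (m : ℕ) (e : Fin m ≃ ι) :
    IsPVM fun a : Fin m => (Pi.single (e a) 1 : ι → H →L[ℂ] H) where
  star_eq a := by
    ext i : 1
    by_cases h : i = e a
    · subst h; simp
    · simp [h]
  mul_eq a b := by
    ext i : 1
    by_cases h : a = b
    · subst h
      by_cases hi : i = e a
      · subst hi; simp
      · simp [hi]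
    · by_cases hi : i = e a
      · subst hi; simp [h]
      · simp [h, hi]
  sum_eq := by
    ext i : 1
    rw [Finset.sum_apply, Finset.sum_eq_single (e.symm i)]
    · simp
    · intro a _ ha
      rw [Pi.single_eq_of_ne]
      rintro rfl
      simp at ha
    · simp

open scoped ComplexOrder in
/-- Naimark dilation of one of several measurements: along the isometry `h ↦ (√(A x₀ a) h)ₐ` the
measurement `A x₀` dilates to the coordinate projections, while the other measurements are extended
trivially to the complement of the range of the isometry. The commutant of the measurements acts
diagonally. -/
theorem exists_dilation_step {A : Fin k → Fin m → H →L[ℂ] H} (hA : IsPOVMFamily A) (x₀ : Fin k)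
    (a₀ : Fin m) :
    ∃ (V : H →ₗᵢ[ℂ] Copies (Fin m) H) (A' : Fin k → Fin m → Copies (Fin m) H →L[ℂ] Copies (Fin m) H),
      IsPOVMFamily A' ∧ IsPVM (A' x₀) ∧ (∀ x, IsPVM (A x) → IsPVM (A' x)) ∧
      (∀ x a, V.toContinuousLinearMap.adjoint ∘L A' x a ∘L V.toContinuousLinearMap = A x a) ∧
      ∀ T, (∀ x a, Commute T (A x a)) →
        (∀ h, ampl (Fin m) H T (V h) = V (T h)) ∧
        ∀ x a, Commute (ampl (Fin m) H T) (A' x a) := by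
  have hA0 : ∀ x a, 0 ≤ A x a := fun x a => (nonneg_iff_isPositive _).2 (hA.1 x a)
  let S : Fin m → H →L[ℂ] H := fun a => CFC.sqrt (A x₀ a)
  have hSS : ∀ a, S a * S a = A x₀ a := fun a => CFC.sqrt_mul_sqrt_self _ (hA0 x₀ a)
  have hSstar : ∀ a, star (S a) = S a := fun a => (CFC.sqrt_nonneg (A x₀ a)).isSelfAdjoint
  let v : H →L[ℂ] Copies (Fin m) H := colOp S
  have hv' : ∀ f, v.adjoint f = ∑ i, S i (f i) := by
    intro f
    simp only [v, adjoint_colOp_apply, hSstar]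
  have hvv : v.adjoint ∘L v = 1 := by
    ext h
    rw [coe_comp, Function.comp_apply, hv', ← hA.2 x₀]
    simp only [← hSS, v, colOp_apply, sum_apply]
    rfl
  let V : H →ₗᵢ[ℂ] Copies (Fin m) H :=
    ⟨v.toLinearMap, (norm_map_iff_adjoint_comp_self v).2 hvv⟩
  have hV : V.toContinuousLinearMap = v := rfl
  let Q : Copies (Fin m) H →L[ℂ] Copies (Fin m) H := 1 - v ∘L v.adjoint
  have hQv : Q ∘L v = 0 := by
    change (1 - v ∘L v.adjoint) ∘L v = 0
    rw [sub_comp, comp_assoc, hvv]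
    ext; simp
  have hQstar : Q.adjoint = Q := by
    change (1 - v ∘L v.adjoint).adjoint = 1 - v ∘L v.adjoint
    rw [map_sub, adjoint_comp, adjoint_adjoint]
    congr 1
    exact star_one (R := Copies (Fin m) H →L[ℂ] Copies (Fin m) H)
  have hvQ : v.adjoint ∘L Q = 0 := by
    have := congrArg ContinuousLinearMap.adjoint hQv
    rwa [adjoint_comp, hQstar, map_zero] at this
  have hQQ : Q ∘L Q = Q := by
    conv_lhs => enter [1]; change 1 - v ∘L v.adjoint
    rw [sub_comp, comp_assoc, hvQ]
    ext; simp
  -- On the complement `Q` of the range of `v` the other measurements have the certain outcome `a₀`,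
  -- which keeps projective measurements projective.
  let δ : Fin m → ℂ := fun a => if a = a₀ then 1 else 0
  let B : Fin k → Fin m → Copies (Fin m) H →L[ℂ] Copies (Fin m) H :=
    fun x a => v ∘L A x a ∘L v.adjoint + δ a • Q
  let P : Fin m → Copies (Fin m) H →L[ℂ] Copies (Fin m) H :=
    fun a => diagOp (Fin m) H (Pi.single a 1)
  have hP : IsPVM P := (isPVM_single (Fin m) m (Equiv.refl _)).map (diagOp (Fin m) H)
  have hδ0 : ∀ a, 0 ≤ δ a := by
    intro a
    simp only [δ]
    split_ifs <;> simp
  have hQpos : Q.IsPositive := by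
    have := isPositive_adjoint_comp_self Q
    rwa [hQstar, hQQ] at this
  have hB : IsPOVMFamily B := by
    refine ⟨fun x a => ((hA.1 x a).conj_adjoint v).add (hQpos.smul_of_nonneg (hδ0 a)),
      fun x => ?_⟩
    have h1 : ∑ a, v ∘L A x a ∘L v.adjoint = v ∘L v.adjoint := by
      ext f : 1
      have := DFunLike.congr_fun (hA.2 x) (v.adjoint f)
      simp only [sum_apply, one_apply_eq_self] at this
      simp only [sum_apply, coe_comp, Function.comp_apply, ← map_sum]
      exact congrArg v this
    simp only [B, Finset.sum_add_distrib, h1, ← Finset.sum_smul]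
    simp [δ, Q]
  have hBmul : ∀ x a b, B x a * B x b = v ∘L (A x a * A x b) ∘L v.adjoint + (δ a * δ b) • Q := by
    intro x a b
    have e1 : ∀ f, v.adjoint (v f) = f := DFunLike.congr_fun hvv
    have e2 : ∀ f, Q (v f) = 0 := DFunLike.congr_fun hQv
    have e3 : ∀ f, v.adjoint (Q f) = 0 := DFunLike.congr_fun hvQ
    have e4 : ∀ f, Q (Q f) = Q f := DFunLike.congr_fun hQQ
    ext f : 1
    change B x a (B x b f) = v (A x a (A x b (v.adjoint f))) + (δ a * δ b) • Q f
    change v (A x a (v.adjoint (v (A x b (v.adjoint f)) + δ b • Q f))) +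
      δ a • Q (v (A x b (v.adjoint f)) + δ b • Q f) = _
    simp only [map_add, map_smul, e1, e2, e3, e4, smul_zero, add_zero, zero_add, smul_smul]
  refine ⟨V, fun x => if x = x₀ then P else B x, ⟨fun x a => ?_, fun x => ?_⟩, ?_, fun x hx => ?_,
    fun x a => ?_, fun T hT => ?_⟩
  · dsimp only
    split_ifs
    exacts [hP.isPositive a, hB.1 x a]
  · dsimp only
    split_ifs
    exacts [hP.sum_eq, hB.2 x]
  · dsimp only
    rw [if_pos rfl]
    exact hP
  · dsimp only
    split_ifs
    · exact hP
    · refine ⟨fun a => (hB.1 x a).isSelfAdjoint, fun a b => ?_, hB.2 x⟩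
      rw [hBmul, hx.mul_eq]
      simp only [B, δ]
      by_cases hab : a = b
      · subst hab
        simp only [if_true]
        split_ifs
        · rw [mul_one]
        · rw [mul_zero]
      · have h0 : (if a = a₀ then (1 : ℂ) else 0) * (if b = a₀ then 1 else 0) = 0 := by
          by_cases ha : a = a₀
          · rw [if_neg (fun hb => hab (ha.trans hb.symm) : ¬b = a₀), mul_zero]
          · rw [if_neg ha, zero_mul]
        rw [if_neg hab, if_neg hab, h0]
        have hQ0 : (0 : ℂ) • Q = 0 := zero_smul ℂ Q
        rw [hQ0, zero_comp, comp_zero, add_zero]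
  · rw [hV]
    dsimp only
    split_ifs with hx
    · subst hx
      ext h
      simp only [coe_comp, Function.comp_apply, hv', P, diagOp_apply]
      rw [Finset.sum_eq_single a]
      · rw [Pi.single_eq_same, ← hSS]; rfl
      · intro b _ hb
        rw [Pi.single_eq_of_ne hb]
        simp
      · simp
    · ext h
      have e1 : ∀ f, v.adjoint (v f) = f := DFunLike.congr_fun hvv
      have e2 : ∀ f, Q (v f) = 0 := DFunLike.congr_fun hQv
      simp [B, e1, e2]
  · have hTS : ∀ a, Commute T (S a) := fun a => ((hT x₀ a).symm.cfcₙ_nnreal _).symm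
    have e1 : ∀ h, ampl (Fin m) H T (v h) = v (T h) := ampl_colOp T S hTS
    have e2 : ∀ f, v.adjoint (ampl (Fin m) H T f) = T (v.adjoint f) := by
      intro f
      rw [hv', hv', map_sum]
      refine Finset.sum_congr rfl fun i _ => ?_
      rw [ampl_apply]
      exact (DFunLike.congr_fun (hTS i).eq (f i)).symm
    refine ⟨e1, fun x a => ?_⟩
    dsimp only
    split_ifs
    · have : Commute (fun _ => T : Fin m → H →L[ℂ] H) (Pi.single a 1) := by
        ext i : 1
        by_cases hi : i = a
        · subst hi; simp
        · simp [hi]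
      exact this.map (diagOp (Fin m) H)
    · ext f : 1
      change ampl (Fin m) H T (v (A x a (v.adjoint f)) + δ a • (f - v (v.adjoint f))) =
        v (A x a (v.adjoint (ampl (Fin m) H T f))) +
          δ a • (ampl (Fin m) H T f - v (v.adjoint (ampl (Fin m) H T f)))
      have e3 : ∀ h, T (A x a h) = A x a (T h) := DFunLike.congr_fun (hT x a).eq
      simp only [map_add, map_smul, map_sub, e1, e2, e3]

/-- Simultaneous Naimark dilation: finitely many measurements on `H` are compressions of projective
measurements, and the commutant of the measurements extends to the dilation. -/
theorem exists_pvm_dilation {A : Fin k → Fin m → H →L[ℂ] H} (hA : IsPOVMFamily A) (hm : m ≠ 0) :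
    ∃ (K : Type) (_ : NormedAddCommGroup K) (_ : InnerProductSpace ℂ K) (_ : CompleteSpace K)
      (V : H →ₗᵢ[ℂ] K) (P : Fin k → Fin m → K →L[ℂ] K) (ρ : (H →L[ℂ] H) →⋆ₐ[ℂ] (K →L[ℂ] K)),
      (∀ x, IsPVM (P x)) ∧
      (∀ x a, V.toContinuousLinearMap.adjoint ∘L P x a ∘L V.toContinuousLinearMap = A x a) ∧
      ∀ T, (∀ x a, Commute T (A x a)) → (∀ h, ρ T (V h) = V (T h)) ∧
        ∀ x a, Commute (ρ T) (P x a) := by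
  -- The measurements are dilated one after the other; `s` is the set of those already projective.
  suffices h : ∀ s : Finset (Fin k), ∃ (K : Type) (_ : NormedAddCommGroup K)
      (_ : InnerProductSpace ℂ K) (_ : CompleteSpace K)
      (V : H →ₗᵢ[ℂ] K) (P : Fin k → Fin m → K →L[ℂ] K) (ρ : (H →L[ℂ] H) →⋆ₐ[ℂ] (K →L[ℂ] K)),
      IsPOVMFamily P ∧ (∀ x ∈ s, IsPVM (P x)) ∧
      (∀ x a, V.toContinuousLinearMap.adjoint ∘L P x a ∘L V.toContinuousLinearMap = A x a) ∧
      ∀ T, (∀ x a, Commute T (A x a)) → (∀ h, ρ T (V h) = V (T h)) ∧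
        ∀ x a, Commute (ρ T) (P x a) by
    obtain ⟨K, _, _, _, V, P, ρ, _, hP, hVP, hρ⟩ := h Finset.univ
    exact ⟨K, _, _, inferInstance, V, P, ρ, fun x => hP x (Finset.mem_univ x), hVP, hρ⟩
  intro s
  induction s using Finset.induction_on with
  | empty =>
    refine ⟨H, _, _, inferInstance, LinearIsometry.id, A, StarAlgHom.id ℂ _, hA, by simp,
      fun x a => ?_, fun T hT => ⟨fun h => rfl, hT⟩⟩
    have h1 : (LinearIsometry.id : H →ₗᵢ[ℂ] H).toContinuousLinearMap = 1 := rfl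
    have h2 : (1 : H →L[ℂ] H).adjoint = 1 := star_one (R := H →L[ℂ] H)
    rw [h1, h2]
    rfl
  | insert x₀ s _ ih =>
    obtain ⟨K, _, _, _, V, P, ρ, hPOVM, hP, hVP, hρ⟩ := ih
    obtain ⟨V', P', hPOVM', hPVM', hP', hVP', hρ'⟩ :=
      exists_dilation_step hPOVM x₀ ⟨0, Nat.pos_of_ne_zero hm⟩
    refine ⟨_, _, _, inferInstance, V'.comp V, P', (ampl (Fin m) K).comp ρ, hPOVM', ?_,
      fun x a => ?_, fun T hT => ?_⟩
    · intro x hx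
      rcases Finset.mem_insert.1 hx with rfl | hx
      exacts [hPVM', hP' x (hP x hx)]
    · have h1 : (V'.comp V).toContinuousLinearMap =
        V'.toContinuousLinearMap ∘L V.toContinuousLinearMap := rfl
      rw [h1, adjoint_comp, ← hVP x a, ← hVP' x a]
      rfl
    · obtain ⟨h1, h2⟩ := hρ T hT
      obtain ⟨h3, h4⟩ := hρ' (ρ T) h2
      exact ⟨fun h => (h3 (V h)).trans (congrArg V' (h1 h)), h4⟩

end Steering

/-! ### Steering data in terms of families of vectors -/

namespace Steering

open OpMatrix Measurement TensorNorm

section Vec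

variable {d : ℕ} {H : Type} [NormedAddCommGroup H] [InnerProductSpace ℂ H]

theorem elemTensor_add_right {E F : Type*} [NormedAddCommGroup E] [InnerProductSpace ℂ E]
    [NormedAddCommGroup F] [InnerProductSpace ℂ F] (x : E) (y y' : F) :
    elemTensor x (y + y') = elemTensor x y + elemTensor x y' := by
  simp only [elemTensor, TensorProduct.tmul_add, UniformSpace.Completion.coe_add]

theorem elemTensor_smul_right {E F : Type*} [NormedAddCommGroup E] [InnerProductSpace ℂ E]
    [NormedAddCommGroup F] [InnerProductSpace ℂ F] (c : ℂ) (x : E) (y : F) :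
    elemTensor x (c • y) = c • elemTensor x y := by
  simp only [elemTensor, TensorProduct.tmul_smul, UniformSpace.Completion.coe_smul]

theorem elemTensor_smul_left {E F : Type*} [NormedAddCommGroup E] [InnerProductSpace ℂ E]
    [NormedAddCommGroup F] [InnerProductSpace ℂ F] (c : ℂ) (x : E) (y : F) :
    elemTensor (c • x) y = c • elemTensor x y := by
  simp only [elemTensor, ← TensorProduct.smul_tmul', UniformSpace.Completion.coe_smul]

theorem elemTensor_sum_left {E F ι : Type*} [NormedAddCommGroup E] [InnerProductSpace ℂ E]
    [NormedAddCommGroup F] [InnerProductSpace ℂ F] (s : Finset ι) (x : ι → E) (y : F) :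
    elemTensor (∑ i ∈ s, x i) y = ∑ i ∈ s, elemTensor (x i) y := by
  classical
  induction s using Finset.induction_on with
  | empty => simp [elemTensor]
  | insert i s hi ih =>
    rw [Finset.sum_insert hi, Finset.sum_insert hi, ← ih]
    simp only [elemTensor, TensorProduct.add_tmul, UniformSpace.Completion.coe_add]

/-- The vector `∑ᵢ eᵢ ⊗ ψ i` of `ℂ^d ⊗ H`. -/
def vec : Copies (Fin d) H →ₗᵢ[ℂ] HilbertTensor (EuclideanSpace ℂ (Fin d)) H where
  toFun ψ := ∑ i, elemTensor (EuclideanSpace.single i 1) (ψ i)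
  map_add' ψ φ := by simp [elemTensor_add_right, Finset.sum_add_distrib]
  map_smul' c ψ := by simp [elemTensor_smul_right, Finset.smul_sum]
  norm_map' ψ := by
    refine (sq_eq_sq₀ (norm_nonneg _) (norm_nonneg _)).1 ?_
    rw [← Complex.ofReal_inj, Complex.ofReal_pow, Complex.ofReal_pow,
      ← RCLike.ofReal_eq_complex_ofReal, ← inner_self_eq_norm_sq_to_K,
      ← inner_self_eq_norm_sq_to_K, inner_copies]
    change inner ℂ (∑ i, elemTensor (EuclideanSpace.single i (1 : ℂ)) (ψ i))
      (∑ i, elemTensor (EuclideanSpace.single i (1 : ℂ)) (ψ i)) = _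
    simp only [sum_inner, inner_sum, inner_elemTensor]
    refine Finset.sum_congr rfl fun i _ => ?_
    rw [Finset.sum_eq_single i]
    · simp
    · intro j _ hj
      rw [EuclideanSpace.inner_single_left]
      simp [hj]
    · simp

theorem vec_apply (ψ : Copies (Fin d) H) :
    vec ψ = ∑ i, elemTensor (EuclideanSpace.single i 1) (ψ i) := rfl

theorem opTensor_vec (V : Matrix (Fin d) (Fin d) ℂ) (T : H →L[ℂ] H) (ψ : Copies (Fin d) H) :
    opTensor (Matrix.toEuclideanCLM (𝕜 := ℂ) V) T (vec ψ) =
      vec (WithLp.toLp 2 fun i => ∑ j, V i j • T (ψ j)) := by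
  have h : ∀ j, Matrix.toEuclideanCLM (𝕜 := ℂ) V (EuclideanSpace.single j 1) =
      ∑ i, V i j • EuclideanSpace.single i (1 : ℂ) := by
    intro j
    ext i
    simp [Matrix.ofLp_toEuclideanCLM, Pi.single_apply]
  rw [vec_apply, vec_apply, map_sum]
  simp only [opTensor_elemTensor, h, elemTensor_sum_left, elemTensor_smul_left]
  rw [Finset.sum_comm]
  refine Finset.sum_congr rfl fun i _ => ?_
  have h2 : ∀ f : Fin d → H, elemTensor (EuclideanSpace.single i (1 : ℂ)) (∑ j, f j) =
      ∑ j, elemTensor (EuclideanSpace.single i (1 : ℂ)) (f j) := by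
    intro f
    exact map_sum ({ toFun := elemTensor (EuclideanSpace.single i (1 : ℂ))
                     map_zero' := by simp [elemTensor]
                     map_add' := elemTensor_add_right _ } : H →+ _) f _
  rw [h2]
  simp only [elemTensor_smul_right]

theorem inner_opTensor_vec (V : Matrix (Fin d) (Fin d) ℂ) (T : H →L[ℂ] H)
    (ψ : Copies (Fin d) H) :
    inner ℂ (vec ψ) (opTensor (Matrix.toEuclideanCLM (𝕜 := ℂ) V) T (vec ψ)) =
      ∑ i, ∑ j, V i j * inner ℂ (ψ i) (T (ψ j)) := by
  rw [opTensor_vec, LinearIsometry.inner_map_map, inner_copies]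
  simp

theorem vec_surjective [CompleteSpace H] (Ψ : HilbertTensor (EuclideanSpace ℂ (Fin d)) H) :
    ∃ ψ, vec ψ = Ψ := by
  have hclosed : IsClosed (Set.range (vec : Copies (Fin d) H → _)) :=
    (vec (d := d) (H := H)).isometry.isClosedEmbedding.isClosed_range
  induction Ψ using UniformSpace.Completion.induction_on with
  | hp => exact hclosed
  | ih z =>
    induction z using TensorProduct.induction_on with
    | zero => exact ⟨0, by rw [map_zero, UniformSpace.Completion.coe_zero]⟩
    | add z w hz hw =>
      obtain ⟨ψ, hψ⟩ := hz
      obtain ⟨φ, hφ⟩ := hw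
      exact ⟨ψ + φ, by rw [map_add, hψ, hφ, UniformSpace.Completion.coe_add]⟩
    | tmul x y =>
      refine ⟨WithLp.toLp 2 fun i => x i • y, ?_⟩
      have hx : x = ∑ i, x i • EuclideanSpace.single i (1 : ℂ) := by
        ext i; simp [Pi.single_apply]
      change _ = elemTensor x y
      conv_rhs => rw [hx, elemTensor_sum_left]
      rw [vec_apply]
      simp only [elemTensor_smul_right, elemTensor_smul_left]

end Vec

variable {k m d : ℕ}

/-- Commuting models of steering data, given by families of `d` vectors. -/
theorem mem_commutingData_iff {s : FunctionalFamily k m d} : s ∈ commutingData k m d ↔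
    ∃ (H : Type) (_ : NormedAddCommGroup H) (_ : InnerProductSpace ℂ H) (_ : CompleteSpace H)
      (A : Fin k → Fin m → H →L[ℂ] H) (B : Fin k → Fin m → H →L[ℂ] H) (ψ : Copies (Fin d) H),
      IsPOVMFamily A ∧ IsPOVMFamily B ∧ (∀ x a y b, Commute (A x a) (B y b)) ∧ ‖ψ‖ = 1 ∧
      (∀ x a V, s.1 x a V = ∑ i, ∑ j, V i j * inner ℂ (ψ i) (A x a (ψ j))) ∧
      (∀ y b W, s.2 y b W = ∑ i, ∑ j, W i j * inner ℂ (ψ i) (B y b (ψ j))) := by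
  constructor
  · rintro ⟨H, _, _, _, A, B, Ψ, hA, hB, hAB, hΨ, h1, h2⟩
    obtain ⟨ψ, rfl⟩ := vec_surjective Ψ
    refine ⟨H, _, _, _, A, B, ψ, hA, hB, fun x a y b => hAB x y a b, by simpa using hΨ,
      fun x a V => ?_, fun y b W => ?_⟩
    · rw [h1, inner_opTensor_vec]
    · rw [h2, inner_opTensor_vec]
  · rintro ⟨H, _, _, _, A, B, ψ, hA, hB, hAB, hψ, h1, h2⟩
    refine ⟨H, _, _, _, A, B, vec ψ, hA, hB, fun x y a b => hAB x a y b, by simpa using hψ,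
      fun x a V => ?_, fun y b W => ?_⟩
    · rw [h1, inner_opTensor_vec]
    · rw [h2, inner_opTensor_vec]

/-- Tensor product models of steering data, given by families of `d` vectors. -/
theorem mem_tensorData_iff {s : FunctionalFamily k m d} : s ∈ tensorData k m d ↔
    ∃ (HA : Type) (_ : NormedAddCommGroup HA) (_ : InnerProductSpace ℂ HA) (_ : CompleteSpace HA)
      (HB : Type) (_ : NormedAddCommGroup HB) (_ : InnerProductSpace ℂ HB) (_ : CompleteSpace HB)
      (A : Fin k → Fin m → HA →L[ℂ] HA) (B : Fin k → Fin m → HB →L[ℂ] HB)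
      (ψ : Copies (Fin d) (HilbertTensor HA HB)),
      IsPOVMFamily A ∧ IsPOVMFamily B ∧ ‖ψ‖ = 1 ∧
      (∀ x a V, s.1 x a V = ∑ i, ∑ j, V i j * inner ℂ (ψ i) (ampLeft HA HB (A x a) (ψ j))) ∧
      (∀ y b W, s.2 y b W = ∑ i, ∑ j, W i j * inner ℂ (ψ i) (ampRight HA HB (B y b) (ψ j))) := by
  constructor
  · rintro ⟨HA, _, _, _, HB, _, _, _, A, B, Ψ, hA, hB, hΨ, h1, h2⟩
    obtain ⟨ψ, rfl⟩ := vec_surjective Ψ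
    refine ⟨HA, _, _, _, HB, _, _, _, A, B, ψ, hA, hB, by simpa using hΨ,
      fun x a V => ?_, fun y b W => ?_⟩
    · rw [h1, inner_opTensor_vec]; rfl
    · rw [h2, inner_opTensor_vec]; rfl
  · rintro ⟨HA, _, _, _, HB, _, _, _, A, B, ψ, hA, hB, hψ, h1, h2⟩
    refine ⟨HA, _, _, _, HB, _, _, _, A, B, vec ψ, hA, hB, by simpa using hψ,
      fun x a V => ?_, fun y b W => ?_⟩
    · rw [h1, inner_opTensor_vec]; rfl
    · rw [h2, inner_opTensor_vec]; rfl

theorem IsPOVMFamily.map {H K : Type} [NormedAddCommGroup H] [InnerProductSpace ℂ H]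
    [CompleteSpace H] [NormedAddCommGroup K] [InnerProductSpace ℂ K] [CompleteSpace K]
    {A : Fin k → Fin m → H →L[ℂ] H} (hA : IsPOVMFamily A)
    (π : (H →L[ℂ] H) →⋆ₐ[ℂ] (K →L[ℂ] K)) : IsPOVMFamily fun x a => π (A x a) := by
  refine ⟨fun x a => ?_, fun x => by rw [← map_sum, hA.2 x, map_one]⟩
  rw [← ContinuousLinearMap.nonneg_iff_isPositive]
  exact map_nonneg π ((ContinuousLinearMap.nonneg_iff_isPositive _).2 (hA.1 x a))

theorem tensorData_subset_commutingData : tensorData k m d ⊆ commutingData k m d := by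
  intro s hs
  obtain ⟨HA, _, _, _, HB, _, _, _, A, B, ψ, hA, hB, hψ, h1, h2⟩ := mem_tensorData_iff.1 hs
  exact mem_commutingData_iff.2 ⟨HilbertTensor HA HB, _, _, inferInstance, _, _, ψ,
    hA.map (ampLeft HA HB), hB.map (ampRight HA HB), fun x a y b => commute_amp _ _, hψ, h1, h2⟩

/-- The measurements of a tensor product model can be chosen projective. -/
theorem exists_pvm_of_mem_tensorData (hm : m ≠ 0) {s : FunctionalFamily k m d}
    (hs : s ∈ tensorData k m d) :
    ∃ (HA : Type) (_ : NormedAddCommGroup HA) (_ : InnerProductSpace ℂ HA) (_ : CompleteSpace HA)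
      (HB : Type) (_ : NormedAddCommGroup HB) (_ : InnerProductSpace ℂ HB) (_ : CompleteSpace HB)
      (P : Fin k → Fin m → HA →L[ℂ] HA) (Q : Fin k → Fin m → HB →L[ℂ] HB)
      (ψ : Copies (Fin d) (HilbertTensor HA HB)),
      (∀ x, IsPVM (P x)) ∧ (∀ y, IsPVM (Q y)) ∧
      (∀ x a V, s.1 x a V = ∑ i, ∑ j, V i j * inner ℂ (ψ i) (ampLeft HA HB (P x a) (ψ j))) ∧
      (∀ y b W, s.2 y b W = ∑ i, ∑ j, W i j * inner ℂ (ψ i) (ampRight HA HB (Q y b) (ψ j))) := by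
  obtain ⟨HA, _, _, _, HB, _, _, _, A, B, ψ, hA, hB, hψ, h1, h2⟩ := mem_tensorData_iff.1 hs
  obtain ⟨KA, _, _, _, V, P, -, hP, hVP, -⟩ := exists_pvm_dilation hA hm
  obtain ⟨KB, _, _, _, W, Q, -, hQ, hWQ, -⟩ := exists_pvm_dilation hB hm
  have hV : V.toContinuousLinearMap.adjoint ∘L (1 : KA →L[ℂ] KA) ∘L V.toContinuousLinearMap = 1 :=
    V.adjoint_comp_self
  have hW : W.toContinuousLinearMap.adjoint ∘L (1 : KB →L[ℂ] KB) ∘L W.toContinuousLinearMap = 1 :=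
    W.adjoint_comp_self
  refine ⟨KA, _, _, _, KB, _, _, _, P, Q, WithLp.toLp 2 fun i =>
    tensorMap V.toContinuousLinearMap W.toContinuousLinearMap (ψ i), hP, hQ, fun x a M => ?_,
    fun y b M => ?_⟩
  · simp only [ampLeft_apply, inner_tensorMap_tensorMap, hVP, hW]
    exact h1 x a M
  · simp only [ampRight_apply, inner_tensorMap_tensorMap, hWQ, hV]
    exact h2 y b M

end Steering

/-! ### Matrices over a tensor product with a unique C⋆-norm -/

namespace TensorNorm

open OpMatrix

universe u

theorem le_of_forall_pow_two_pow_le {a C D : ℝ} (hC : 0 ≤ C)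
    (h : ∀ n : ℕ, a ^ 2 ^ n ≤ D * C ^ 2 ^ n) : a ≤ C := by
  by_contra! hlt
  rcases hC.eq_or_lt with rfl | hC
  · have := h 0
    simp at this
    linarith
  · have h1 : 1 < a / C := (one_lt_div hC).2 hlt
    obtain ⟨n, hn⟩ := pow_unbounded_of_one_lt D h1
    have h2 : (a / C) ^ n ≤ (a / C) ^ 2 ^ n := pow_le_pow_right₀ h1.le Nat.lt_two_pow_self.le
    have h3 : (a / C) ^ 2 ^ n ≤ D := by
      rw [div_pow, div_le_iff₀ (pow_pos hC _)]
      exact h n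
    linarith

variable {A B : Type u} [CStarAlgebra A] [CStarAlgebra B] {ι : Type} [Fintype ι] [DecidableEq ι]

/-- The operator given by a matrix over `A ⊗ B` in the representation of a commuting pair. -/
def commMat {H : Type u} [NormedAddCommGroup H] [InnerProductSpace ℂ H] [CompleteSpace H]
    (π : A →⋆ₐ[ℂ] (H →L[ℂ] H)) (σ : B →⋆ₐ[ℂ] (H →L[ℂ] H)) (h : ∀ a b, Commute (π a) (σ b)) :
    Matrix ι ι (A ⊗[ℂ] B) →ₐ[ℂ] (Copies ι H →L[ℂ] Copies ι H) :=
  (matOpHom ι H).toAlgHom.comp (commRep π σ h).mapMatrix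

theorem commMat_apply {H : Type u} [NormedAddCommGroup H] [InnerProductSpace ℂ H] [CompleteSpace H]
    (π : A →⋆ₐ[ℂ] (H →L[ℂ] H)) (σ : B →⋆ₐ[ℂ] (H →L[ℂ] H)) (h : ∀ a b, Commute (π a) (σ b))
    (X : Matrix ι ι (A ⊗[ℂ] B)) : commMat π σ h X = matOp (X.map (commRep π σ h)) := rfl

/-- If the minimal and the maximal norm agree on `A ⊗ B`, spatial norm bounds on a self-adjoint
matrix over `A ⊗ B` hold in all commuting representations. The norm of the matrix is recovered from
the norms of the entries of its powers. -/
theorem MinEqMax.norm_commMat_le (hAB : MinEqMax A B) {X : Matrix ι ι (A ⊗[ℂ] B)} {C : ℝ}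
    (hC : 0 ≤ C)
    (hX : ∀ (H : Type u) (_ : NormedAddCommGroup H) (_ : InnerProductSpace ℂ H)
      (_ : CompleteSpace H) (K : Type u) (_ : NormedAddCommGroup K) (_ : InnerProductSpace ℂ K)
      (_ : CompleteSpace K) (π : A →⋆ₐ[ℂ] (H →L[ℂ] H)) (σ : B →⋆ₐ[ℂ] (K →L[ℂ] K)),
      ‖commMat ((ampLeft H K).comp π) ((ampRight H K).comp σ) (commute_spatial π σ) X‖ ≤ C)
    {H : Type u} [NormedAddCommGroup H] [InnerProductSpace ℂ H] [CompleteSpace H]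
    (π : A →⋆ₐ[ℂ] (H →L[ℂ] H)) (σ : B →⋆ₐ[ℂ] (H →L[ℂ] H)) (h : ∀ a b, Commute (π a) (σ b))
    (hsa : IsSelfAdjoint (commMat π σ h X)) :
    ‖commMat π σ h X‖ ≤ C := by
  refine le_of_forall_pow_two_pow_le (D := Fintype.card ι * Fintype.card ι) hC fun n => ?_
  have hentry : ∀ i j, ‖commRep π σ h ((X ^ 2 ^ n) i j)‖ ≤ C ^ 2 ^ n := by
    intro i j
    refine (norm_commRep_le_maxNorm π σ h _).trans ((hAB _).symm.le.trans ?_)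
    refine minNorm_le (pow_nonneg hC _) fun H _ _ _ K _ _ _ π σ => ?_
    rw [spatialRep_eq_commRep]
    refine (norm_entry_le ((X ^ 2 ^ n).map (commRep _ _ (commute_spatial π σ))) i j).trans ?_
    rw [← commMat_apply, map_pow]
    have hle := hX H _ _ _ K _ _ _ π σ
    set T := commMat ((ampLeft H K).comp π) ((ampRight H K).comp σ) (commute_spatial π σ) X
    exact (norm_pow_le' T (Nat.two_pow_pos n)).trans (pow_le_pow_left₀ (norm_nonneg T) hle _)
  rw [← hsa.norm_pow_two_pow, ← map_pow, commMat_apply]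
  refine (norm_matOp_le _).trans ?_
  calc ∑ i, ∑ j, ‖((X ^ 2 ^ n).map (commRep π σ h)) i j‖
      ≤ ∑ _i : ι, ∑ _j : ι, C ^ 2 ^ n :=
        Finset.sum_le_sum fun i _ => Finset.sum_le_sum fun j _ => hentry i j
    _ = Fintype.card ι * Fintype.card ι * C ^ 2 ^ n := by simp [mul_assoc]

/-- The norms of a matrix over `A ⊗ B` in all commuting representations are bounded. -/
theorem exists_commMat_bound (X : Matrix ι ι (A ⊗[ℂ] B)) : ∃ c : ℝ, ∀ (H : Type u)
    (_ : NormedAddCommGroup H) (_ : InnerProductSpace ℂ H) (_ : CompleteSpace H)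
    (π : A →⋆ₐ[ℂ] (H →L[ℂ] H)) (σ : B →⋆ₐ[ℂ] (H →L[ℂ] H)) (h : ∀ a b, Commute (π a) (σ b)),
    ‖commMat π σ h X‖ ≤ c := by
  choose c hc using fun i j => exists_commRep_bound (X i j)
  refine ⟨∑ i, ∑ j, c i j, fun H _ _ _ π σ h => ?_⟩
  rw [commMat_apply]
  exact (norm_matOp_le _).trans
    (Finset.sum_le_sum fun i _ => Finset.sum_le_sum fun j _ => hc i j H _ _ _ π σ h)

theorem norm_le_of_numericalRange_le {H : Type*} [NormedAddCommGroup H] [InnerProductSpace ℂ H]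
    [CompleteSpace H] {T : H →L[ℂ] H} {C : ℝ} (hC : 0 ≤ C) (hT : T.IsPositive)
    (h : ∀ φ, (inner ℂ φ (T φ)).re ≤ C * ‖φ‖ ^ 2) : ‖T‖ ≤ C := by
  have hT0 : 0 ≤ T := (ContinuousLinearMap.nonneg_iff_isPositive _).2 hT
  rw [CStarAlgebra.norm_le_iff_le_algebraMap T hC hT0, ContinuousLinearMap.le_def,
    ContinuousLinearMap.isPositive_def']
  refine ⟨(IsSelfAdjoint.algebraMap _ (IsSelfAdjoint.all C)).sub hT.isSelfAdjoint, fun φ => ?_⟩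
  have h1 : (algebraMap ℝ (H →L[ℂ] H) C) φ = (C : ℂ) • φ := by
    rw [Algebra.algebraMap_eq_smul_one]
    simp
  have h2 : (inner ℂ (T φ) φ).re = (inner ℂ φ (T φ)).re := by
    rw [← inner_conj_symm, Complex.conj_re]
  have h3 := h φ
  rw [ContinuousLinearMap.reApplyInnerSelf_apply, sub_apply, inner_sub_left, h1,
    inner_smul_left, inner_self_eq_norm_sq_to_K]
  simp only [map_sub, RCLike.re_to_complex, h2, Complex.conj_ofReal]
  have h4 : ((C : ℂ) * ((‖φ‖ : ℝ) : ℂ) ^ 2).re = C * ‖φ‖ ^ 2 := by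
    rw [← Complex.ofReal_pow, ← Complex.ofReal_mul, Complex.ofReal_re]
  change 0 ≤ ((C : ℂ) * ((‖φ‖ : ℝ) : ℂ) ^ 2).re - _
  rw [h4]
  linarith

theorem isSelfAdjoint_add_algebraMap {H : Type*} [NormedAddCommGroup H] [InnerProductSpace ℂ H]
    [CompleteSpace H] {T : H →L[ℂ] H} (hT : IsSelfAdjoint T) (c : ℝ) :
    IsSelfAdjoint (T + algebraMap ℂ (H →L[ℂ] H) (c : ℂ)) :=
  hT.add (IsSelfAdjoint.algebraMap _ (Complex.conj_ofReal c))

/-- If the minimal and the maximal norm agree on `A ⊗ B`, upper bounds for the numerical range of a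
self-adjoint matrix over `A ⊗ B` in the spatial representations hold in all commuting
representations. -/
theorem MinEqMax.numericalRange_le (hAB : MinEqMax A B) {X : Matrix ι ι (A ⊗[ℂ] B)} {w : ℝ}
    (hsa : ∀ (H : Type u) (_ : NormedAddCommGroup H) (_ : InnerProductSpace ℂ H)
      (_ : CompleteSpace H) (π : A →⋆ₐ[ℂ] (H →L[ℂ] H)) (σ : B →⋆ₐ[ℂ] (H →L[ℂ] H))
      (h : ∀ a b, Commute (π a) (σ b)), IsSelfAdjoint (commMat π σ h X))
    (hX : ∀ (H : Type u) (_ : NormedAddCommGroup H) (_ : InnerProductSpace ℂ H)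
      (_ : CompleteSpace H) (K : Type u) (_ : NormedAddCommGroup K) (_ : InnerProductSpace ℂ K)
      (_ : CompleteSpace K) (π : A →⋆ₐ[ℂ] (H →L[ℂ] H)) (σ : B →⋆ₐ[ℂ] (K →L[ℂ] K))
      (φ : Copies ι (HilbertTensor H K)),
      (inner ℂ φ (commMat ((ampLeft H K).comp π) ((ampRight H K).comp σ)
        (commute_spatial π σ) X φ)).re ≤ w * ‖φ‖ ^ 2)
    {H : Type u} [NormedAddCommGroup H] [InnerProductSpace ℂ H] [CompleteSpace H]
    (π : A →⋆ₐ[ℂ] (H →L[ℂ] H)) (σ : B →⋆ₐ[ℂ] (H →L[ℂ] H)) (h : ∀ a b, Commute (π a) (σ b))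
    (φ : Copies ι H) :
    (inner ℂ φ (commMat π σ h X φ)).re ≤ w * ‖φ‖ ^ 2 := by
  obtain ⟨c₀, hc₀⟩ := exists_commMat_bound X
  -- The shift by `c` makes the matrix positive in every representation.
  let c : ℝ := max c₀ |w|
  have hwc : 0 ≤ w + c := by
    have h1 : -|w| ≤ w := neg_abs_le w
    have h2 : |w| ≤ c := le_max_right _ _
    linarith
  let X' : Matrix ι ι (A ⊗[ℂ] B) := X + algebraMap ℂ _ (c : ℂ)
  have happly : ∀ (H : Type u) (_ : NormedAddCommGroup H) (_ : InnerProductSpace ℂ H)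
      (_ : CompleteSpace H) (π : A →⋆ₐ[ℂ] (H →L[ℂ] H)) (σ : B →⋆ₐ[ℂ] (H →L[ℂ] H))
      (h : ∀ a b, Commute (π a) (σ b)) (φ : Copies ι H),
      (inner ℂ φ (commMat π σ h X' φ)).re = (inner ℂ φ (commMat π σ h X φ)).re + c * ‖φ‖ ^ 2 := by
    intro H _ _ _ π σ h φ
    have h1 : commMat π σ h X' φ = commMat π σ h X φ + (c : ℂ) • φ := by
      change commMat π σ h (X + algebraMap ℂ _ (c : ℂ)) φ = _
      rw [map_add, AlgHom.commutes, Algebra.algebraMap_eq_smul_one]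
      rfl
    rw [h1, inner_add_right, inner_smul_right, inner_self_eq_norm_sq_to_K, Complex.add_re]
    congr 1
    change ((c : ℂ) * ((‖φ‖ : ℝ) : ℂ) ^ 2).re = _
    rw [← Complex.ofReal_pow, ← Complex.ofReal_mul, Complex.ofReal_re]
  have hsa' : ∀ (H : Type u) (_ : NormedAddCommGroup H) (_ : InnerProductSpace ℂ H)
      (_ : CompleteSpace H) (π : A →⋆ₐ[ℂ] (H →L[ℂ] H)) (σ : B →⋆ₐ[ℂ] (H →L[ℂ] H))
      (h : ∀ a b, Commute (π a) (σ b)), IsSelfAdjoint (commMat π σ h X') := by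
    intro H _ _ _ π σ h
    change IsSelfAdjoint (commMat π σ h (X + algebraMap ℂ _ (c : ℂ)))
    rw [map_add, AlgHom.commutes]
    exact isSelfAdjoint_add_algebraMap (hsa H _ _ _ π σ h) c
  have hpos : ∀ (H : Type u) (_ : NormedAddCommGroup H) (_ : InnerProductSpace ℂ H)
      (_ : CompleteSpace H) (π : A →⋆ₐ[ℂ] (H →L[ℂ] H)) (σ : B →⋆ₐ[ℂ] (H →L[ℂ] H))
      (h : ∀ a b, Commute (π a) (σ b)), (commMat π σ h X').IsPositive := by
    intro H _ _ _ π σ h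
    refine (ContinuousLinearMap.isPositive_def').2 ⟨hsa' H _ _ _ π σ h, fun φ => ?_⟩
    rw [ContinuousLinearMap.reApplyInnerSelf_apply, ← inner_conj_symm]
    change 0 ≤ (starRingEnd ℂ (inner ℂ φ (commMat π σ h X' φ))).re
    rw [Complex.conj_re, happly]
    have h1 : |(inner ℂ φ (commMat π σ h X φ)).re| ≤ c * ‖φ‖ ^ 2 := by
      refine (Complex.abs_re_le_norm _).trans ((norm_inner_le_norm _ _).trans ?_)
      calc ‖φ‖ * ‖commMat π σ h X φ‖ ≤ ‖φ‖ * (c * ‖φ‖) := by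
            refine mul_le_mul_of_nonneg_left ?_ (norm_nonneg _)
            exact (ContinuousLinearMap.le_opNorm _ _).trans (mul_le_mul_of_nonneg_right
              ((hc₀ H _ _ _ π σ h).trans (le_max_left _ _)) (norm_nonneg _))
        _ = c * ‖φ‖ ^ 2 := by ring
    linarith [(abs_le.1 h1).1]
  have hnorm : ‖commMat π σ h X'‖ ≤ w + c := by
    refine hAB.norm_commMat_le hwc (fun H _ _ _ K _ _ _ π σ => ?_) π σ h (hsa' H _ _ _ π σ h)
    refine norm_le_of_numericalRange_le hwc (hpos _ _ _ _ _ _ _) fun φ => ?_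
    rw [happly, add_mul]
    linarith [hX H _ _ _ K _ _ _ π σ φ]
  have h1 : (inner ℂ φ (commMat π σ h X' φ)).re ≤ (w + c) * ‖φ‖ ^ 2 := by
    refine (Complex.re_le_norm _).trans ((norm_inner_le_norm _ _).trans ?_)
    calc ‖φ‖ * ‖commMat π σ h X' φ‖ ≤ ‖φ‖ * ((w + c) * ‖φ‖) := by
          refine mul_le_mul_of_nonneg_left ?_ (norm_nonneg _)
          exact (ContinuousLinearMap.le_opNorm _ _).trans
            (mul_le_mul_of_nonneg_right hnorm (norm_nonneg _))
      _ = (w + c) * ‖φ‖ ^ 2 := by ring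
  rw [happly] at h1
  linarith

end TensorNorm

/-! ### Scores of models -/

namespace Steering

open OpMatrix Measurement TensorNorm MaxGroup

variable {k m d : ℕ}

/-- The functional `V ↦ ∑ V i j c i j` on matrices. -/
def functional (c : Fin d → Fin d → ℂ) : WeakDual ℂ (Matrix (Fin d) (Fin d) ℂ) :=
  StrongDual.toWeakDual (LinearMap.toContinuousLinearMap
    { toFun := fun V : Matrix (Fin d) (Fin d) ℂ => ∑ i, ∑ j, V i j * c i j
      map_add' := fun V W => by simp [add_mul, Finset.sum_add_distrib]
      map_smul' := fun a V => by simp [Finset.mul_sum, mul_assoc] })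

theorem functional_apply (c : Fin d → Fin d → ℂ) (V : Matrix (Fin d) (Fin d) ℂ) :
    functional c V = ∑ i, ∑ j, V i j * c i j := rfl

theorem tensorData_nonempty (hm : m ≠ 0) (hd : 1 ≤ d) : (tensorData k m d).Nonempty := by
  have : NeZero m := ⟨hm⟩
  let A : Fin k → Fin m → ℂ →L[ℂ] ℂ := fun _ => Pi.single 0 1
  have hA : IsPOVMFamily A := by
    refine ⟨fun x a => ?_, fun x => ?_⟩
    · simp only [A]
      by_cases ha : a = 0
      · subst ha
        rw [Pi.single_eq_same]
        exact ContinuousLinearMap.isPositive_one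
      · rw [Pi.single_eq_of_ne ha]
        exact ContinuousLinearMap.isPositive_zero
    · simp [A]
  let ψ : Copies (Fin d) (HilbertTensor ℂ ℂ) := copy ⟨0, hd⟩ (elemTensor 1 1)
  have hψ : ‖ψ‖ = 1 := by
    rw [LinearIsometry.norm_map]
    simp [elemTensor]
  exact ⟨⟨fun x a => functional fun i j => inner ℂ (ψ i) (ampLeft ℂ ℂ (A x a) (ψ j)),
    fun y b => functional fun i j => inner ℂ (ψ i) (ampRight ℂ ℂ (A y b) (ψ j))⟩,
    mem_tensorData_iff.2 ⟨ℂ, _, _, inferInstance, ℂ, _, _, inferInstance, A, A, ψ, hA, hA, hψ,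
      fun x a V => functional_apply _ _, fun y b W => functional_apply _ _⟩⟩

section GameOp

variable {H : Type} [NormedAddCommGroup H] [InnerProductSpace ℂ H] [CompleteSpace H]

/-- The operator matrix `∑ V x a ⊗ A x a + ∑ W y b ⊗ B y b`. -/
def gameOp (V W : Fin k → Fin m → Matrix (Fin d) (Fin d) ℂ) (A B : Fin k → Fin m → H →L[ℂ] H) :
    Matrix (Fin d) (Fin d) (H →L[ℂ] H) :=
  Matrix.of fun i j => ∑ x, ∑ a, V x a i j • A x a + ∑ y, ∑ b, W y b i j • B y b

theorem isSelfAdjoint_gameOp {V W : Fin k → Fin m → Matrix (Fin d) (Fin d) ℂ}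
    (hV : ∀ x a, (V x a).IsHermitian) (hW : ∀ y b, (W y b).IsHermitian)
    {A B : Fin k → Fin m → H →L[ℂ] H} (hA : ∀ x a, IsSelfAdjoint (A x a))
    (hB : ∀ y b, IsSelfAdjoint (B y b)) : IsSelfAdjoint (matOp (gameOp V W A B)) := by
  have h : IsSelfAdjoint (gameOp V W A B) := by
    ext i j : 2
    simp only [gameOp, Matrix.star_apply, Matrix.of_apply, star_add, star_sum, star_smul,
      (hA _ _).star_eq, (hB _ _).star_eq, (hV _ _).apply, (hW _ _).apply]
  exact h.map (matOpHom (Fin d) H)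

theorem score_eq_inner (V W : Fin k → Fin m → Matrix (Fin d) (Fin d) ℂ)
    {A B : Fin k → Fin m → H →L[ℂ] H} {ψ : Copies (Fin d) H} {s : FunctionalFamily k m d}
    (h1 : ∀ x a V, s.1 x a V = ∑ i, ∑ j, V i j * inner ℂ (ψ i) (A x a (ψ j)))
    (h2 : ∀ y b W, s.2 y b W = ∑ i, ∑ j, W i j * inner ℂ (ψ i) (B y b (ψ j))) :
    score V W s = (inner ℂ ψ (matOp (gameOp V W A B) ψ)).re := by
  have key : ∀ (V : Fin k → Fin m → Matrix (Fin d) (Fin d) ℂ) (A : Fin k → Fin m → H →L[ℂ] H),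
      ∑ i, ∑ j, inner ℂ (ψ i) ((∑ x, ∑ a, V x a i j • A x a) (ψ j)) =
      ∑ x, ∑ a, ∑ i, ∑ j, V x a i j * inner ℂ (ψ i) (A x a (ψ j)) := by
    intro V A
    simp only [sum_apply, smul_apply, inner_sum, inner_smul_right]
    calc _ = ∑ i, ∑ x, ∑ j, ∑ a, V x a i j * inner ℂ (ψ i) (A x a (ψ j)) :=
          Finset.sum_congr rfl fun i _ => Finset.sum_comm
      _ = ∑ x, ∑ i, ∑ a, ∑ j, V x a i j * inner ℂ (ψ i) (A x a (ψ j)) := by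
          rw [Finset.sum_comm]
          exact Finset.sum_congr rfl fun x _ => Finset.sum_congr rfl fun i _ => Finset.sum_comm
      _ = _ := Finset.sum_congr rfl fun x _ => Finset.sum_comm
  rw [score]
  congr 1
  simp only [h1, h2]
  rw [inner_copies, ← key, ← key]
  simp only [matOp_apply, inner_sum, gameOp, Matrix.of_apply, add_apply, inner_add_right,
    Finset.sum_add_distrib]

theorem IsPOVMFamily.norm_le_one {A : Fin k → Fin m → H →L[ℂ] H} (hA : IsPOVMFamily A) (x : Fin k)
    (a : Fin m) : ‖A x a‖ ≤ 1 := by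
  have h0 : ∀ a, 0 ≤ A x a := fun a => (ContinuousLinearMap.nonneg_iff_isPositive _).2 (hA.1 x a)
  rw [CStarAlgebra.norm_le_one_iff_of_nonneg _ (h0 a), ← hA.2 x]
  exact Finset.single_le_sum (fun a _ => h0 a) (Finset.mem_univ a)

end GameOp

theorem bddAbove_score (V W : Fin k → Fin m → Matrix (Fin d) (Fin d) ℂ) :
    BddAbove (score V W '' commutingData k m d) := by
  refine ⟨∑ i, ∑ j, (∑ x, ∑ a, ‖V x a i j‖ + ∑ y, ∑ b, ‖W y b i j‖), ?_⟩
  rintro _ ⟨s, hs, rfl⟩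
  obtain ⟨H, _, _, _, A, B, ψ, hA, hB, -, hψ, h1, h2⟩ := mem_commutingData_iff.1 hs
  rw [score_eq_inner V W h1 h2]
  refine (Complex.re_le_norm _).trans ((norm_inner_le_norm _ _).trans ?_)
  rw [hψ, one_mul]
  refine (ContinuousLinearMap.le_opNorm _ _).trans ?_
  rw [hψ, mul_one]
  refine (norm_matOp_le _).trans
    (Finset.sum_le_sum fun i _ => Finset.sum_le_sum fun j _ => ?_)
  refine (norm_add_le _ _).trans (add_le_add ?_ ?_)
  · refine (norm_sum_le _ _).trans (Finset.sum_le_sum fun x _ =>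
      (norm_sum_le _ _).trans (Finset.sum_le_sum fun a _ => ?_))
    rw [norm_smul]
    exact mul_le_of_le_one_right (norm_nonneg _) (hA.norm_le_one x a)
  · refine (norm_sum_le _ _).trans (Finset.sum_le_sum fun x _ =>
      (norm_sum_le _ _).trans (Finset.sum_le_sum fun a _ => ?_))
    rw [norm_smul]
    exact mul_le_of_le_one_right (norm_nonneg _) (hB.norm_le_one x a)

/-! ### Measurements in the group C⋆-algebra of the free group -/

/-- The measurements of a commuting model can be chosen projective. -/
theorem exists_pvm_of_mem_commutingData (hm : m ≠ 0) {s : FunctionalFamily k m d}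
    (hs : s ∈ commutingData k m d) :
    ∃ (H : Type) (_ : NormedAddCommGroup H) (_ : InnerProductSpace ℂ H) (_ : CompleteSpace H)
      (P : Fin k → Fin m → H →L[ℂ] H) (Q : Fin k → Fin m → H →L[ℂ] H) (ψ : Copies (Fin d) H),
      (∀ x, IsPVM (P x)) ∧ (∀ y, IsPVM (Q y)) ∧ (∀ x a y b, Commute (P x a) (Q y b)) ∧ ‖ψ‖ = 1 ∧
      (∀ x a V, s.1 x a V = ∑ i, ∑ j, V i j * inner ℂ (ψ i) (P x a (ψ j))) ∧
      (∀ y b W, s.2 y b W = ∑ i, ∑ j, W i j * inner ℂ (ψ i) (Q y b (ψ j))) := by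
  obtain ⟨H, _, _, _, A, B, ψ, hA, hB, hAB, hψ, h1, h2⟩ := mem_commutingData_iff.1 hs
  -- First `A` is dilated, with `B` in its commutant, and then the extension `ρ (B y b)`, with the
  -- projective dilation of `A` in its commutant.
  obtain ⟨K, _, _, _, V, P, ρ, hP, hVP, hρ⟩ := exists_pvm_dilation hA hm
  obtain ⟨L, _, _, _, W, Q, τ, hQ, hWQ, hτ⟩ := exists_pvm_dilation (hB.map ρ) hm
  have hρB := fun y b => hρ (B y b) fun x a => (hAB x a y b).symm
  have hτP := fun x a => hτ (P x a) fun y b => ((hρB y b).2 x a).symm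
  have hconj : ∀ {H K : Type} [NormedAddCommGroup H] [InnerProductSpace ℂ H] [CompleteSpace H]
      [NormedAddCommGroup K] [InnerProductSpace ℂ K] [CompleteSpace K] (V : H →ₗᵢ[ℂ] K)
      {P : K →L[ℂ] K} {A : H →L[ℂ] H},
      V.toContinuousLinearMap.adjoint ∘L P ∘L V.toContinuousLinearMap = A →
      ∀ x y, inner ℂ (V x) (P (V y)) = inner ℂ x (A y) := by
    rintro H K _ _ _ _ _ _ V P _ rfl x y
    exact (ContinuousLinearMap.adjoint_inner_right V.toContinuousLinearMap x (P (V y))).symm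
  refine ⟨L, _, _, _, fun x a => τ (P x a), Q, WithLp.toLp 2 fun i => W (V (ψ i)),
    fun x => (hP x).map τ, hQ, fun x a y b => (hτP x a).2 y b, ?_, fun x a M => ?_,
    fun y b M => ?_⟩
  · rw [← hψ, PiLp.norm_eq_of_L2, PiLp.norm_eq_of_L2]
    simp
  · simp only [(hτP x a).1, LinearIsometry.inner_map_map, hconj V (hVP x a)]
    exact h1 x a M
  · simp only [hconj W (hWQ y b), (hρB y b).1, LinearIsometry.inner_map_map]
    exact h2 y b M

/-- The words `b⁻ˣ a bˣ` in the generators of the free group. -/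
def conjWord (x : ℕ) : FreeGroup (Fin 2) :=
  (FreeGroup.of 1 ^ x)⁻¹ * FreeGroup.of 0 * FreeGroup.of 1 ^ x

/-- Arbitrary unitaries `u x` are the restrictions of the words `conjWord x` in a representation of
the free group on copies of `H`. -/
theorem exists_rep_conjWord [NeZero k] {H : Type} [NormedAddCommGroup H] [InnerProductSpace ℂ H]
    [CompleteSpace H] (u : Fin k → unitary (H →L[ℂ] H)) :
    ∃ π : FreeGroup (Fin 2) →* unitary (Copies (Fin k) H →L[ℂ] Copies (Fin k) H),
      (∀ x : Fin k, Moves (π (conjWord x)) 0 0 (u x)) ∧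
      ∀ T, (∀ x, Commute (u x : H →L[ℂ] H) T) → ∀ g,
        Commute (π g : Copies (Fin k) H →L[ℂ] Copies (Fin k) H) (ampl (Fin k) H T) := by
  let π : FreeGroup (Fin 2) →* unitary (Copies (Fin k) H →L[ℂ] Copies (Fin k) H) :=
    FreeGroup.lift ![diagUnitary (Fin k) H u, permUnitary (Fin k) H (Equiv.addRight 1)]
  have h0 : π (FreeGroup.of 0) = diagUnitary (Fin k) H u := by simp [π]
  have h1 : π (FreeGroup.of 1) = permUnitary (Fin k) H (Equiv.addRight 1) := by simp [π]
  have hb : ∀ i, Moves (π (FreeGroup.of 1)) i (i + 1) 1 := by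
    intro i
    rw [h1]
    exact permUnitary_copy (Equiv.addRight (1 : Fin k)) i
  have hbn : ∀ n : ℕ, Moves (π (FreeGroup.of 1) ^ n) 0 (Fin.ofNat k n) 1 := by
    intro n
    induction n with
    | zero => intro h; simp
    | succ n ih =>
      have hn : Fin.ofNat k (n + 1) = Fin.ofNat k n + 1 := by
        ext
        simp [Fin.val_add]
      rw [pow_succ', hn]
      exact ((hb _).mul ih).congr (mul_one 1)
  have ha : ∀ i, Moves (π (FreeGroup.of 0)) i i (u i) := by
    intro i
    rw [h0]
    exact diagUnitary_copy u i
  refine ⟨π, fun x => ?_, fun T hT g => ?_⟩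
  · rw [conjWord, map_mul, map_mul, map_inv, map_pow]
    have hx := hbn x
    rw [show Fin.ofNat k x = x from Fin.ext (Nat.mod_eq_of_lt x.2)] at hx
    exact ((hx.inv.mul (ha x)).mul hx).congr (by simp)
  · have hgen : ∀ i, Commute (π (FreeGroup.of i) : Copies (Fin k) H →L[ℂ] Copies (Fin k) H)
        (ampl (Fin k) H T) := by
      refine Fin.forall_fin_two.2 ⟨?_, ?_⟩
      · rw [h0]; exact commute_diagUnitary_ampl u T hT
      · rw [h1]; exact commute_permUnitary_ampl _ T
    induction g using FreeGroup.induction_on with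
    | C1 => rw [map_one]; exact Commute.one_left _
    | of i => exact hgen i
    | inv_of i _ => rw [map_inv]; exact commute_unitary_inv (hgen i)
    | mul g g' hg hg' => rw [map_mul]; exact hg.mul_left hg'

/-- The measurements of `C⋆(𝔽₂)` formed by the effects of the words `conjWord x`. -/
def freeEffect (k m : ℕ) (x : Fin k) (a : Fin m) : GroupCStar (FreeGroup (Fin 2)) :=
  effect m (MaxGroup.of (FreeGroup (Fin 2)) (conjWord x) : GroupCStar (FreeGroup (Fin 2))) a

theorem isPOVMFamily_freeEffect (hm : m ≠ 0) {H : Type} [NormedAddCommGroup H]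
    [InnerProductSpace ℂ H] [CompleteSpace H]
    (π : GroupCStar (FreeGroup (Fin 2)) →⋆ₐ[ℂ] (H →L[ℂ] H)) :
    IsPOVMFamily fun x a => π (freeEffect k m x a) := by
  refine ⟨fun x a => ?_, fun x => ?_⟩
  · change (π (effect m _ a)).IsPositive
    rw [map_effect]
    exact effect_isPositive _ a
  · rw [← map_sum]
    exact (congrArg π (sum_effect hm (MaxGroup.of _ (conjWord x)).2.1)).trans (map_one π)

/-- Every commuting model arises from a commuting pair of representations of `C⋆(𝔽₂)`. -/
theorem exists_freeGroup_model (hk : k ≠ 0) (hm : m ≠ 0) {s : FunctionalFamily k m d}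
    (hs : s ∈ commutingData k m d) :
    ∃ (H : Type) (_ : NormedAddCommGroup H) (_ : InnerProductSpace ℂ H) (_ : CompleteSpace H)
      (π σ : GroupCStar (FreeGroup (Fin 2)) →⋆ₐ[ℂ] (H →L[ℂ] H)) (ψ : Copies (Fin d) H),
      (∀ a b, Commute (π a) (σ b)) ∧ ‖ψ‖ = 1 ∧
      (∀ x a V, s.1 x a V = ∑ i, ∑ j, V i j * inner ℂ (ψ i) (π (freeEffect k m x a) (ψ j))) ∧
      (∀ y b W, s.2 y b W =
        ∑ i, ∑ j, W i j * inner ℂ (ψ i) (σ (freeEffect k m y b) (ψ j))) := by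
  have : NeZero k := ⟨hk⟩
  obtain ⟨H, _, _, _, P, Q, ψ, hP, hQ, hPQ, hψ, h1, h2⟩ := exists_pvm_of_mem_commutingData hm hs
  let u : Fin k → unitary (H →L[ℂ] H) := fun x => ⟨pvmUnitary (P x), (hP x).pvmUnitary_mem hm⟩
  let v : Fin k → unitary (Copies (Fin k) H →L[ℂ] Copies (Fin k) H) := fun y =>
    ⟨ampl (Fin k) H (pvmUnitary (Q y)),
      Unitary.map_mem (ampl (Fin k) H) ((hQ y).pvmUnitary_mem hm)⟩
  have huv : ∀ x y, Commute (pvmUnitary (P x)) (pvmUnitary (Q y)) := fun x y =>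
    Commute.sum_left _ _ _ fun a _ => Commute.sum_right _ _ _ fun b _ =>
      ((hPQ x a y b).smul_left _).smul_right _
  obtain ⟨π₀, hπ₀, hπT⟩ := exists_rep_conjWord u
  obtain ⟨σ₀, hσ₀, hσT⟩ := exists_rep_conjWord v
  let π : GroupCStar (FreeGroup (Fin 2)) →⋆ₐ[ℂ] _ :=
    (ampl (Fin k) (Copies (Fin k) H)).comp (liftCStar π₀)
  let σ : GroupCStar (FreeGroup (Fin 2)) →⋆ₐ[ℂ] _ := liftCStar σ₀
  have hcomm : ∀ a b, Commute (π a) (σ b) := by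
    intro a b
    refine (commute_of_forall_of σ (fun g => ?_) b).symm
    rw [liftCStar_of]
    refine hσT (liftCStar π₀ a) (fun y => ?_) g
    refine (commute_of_forall_of (liftCStar π₀) (fun g' => ?_) a).symm
    rw [liftCStar_of]
    exact hπT _ (fun x => huv x y) g'
  -- `π` lives on the inner copies and is amplified to the outer ones, on which `σ` acts.
  let J : H →ₗᵢ[ℂ] Copies (Fin k) (Copies (Fin k) H) := (copy 0).comp (copy 0)
  have hJπ : ∀ x a h, π (freeEffect k m x a) (J h) = J (P x a h) := by
    intro x a h
    change ampl (Fin k) (Copies (Fin k) H) (liftCStar π₀ (freeEffect k m x a))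
      (copy 0 (copy 0 h)) = copy 0 (copy 0 (P x a h))
    rw [ampl_copy, freeEffect, map_effect, liftCStar_of]
    have h3 := effect_intertwine (m := m) (W := π₀ (conjWord x)) (w := u x)
      (copy (ι := Fin k) (H := H) 0).toContinuousLinearMap (fun z => hπ₀ x z) a h
    rw [(hP x).effect_pvmUnitary a] at h3
    exact congrArg (copy 0) h3
  have hJσ : ∀ y b h, σ (freeEffect k m y b) (J h) = J (Q y b h) := by
    intro y b h
    change liftCStar σ₀ (freeEffect k m y b) (copy 0 (copy 0 h)) = copy 0 (copy 0 (Q y b h))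
    rw [freeEffect, map_effect, liftCStar_of]
    have h3 := effect_intertwine (m := m) (W := σ₀ (conjWord y)) (w := v y)
      (copy (ι := Fin k) (H := Copies (Fin k) H) 0).toContinuousLinearMap (fun z => hσ₀ y z) b
      (copy 0 h)
    have h4 : effect m (v y : Copies (Fin k) H →L[ℂ] Copies (Fin k) H) b =
        ampl (Fin k) H (Q y b) := by
      change effect m (ampl (Fin k) H (pvmUnitary (Q y))) b = _
      rw [← map_effect, (hQ y).effect_pvmUnitary b]
    rw [h4] at h3
    exact h3.trans (congrArg (copy 0) (ampl_copy _ _ _))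
  refine ⟨_, _, _, inferInstance, π, σ, WithLp.toLp 2 fun i => J (ψ i), hcomm, ?_,
    fun x a V => ?_, fun y b W => ?_⟩
  · rw [← hψ, PiLp.norm_eq_of_L2, PiLp.norm_eq_of_L2]
    simp
  · simp only [hJπ, LinearIsometry.inner_map_map]
    exact h1 x a V
  · simp only [hJσ, LinearIsometry.inner_map_map]
    exact h2 y b W

/-- If the norms on `C⋆(𝔽₂) ⊗ C⋆(𝔽₂)` agree, commuting strategies are not better than tensor product
strategies. -/
theorem tensorValue_eq_of_qwep (h : QWEP) (hk : k ≠ 0) (hm : m ≠ 0) (hd : 1 ≤ d)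
    {V W : Fin k → Fin m → Matrix (Fin d) (Fin d) ℂ} (hV : ∀ x a, (V x a).IsHermitian)
    (hW : ∀ y b, (W y b).IsHermitian) : tensorValue V W = commutativeValue V W := by
  have hne : (score V W '' tensorData k m d).Nonempty := (tensorData_nonempty hm hd).image _
  have hsub : score V W '' tensorData k m d ⊆ score V W '' commutingData k m d :=
    Set.image_mono tensorData_subset_commutingData
  rw [tensorValue, commutativeValue]
  congr 1
  refine le_antisymm (csSup_le_csSup (bddAbove_score V W) hne hsub) ?_
  refine csSup_le (hne.mono hsub) ?_
  rintro _ ⟨s, hs, rfl⟩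
  obtain ⟨H, _, _, _, π, σ, ψ, hc, hψ, h1, h2⟩ := exists_freeGroup_model hk hm hs
  let X : Matrix (Fin d) (Fin d)
      (GroupCStar (FreeGroup (Fin 2)) ⊗[ℂ] GroupCStar (FreeGroup (Fin 2))) :=
    Matrix.of fun i j => ∑ x, ∑ a, V x a i j • (freeEffect k m x a ⊗ₜ[ℂ] 1) +
      ∑ y, ∑ b, W y b i j • (1 ⊗ₜ[ℂ] freeEffect k m y b)
  have hX : ∀ (H : Type) (_ : NormedAddCommGroup H) (_ : InnerProductSpace ℂ H)
      (_ : CompleteSpace H) (π σ : GroupCStar (FreeGroup (Fin 2)) →⋆ₐ[ℂ] (H →L[ℂ] H))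
      (hc : ∀ a b, Commute (π a) (σ b)),
      commMat π σ hc X = matOp (gameOp V W (fun x a => π (freeEffect k m x a))
        fun y b => σ (freeEffect k m y b)) := by
    intro H _ _ _ π σ hc
    rw [commMat_apply]
    congr 1
    ext i j : 2
    simp only [X, gameOp, Matrix.map_apply, Matrix.of_apply, map_add, map_sum, map_smul,
      commRep_tmul, map_one, mul_one, one_mul]
  have hle := h.numericalRange_le (X := X) (w := sSup (score V W '' tensorData k m d))
    (fun H _ _ _ π σ hc => by
      rw [hX]
      exact isSelfAdjoint_gameOp hV hW
        (fun x a => ((isPOVMFamily_freeEffect hm π).1 x a).isSelfAdjoint)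
        fun y b => ((isPOVMFamily_freeEffect hm σ).1 y b).isSelfAdjoint)
    (fun H _ _ _ K _ _ _ π σ φ => ?_) π σ hc ψ
  · rw [score_eq_inner V W h1 h2, ← hX _ _ _ _ π σ hc]
    simpa [hψ] using hle
  · rw [hX]
    -- For a unit vector in a spatial representation the quadratic form is the score of a tensor
    -- product model.
    rcases eq_or_ne φ 0 with rfl | hφ
    · simp
    have hφ0 : 0 < ‖φ‖ := norm_pos_iff.2 hφ
    let φ' : Copies (Fin d) (HilbertTensor H K) := ((‖φ‖⁻¹ : ℝ) : ℂ) • φ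
    have hφ' : ‖φ'‖ = 1 := by
      rw [norm_smul, Complex.norm_real, norm_inv, norm_norm, inv_mul_cancel₀ hφ0.ne']
    have hφφ' : φ = ((‖φ‖ : ℝ) : ℂ) • φ' := by
      rw [smul_smul, ← Complex.ofReal_mul, mul_inv_cancel₀ hφ0.ne', Complex.ofReal_one, one_smul]
    let A : Fin k → Fin m → H →L[ℂ] H := fun x a => π (freeEffect k m x a)
    let B : Fin k → Fin m → K →L[ℂ] K := fun y b => σ (freeEffect k m y b)
    let t : FunctionalFamily k m d :=
      ⟨fun x a => functional fun i j => inner ℂ (φ' i) (ampLeft H K (A x a) (φ' j)),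
        fun y b => functional fun i j => inner ℂ (φ' i) (ampRight H K (B y b) (φ' j))⟩
    have ht : t ∈ tensorData k m d :=
      mem_tensorData_iff.2 ⟨H, _, _, inferInstance, K, _, _, inferInstance, A, B, φ',
        isPOVMFamily_freeEffect hm π, isPOVMFamily_freeEffect hm σ, hφ',
        fun x a V => functional_apply _ _, fun y b W => functional_apply _ _⟩
    have h3 : score V W t ≤ sSup (score V W '' tensorData k m d) :=
      le_csSup ((bddAbove_score V W).mono hsub) ⟨t, ht, rfl⟩
    rw [score_eq_inner V W (s := t) (fun x a V => functional_apply _ _)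
      (fun y b W => functional_apply _ _)] at h3
    conv_lhs => rw [hφφ']
    rw [map_smul, inner_smul_left, inner_smul_right, Complex.conj_ofReal, ← mul_assoc,
      ← Complex.ofReal_mul, Complex.re_ofReal_mul, mul_comm, ← sq]
    exact mul_le_mul_of_nonneg_right h3 (sq_nonneg _)

end Steering

/-! ### Ultraproducts of Hilbert spaces -/

namespace Ultra

open Filter Topology

variable {T : Type} (U : Ultrafilter T) (H : T → Type) [∀ t, NormedAddCommGroup (H t)]
  [∀ t, InnerProductSpace ℂ (H t)]

/-- The submodule of bounded families of vectors. -/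
def boundedFamilies (H : T → Type) [∀ t, NormedAddCommGroup (H t)]
    [∀ t, InnerProductSpace ℂ (H t)] : Submodule ℂ (∀ t, H t) where
  carrier := {x | ∃ C : ℝ, ∀ t, ‖x t‖ ≤ C}
  add_mem' := by
    rintro x y ⟨C, hC⟩ ⟨D, hD⟩
    exact ⟨C + D, fun t => (norm_add_le _ _).trans (add_le_add (hC t) (hD t))⟩
  zero_mem' := ⟨0, fun t => by simp⟩
  smul_mem' := by
    rintro c x ⟨C, hC⟩
    refine ⟨‖c‖ * C, fun t => ?_⟩
    rw [Pi.smul_apply, norm_smul]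
    exact mul_le_mul_of_nonneg_left (hC t) (norm_nonneg c)

/-- The space of bounded families of vectors `x t` of `H t`, to be equipped with the inner product
`lim ⟪x t, y t⟫` along the ultrafilter `U`. It is a type of its own, since it does not carry the
subspace topology of the product. -/
def Family (_ : Ultrafilter T) (H : T → Type) [∀ t, NormedAddCommGroup (H t)]
    [∀ t, InnerProductSpace ℂ (H t)] : Type := boundedFamilies H

instance : AddCommGroup (Family U H) := inferInstanceAs (AddCommGroup (boundedFamilies H))

instance : Module ℂ (Family U H) := inferInstanceAs (Module ℂ (boundedFamilies H))

variable {U H}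

theorem Family.add_val (x y : Family U H) (t : T) : (x + y).1 t = x.1 t + y.1 t := rfl

theorem Family.smul_val (c : ℂ) (x : Family U H) (t : T) : (c • x).1 t = c • x.1 t := rfl

theorem exists_tendsto_inner (x y : Family U H) :
    ∃ z, Tendsto (fun t => inner ℂ (x.1 t) (y.1 t)) U (𝓝 z) := by
  obtain ⟨C, hC⟩ := x.2
  obtain ⟨D, hD⟩ := y.2
  have hmem : ∀ t, inner ℂ (x.1 t) (y.1 t) ∈ Metric.closedBall (0 : ℂ) (C * D) := fun t => by
    rw [mem_closedBall_zero_iff]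
    exact (norm_inner_le_norm _ _).trans
      (mul_le_mul (hC t) (hD t) (norm_nonneg _) ((norm_nonneg _).trans (hC t)))
  obtain ⟨z, -, hz⟩ := (isCompact_closedBall (0 : ℂ) (C * D)).ultrafilter_le_nhds
    (U.map fun t => inner ℂ (x.1 t) (y.1 t))
    (le_principal_iff.2 (mem_map.2 (Filter.Eventually.of_forall hmem)))
  exact ⟨z, hz⟩

variable (U H) in
/-- The semi-inner product `lim ⟪x t, y t⟫`. -/
@[reducible] def core : PreInnerProductSpace.Core ℂ (Family U H) where
  inner x y := (exists_tendsto_inner x y).choose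
  conj_inner_symm x y := by
    refine tendsto_nhds_unique ?_ (exists_tendsto_inner x y).choose_spec
    refine ((Complex.continuous_conj.tendsto _).comp
      (exists_tendsto_inner y x).choose_spec).congr fun t => ?_
    exact inner_conj_symm (x.1 t) (y.1 t)
  re_inner_nonneg x := by
    refine ge_of_tendsto ((Complex.continuous_re.tendsto _).comp
      (exists_tendsto_inner x x).choose_spec) (Filter.Eventually.of_forall fun t => ?_)
    exact inner_self_nonneg (𝕜 := ℂ) (x := x.1 t)
  add_left x y z := by
    refine tendsto_nhds_unique (exists_tendsto_inner (x + y) z).choose_spec ?_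
    refine ((exists_tendsto_inner x z).choose_spec.add
      (exists_tendsto_inner y z).choose_spec).congr fun t => ?_
    rw [Family.add_val, inner_add_left]
  smul_left x y r := by
    refine tendsto_nhds_unique (exists_tendsto_inner (r • x) y).choose_spec ?_
    refine ((exists_tendsto_inner x y).choose_spec.const_mul _).congr fun t => ?_
    rw [Family.smul_val, inner_smul_left]

instance : SeminormedAddCommGroup (Family U H) :=
  @InnerProductSpace.Core.toSeminormedAddCommGroup ℂ _ _ _ _ (core U H)

instance : InnerProductSpace ℂ (Family U H) := InnerProductSpace.ofCore (core U H)

theorem tendsto_inner (x y : Family U H) :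
    Tendsto (fun t => inner ℂ (x.1 t) (y.1 t)) U (𝓝 (inner ℂ x y)) :=
  (exists_tendsto_inner x y).choose_spec

theorem tendsto_norm_sq (x : Family U H) : Tendsto (fun t => ‖x.1 t‖ ^ 2) U (𝓝 (‖x‖ ^ 2)) := by
  have h := (Complex.continuous_re.tendsto _).comp (tendsto_inner x x)
  rw [inner_self_eq_norm_sq_to_K] at h
  convert h using 2 with t
  · rw [Function.comp_apply, inner_self_eq_norm_sq_to_K]
    norm_cast
  · norm_cast

/-- A family of contractions acts on bounded families of vectors. -/
def familyOp (S : ∀ t, H t →L[ℂ] H t) (hS : ∀ t, ‖S t‖ ≤ 1) : Family U H →L[ℂ] Family U H :=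
  LinearMap.mkContinuous
    { toFun := fun x => ⟨fun t => S t (x.1 t), by
        obtain ⟨C, hC⟩ := x.2
        exact ⟨C, fun t => ((S t).le_of_opNorm_le (hS t) _).trans (by rw [one_mul]; exact hC t)⟩⟩
      map_add' := fun x y => Subtype.ext <| funext fun t => map_add (S t) (x.1 t) (y.1 t)
      map_smul' := fun c x => Subtype.ext <| funext fun t => map_smul (S t) c (x.1 t) } 1
    (fun x => by
      rw [one_mul]
      refine (sq_le_sq₀ (norm_nonneg _) (norm_nonneg _)).1 ?_
      refine le_of_tendsto_of_tendsto (tendsto_norm_sq _) (tendsto_norm_sq x)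
        (Filter.Eventually.of_forall fun t => ?_)
      refine pow_le_pow_left₀ (norm_nonneg _) ?_ 2
      exact ((S t).le_of_opNorm_le (hS t) _).trans (by rw [one_mul]))

/-- The ultraproduct of a family of contractions. -/
def ultraOp (S : ∀ t, H t →L[ℂ] H t) (hS : ∀ t, ‖S t‖ ≤ 1) :
    UniformSpace.Completion (Family U H) →L[ℂ] UniformSpace.Completion (Family U H) :=
  (familyOp S hS).completion

theorem ultraOp_coe (S : ∀ t, H t →L[ℂ] H t) (hS : ∀ t, ‖S t‖ ≤ 1) (x : Family U H) :
    ultraOp S hS (x : UniformSpace.Completion (Family U H)) = (familyOp S hS x : Family U H) :=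
  (familyOp S hS).completion_apply_coe x

theorem ext_coe {P Q : UniformSpace.Completion (Family U H) →L[ℂ]
    UniformSpace.Completion (Family U H)} (h : ∀ x : Family U H, P x = Q x) : P = Q := by
  ext z
  induction z using UniformSpace.Completion.induction_on with
  | hp => exact isClosed_eq P.continuous Q.continuous
  | ih z => exact h z

theorem commute_ultraOp {S R : ∀ t, H t →L[ℂ] H t} (hS : ∀ t, ‖S t‖ ≤ 1) (hR : ∀ t, ‖R t‖ ≤ 1)
    (h : ∀ t, Commute (S t) (R t)) : Commute (ultraOp (U := U) S hS) (ultraOp R hR) := by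
  refine ext_coe fun x => ?_
  simp only [mul_apply_eq_comp, ultraOp_coe]
  exact congrArg _ (Subtype.ext <| funext fun t => DFunLike.congr_fun (h t).eq (x.1 t))

theorem sum_ultraOp {ι : Type*} [Fintype ι] {S : ι → ∀ t, H t →L[ℂ] H t}
    (hS : ∀ i t, ‖S i t‖ ≤ 1) (h : ∀ t, ∑ i, S i t = 1) :
    ∑ i, ultraOp (U := U) (S i) (hS i) = 1 := by
  refine ext_coe fun x => ?_
  have hsum : ∀ s : Finset ι, (∑ i ∈ s, familyOp (S i) (hS i) x).1 =
      fun t => (∑ i ∈ s, S i t) (x.1 t) := by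
    classical
    intro s
    induction s using Finset.induction_on with
    | empty => funext t; simp; rfl
    | insert i s hi ih =>
      funext t
      rw [Finset.sum_insert hi, Finset.sum_insert hi, Family.add_val, ih]
      rfl
  have hcoe : ∀ s : Finset ι, ∑ i ∈ s, ((familyOp (S i) (hS i) x : Family U H) :
      UniformSpace.Completion (Family U H)) =
      ((∑ i ∈ s, familyOp (S i) (hS i) x : Family U H) : UniformSpace.Completion (Family U H)) :=
    fun s => (map_sum (UniformSpace.Completion.toComplL (𝕜 := ℂ) (E := Family U H)) _ _).symm
  simp only [sum_apply, ultraOp_coe, hcoe]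
  refine congrArg _ (Subtype.ext ?_)
  rw [hsum]
  funext t
  rw [h t]
  rfl

theorem isPositive_ultraOp [∀ t, CompleteSpace (H t)] {S : ∀ t, H t →L[ℂ] H t}
    (hS : ∀ t, ‖S t‖ ≤ 1) (h : ∀ t, (S t).IsPositive) : (ultraOp (U := U) S hS).IsPositive := by
  rw [ContinuousLinearMap.isPositive_iff_complex]
  intro z
  induction z using UniformSpace.Completion.induction_on with
  | hp =>
    have hc : Continuous fun z => inner ℂ (ultraOp (U := U) S hS z) z := by fun_prop
    exact IsClosed.inter
      (isClosed_eq (Complex.continuous_ofReal.comp (Complex.continuous_re.comp hc)) hc)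
      (isClosed_Ici.preimage (Complex.continuous_re.comp hc))
  | ih x =>
    rw [ultraOp_coe, UniformSpace.Completion.inner_coe]
    have h1 := fun t => ((ContinuousLinearMap.isPositive_iff_complex _).1 (h t)) (x.1 t)
    have h2 := tendsto_inner (familyOp S hS x) x
    have h3 := (Complex.continuous_re.tendsto _).comp h2
    refine ⟨tendsto_nhds_unique (((Complex.continuous_ofReal.tendsto _).comp h3).congr
      fun t => ?_) h2, ge_of_tendsto h3 (Filter.Eventually.of_forall fun t => ?_)⟩
    · exact (h1 t).1
    · exact (h1 t).2

end Ultra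

/-! ### The set of commuting data is closed -/

namespace Steering

open OpMatrix Measurement TensorNorm Filter Topology

variable {k m d : ℕ}

theorem continuous_fst_eval (x : Fin k) (a : Fin m) (V : Matrix (Fin d) (Fin d) ℂ) :
    Continuous fun s : FunctionalFamily k m d => s.1 x a V := by
  have h : Continuous fun s : FunctionalFamily k m d => s.1 x a := by fun_prop
  exact (WeakDual.eval_continuous V).comp h

theorem continuous_snd_eval (y : Fin k) (b : Fin m) (W : Matrix (Fin d) (Fin d) ℂ) :
    Continuous fun s : FunctionalFamily k m d => s.2 y b W := by
  have h : Continuous fun s : FunctionalFamily k m d => s.2 y b := by fun_prop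
  exact (WeakDual.eval_continuous W).comp h

/-- A limit of commuting data along an ultrafilter is realised in the ultraproduct of the models. -/
theorem isClosed_commutingData : IsClosed (commutingData k m d) := by
  rw [← closure_subset_iff_isClosed]
  intro s hs
  obtain ⟨U₀, hU₀, hU₀s⟩ := mem_closure_iff_ultrafilter.1 hs
  let T := commutingData k m d
  let U : Ultrafilter T := U₀.comap Subtype.val_injective (by rwa [Subtype.range_coe])
  have hU : Tendsto (fun t : T => (t : FunctionalFamily k m d)) U (𝓝 s) :=
    tendsto_comap.mono_right hU₀s
  choose H i1 i2 i3 A B ψ hA hB hAB hψ h1 h2 using fun t : T => mem_commutingData_iff.1 t.2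
  have hA1 : ∀ x a t, ‖A t x a‖ ≤ 1 := fun x a t => (hA t).norm_le_one x a
  have hB1 : ∀ y b t, ‖B t y b‖ ≤ 1 := fun y b t => (hB t).norm_le_one y b
  let φ : Fin d → Ultra.Family U H := fun i => ⟨fun t => ψ t i, 1, fun t => by
    rw [← hψ t]; exact PiLp.norm_apply_le (ψ t) i⟩
  let Ψ : Copies (Fin d) (UniformSpace.Completion (Ultra.Family U H)) :=
    WithLp.toLp 2 fun i => (φ i : UniformSpace.Completion (Ultra.Family U H))
  have key : ∀ (S : ∀ t, H t →L[ℂ] H t) (hS : ∀ t, ‖S t‖ ≤ 1) (V : Matrix (Fin d) (Fin d) ℂ),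
      Tendsto (fun t => ∑ i, ∑ j, V i j * inner ℂ (ψ t i) (S t (ψ t j))) U
        (𝓝 (∑ i, ∑ j, V i j * inner ℂ (Ψ i) (Ultra.ultraOp S hS (Ψ j)))) := by
    intro S hS V
    refine tendsto_finsetSum _ fun i _ => tendsto_finsetSum _ fun j _ => Tendsto.const_mul _ ?_
    change Tendsto _ _ (𝓝 (inner ℂ (φ i : UniformSpace.Completion (Ultra.Family U H))
      (Ultra.ultraOp S hS (φ j : UniformSpace.Completion (Ultra.Family U H)))))
    rw [Ultra.ultraOp_coe, UniformSpace.Completion.inner_coe]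
    exact Ultra.tendsto_inner (φ i) (Ultra.familyOp S hS (φ j))
  refine mem_commutingData_iff.2 ⟨_, _, _, inferInstance,
    fun x a => Ultra.ultraOp (fun t => A t x a) (hA1 x a),
    fun y b => Ultra.ultraOp (fun t => B t y b) (hB1 y b), Ψ, ⟨fun x a => ?_, fun x => ?_⟩,
    ⟨fun y b => ?_, fun y => ?_⟩, fun x a y b => ?_, ?_, fun x a V => ?_, fun y b W => ?_⟩
  · exact Ultra.isPositive_ultraOp _ fun t => (hA t).1 x a
  · exact Ultra.sum_ultraOp _ fun t => (hA t).2 x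
  · exact Ultra.isPositive_ultraOp _ fun t => (hB t).1 y b
  · exact Ultra.sum_ultraOp _ fun t => (hB t).2 y
  · exact Ultra.commute_ultraOp _ _ fun t => hAB t x a y b
  · rw [← sq_eq_sq₀ (norm_nonneg _) zero_le_one, one_pow, PiLp.norm_sq_eq_of_L2]
    refine tendsto_nhds_unique (tendsto_finsetSum _ fun i _ => ?_)
      (tendsto_const_nhds.congr fun t => ?_) (f := fun t => ∑ i, ‖ψ t i‖ ^ 2) (l := (U : Filter T))
    · change Tendsto _ _ (𝓝 (‖(φ i : UniformSpace.Completion (Ultra.Family U H))‖ ^ 2))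
      rw [UniformSpace.Completion.norm_coe]
      exact Ultra.tendsto_norm_sq (φ i)
    · rw [← PiLp.norm_sq_eq_of_L2, hψ t, one_pow]
  · refine tendsto_nhds_unique ?_ (key _ (hA1 x a) V)
    simp only [← h1]
    exact ((continuous_fst_eval x a V).tendsto s).comp hU
  · refine tendsto_nhds_unique ?_ (key _ (hB1 y b) W)
    simp only [← h2]
    exact ((continuous_snd_eval y b W).tendsto s).comp hU

end Steering

/-! ### Direct sums of tensor product models -/

namespace TensorNorm

section DirectSum

variable {H H' K : Type} [NormedAddCommGroup H] [InnerProductSpace ℂ H] [CompleteSpace H]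
  [NormedAddCommGroup H'] [InnerProductSpace ℂ H'] [CompleteSpace H']
  [NormedAddCommGroup K] [InnerProductSpace ℂ K] [CompleteSpace K]

/-- `K` is the orthogonal direct sum of the ranges of the isometries `j` and `j'`. -/
structure IsDirectSum (j : H →L[ℂ] K) (j' : H' →L[ℂ] K) : Prop where
  left_left : j.adjoint ∘L j = 1
  right_right : j'.adjoint ∘L j' = 1
  left_right : j.adjoint ∘L j' = 0
  right_left : j'.adjoint ∘L j = 0
  add_eq : j ∘L j.adjoint + j' ∘L j'.adjoint = 1

variable (H H') in
theorem exists_isDirectSum : ∃ (K : Type) (_ : NormedAddCommGroup K) (_ : InnerProductSpace ℂ K)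
    (_ : CompleteSpace K) (j : H →L[ℂ] K) (j' : H' →L[ℂ] K), IsDirectSum j j' := by
  let e := WithLp.prodContinuousLinearEquiv 2 ℂ H H'
  let j : H →L[ℂ] WithLp 2 (H × H') := e.symm.toContinuousLinearMap ∘L .inl ℂ H H'
  let j' : H' →L[ℂ] WithLp 2 (H × H') := e.symm.toContinuousLinearMap ∘L .inr ℂ H H'
  have hj : j.adjoint = .fst ℂ H H' ∘L e.toContinuousLinearMap := by
    refine ((ContinuousLinearMap.eq_adjoint_iff _ _).2 fun x y => ?_).symm
    simp [e, j, WithLp.prod_inner_apply]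
  have hj' : j'.adjoint = .snd ℂ H H' ∘L e.toContinuousLinearMap := by
    refine ((ContinuousLinearMap.eq_adjoint_iff _ _).2 fun x y => ?_).symm
    simp [e, j', WithLp.prod_inner_apply]
  refine ⟨WithLp 2 (H × H'), inferInstance, inferInstance, inferInstance, j, j', ?_, ?_, ?_, ?_, ?_⟩
  · rw [hj]; ext x; simp [j]
  · rw [hj']; ext x; simp [j']
  · rw [hj]; ext x; simp [j']
  · rw [hj']; ext x; simp [j]
  · rw [hj, hj']
    ext x
    apply e.injective
    simp [j, j']

/-- The direct sum of two operators. -/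
def directSum (j : H →L[ℂ] K) (j' : H' →L[ℂ] K) (P : H →L[ℂ] H) (P' : H' →L[ℂ] H') : K →L[ℂ] K :=
  j ∘L P ∘L j.adjoint + j' ∘L P' ∘L j'.adjoint

namespace IsDirectSum

variable {j : H →L[ℂ] K} {j' : H' →L[ℂ] K}

theorem symm (hj : IsDirectSum j j') : IsDirectSum j' j :=
  ⟨hj.right_right, hj.left_left, hj.right_left, hj.left_right, by rw [add_comm, hj.add_eq]⟩

theorem directSum_one (hj : IsDirectSum j j') : directSum j j' 1 1 = 1 := hj.add_eq

theorem directSum_comm (P : H →L[ℂ] H) (P' : H' →L[ℂ] H') :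
    directSum j j' P P' = directSum j' j P' P := add_comm _ _

theorem compress_left_left (hj : IsDirectSum j j') (P : H →L[ℂ] H) (P' : H' →L[ℂ] H') :
    j.adjoint ∘L directSum j j' P P' ∘L j = P := by
  have h1 : ∀ x, j.adjoint (j x) = x := DFunLike.congr_fun hj.left_left
  have h2 : ∀ x, j'.adjoint (j x) = 0 := DFunLike.congr_fun hj.right_left
  ext x
  simp [directSum, h1, h2]

theorem compress_left_right (hj : IsDirectSum j j') (P : H →L[ℂ] H) (P' : H' →L[ℂ] H') :
    j.adjoint ∘L directSum j j' P P' ∘L j' = 0 := by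
  have h2 : ∀ x, j.adjoint (j' x) = 0 := DFunLike.congr_fun hj.left_right
  ext x
  simp [directSum, h2]

variable {G G' L : Type} [NormedAddCommGroup G] [InnerProductSpace ℂ G] [CompleteSpace G]
  [NormedAddCommGroup G'] [InnerProductSpace ℂ G'] [CompleteSpace G']
  [NormedAddCommGroup L] [InnerProductSpace ℂ L] [CompleteSpace L]
  {l : G →L[ℂ] L} {l' : G' →L[ℂ] L}

theorem inner_tensorMap_cross (hj : IsDirectSum j j') (P : H →L[ℂ] H) (P' : H' →L[ℂ] H')
    (T : L →L[ℂ] L) (z : HilbertTensor H G) (w : HilbertTensor H' G') :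
    inner ℂ (tensorMap j l z) (opTensor (directSum j j' P P') T (tensorMap j' l' w)) = 0 := by
  have h0 : tensorMap (0 : H' →L[ℂ] H) (l.adjoint ∘L T ∘L l') = 0 :=
    ext_elemTensor fun x y => by
      rw [tensorMap_elemTensor]
      simp [elemTensor]
  rw [inner_tensorMap_left, opTensor_eq_tensorMap, tensorMap_tensorMap, tensorMap_tensorMap]
  change inner ℂ z (tensorMap (j.adjoint ∘L directSum j j' P P' ∘L j')
    (l.adjoint ∘L T ∘L l') w) = 0
  rw [hj.compress_left_right, h0]
  exact inner_zero_right _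

/-- Matrix coefficients of the direct sum of tensor product operators are sums of matrix
coefficients: the mixed summands of the tensor product of the direct sums are not visited. -/
theorem inner_add_tensorMap (hj : IsDirectSum j j') (hl : IsDirectSum l l') (P : H →L[ℂ] H)
    (P' : H' →L[ℂ] H') (Q : G →L[ℂ] G) (Q' : G' →L[ℂ] G') (r r' : ℝ) (z w : HilbertTensor H G)
    (z' w' : HilbertTensor H' G') :
    inner ℂ ((r : ℂ) • tensorMap j l z + (r' : ℂ) • tensorMap j' l' z')
      (opTensor (directSum j j' P P') (directSum l l' Q Q')
        ((r : ℂ) • tensorMap j l w + (r' : ℂ) • tensorMap j' l' w')) =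
      (r ^ 2 : ℝ) * inner ℂ z (opTensor P Q w) + (r' ^ 2 : ℝ) * inner ℂ z' (opTensor P' Q' w') := by
  have h1 := hj.inner_tensorMap_cross P P' (directSum l l' Q Q') (l := l) (l' := l') z w'
  have h2 := hj.symm.inner_tensorMap_cross P' P (directSum l l' Q Q') (l := l') (l' := l) z' w
  have h3 := inner_tensorMap_tensorMap j l (directSum j j' P P') (directSum l l' Q Q') z w
  have h4 := inner_tensorMap_tensorMap j' l' (directSum j' j P' P) (directSum l' l Q' Q) z' w'
  rw [hj.compress_left_left, hl.compress_left_left] at h3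
  rw [hj.symm.compress_left_left, hl.symm.compress_left_left, directSum_comm (j := j'),
    directSum_comm (j := l')] at h4
  rw [directSum_comm (j := j')] at h2
  simp only [map_add, map_smul, inner_add_left, inner_add_right, inner_smul_left,
    inner_smul_right, h1, h2, h3, h4, Complex.conj_ofReal]
  push_cast
  ring

end IsDirectSum

end DirectSum

end TensorNorm

namespace Steering

open OpMatrix Measurement TensorNorm

theorem IsPOVMFamily.directSum {k m : ℕ} {H H' K : Type} [NormedAddCommGroup H]
    [InnerProductSpace ℂ H] [CompleteSpace H] [NormedAddCommGroup H'] [InnerProductSpace ℂ H']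
    [CompleteSpace H'] [NormedAddCommGroup K] [InnerProductSpace ℂ K] [CompleteSpace K]
    {j : H →L[ℂ] K} {j' : H' →L[ℂ] K} (hj : IsDirectSum j j')
    {A : Fin k → Fin m → H →L[ℂ] H} {A' : Fin k → Fin m → H' →L[ℂ] H'} (hA : IsPOVMFamily A)
    (hA' : IsPOVMFamily A') :
    IsPOVMFamily fun x a => TensorNorm.directSum j j' (A x a) (A' x a) := by
  refine ⟨fun x a => ((hA.1 x a).conj_adjoint j).add ((hA'.1 x a).conj_adjoint j'), fun x => ?_⟩
  rw [← hj.directSum_one, ← hA.2 x, ← hA'.2 x]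
  ext z
  simp [TensorNorm.directSum, Finset.sum_add_distrib]

variable {k m d : ℕ}

/-- Coordinates of steering data: the values on the matrix units. -/
def coords (s : FunctionalFamily k m d) :
    (Fin k × Fin m × Fin d × Fin d) ⊕ (Fin k × Fin m × Fin d × Fin d) → ℂ :=
  Sum.elim (fun p => s.1 p.1 p.2.1 (Matrix.single p.2.2.1 p.2.2.2 1))
    (fun p => s.2 p.1 p.2.1 (Matrix.single p.2.2.1 p.2.2.2 1))

/-- Steering data with given coordinates. -/
def ofCoords (c : (Fin k × Fin m × Fin d × Fin d) ⊕ (Fin k × Fin m × Fin d × Fin d) → ℂ) :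
    FunctionalFamily k m d :=
  (fun x a => functional fun i j => c (.inl (x, a, i, j)),
    fun y b => functional fun i j => c (.inr (y, b, i, j)))

theorem apply_eq_sum_single (f : WeakDual ℂ (Matrix (Fin d) (Fin d) ℂ))
    (V : Matrix (Fin d) (Fin d) ℂ) : f V = ∑ i, ∑ j, V i j * f (Matrix.single i j 1) := by
  conv_lhs => rw [Matrix.matrix_eq_sum_single V]
  simp only [map_sum]
  refine Finset.sum_congr rfl fun i _ => Finset.sum_congr rfl fun j _ => ?_
  rw [← smul_eq_mul, ← map_smul, Matrix.smul_single, smul_eq_mul, mul_one]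

theorem ofCoords_coords (s : FunctionalFamily k m d) : ofCoords (coords s) = s := by
  refine Prod.ext (funext fun x => funext fun a => ?_) (funext fun y => funext fun b => ?_)
  · exact DFunLike.ext _ _ fun V => (apply_eq_sum_single (s.1 x a) V).symm
  · exact DFunLike.ext _ _ fun V => (apply_eq_sum_single (s.2 y b) V).symm

theorem continuous_ofCoords : Continuous (ofCoords : _ → FunctionalFamily k m d) := by
  refine Continuous.prodMk (continuous_pi fun x => continuous_pi fun a => ?_)
    (continuous_pi fun y => continuous_pi fun b => ?_)
  · refine WeakDual.continuous_of_continuous_eval fun V => ?_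
    simp only [functional_apply]
    fun_prop
  · refine WeakDual.continuous_of_continuous_eval fun V => ?_
    simp only [functional_apply]
    fun_prop

theorem functional_single (c : Fin d → Fin d → ℂ) (i j : Fin d) :
    functional c (Matrix.single i j 1) = c i j := by
  rw [functional_apply, Finset.sum_eq_single i, Finset.sum_eq_single j]
  · simp
  · intro j' _ hj'; simp [Ne.symm hj']
  · simp
  · intro i' _ hi'; simp [Ne.symm hi']
  · simp

theorem coords_ofCoords (c : (Fin k × Fin m × Fin d × Fin d) ⊕ (Fin k × Fin m × Fin d × Fin d) → ℂ) :
    coords (ofCoords c) = c := by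
  funext p
  rcases p with ⟨x, a, i, j⟩ | ⟨x, a, i, j⟩
  · exact functional_single (fun i j => c (.inl (x, a, i, j))) i j
  · exact functional_single (fun i j => c (.inr (x, a, i, j))) i j

/-- The direct sum of two tensor product models realises the convex combinations of their data. -/
theorem convex_coords_tensorData : Convex ℝ (coords '' tensorData k m d) := by
  rintro _ ⟨s, hs, rfl⟩ _ ⟨s', hs', rfl⟩ r r' hr hr' hrr
  obtain ⟨HA, _, _, _, HB, _, _, _, A, B, ψ, hA, hB, hψ, h1, h2⟩ := mem_tensorData_iff.1 hs
  obtain ⟨HA', _, _, _, HB', _, _, _, A', B', ψ', hA', hB', hψ', h1', h2'⟩ :=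
    mem_tensorData_iff.1 hs'
  obtain ⟨K, _, _, _, j, j', hj⟩ := exists_isDirectSum HA HA'
  obtain ⟨L, _, _, _, l, l', hl⟩ := exists_isDirectSum HB HB'
  let φ : Copies (Fin d) (HilbertTensor K L) := WithLp.toLp 2 fun i =>
    ((√r : ℝ) : ℂ) • tensorMap j l (ψ i) + ((√r' : ℝ) : ℂ) • tensorMap j' l' (ψ' i)
  have hφ : ∀ i i' P P' Q Q', inner ℂ (φ i)
      (opTensor (directSum j j' P P') (directSum l l' Q Q') (φ i')) =
      r * inner ℂ (ψ i) (opTensor P Q (ψ i')) + r' * inner ℂ (ψ' i) (opTensor P' Q' (ψ' i')) := by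
    intro i i' P P' Q Q'
    refine (hj.inner_add_tensorMap hl P P' Q Q' _ _ _ _ _ _).trans ?_
    rw [Real.sq_sqrt hr, Real.sq_sqrt hr']
  have hsum : ∀ (V : Matrix (Fin d) (Fin d) ℂ) (f f' : Fin d → Fin d → ℂ),
      ∑ i, ∑ i', V i i' * (r * f i i' + r' * f' i i') =
      r * ∑ i, ∑ i', V i i' * f i i' + r' * ∑ i, ∑ i', V i i' * f' i i' := by
    intro V f f'
    simp only [mul_add, Finset.sum_add_distrib, Finset.mul_sum, mul_left_comm]
  refine ⟨ofCoords (r • coords s + r' • coords s'), ?_, coords_ofCoords _⟩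
  have hof1 : ∀ x a V, (ofCoords (r • coords s + r' • coords s')).1 x a V =
      r * s.1 x a V + r' * s'.1 x a V := by
    intro x a V
    rw [apply_eq_sum_single (s.1 x a), apply_eq_sum_single (s'.1 x a), ← hsum]
    rfl
  have hof2 : ∀ x a V, (ofCoords (r • coords s + r' • coords s')).2 x a V =
      r * s.2 x a V + r' * s'.2 x a V := by
    intro x a V
    rw [apply_eq_sum_single (s.2 x a), apply_eq_sum_single (s'.2 x a), ← hsum]
    rfl
  refine mem_tensorData_iff.2 ⟨K, _, _, inferInstance, L, _, _, inferInstance, _, _, φ,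
    hA.directSum hj hA', hB.directSum hl hB', ?_, fun x a V => ?_, fun y b W => ?_⟩
  · have hn : ∀ {H : Type} [NormedAddCommGroup H] [InnerProductSpace ℂ H] (ψ : Copies (Fin d) H),
        ((‖ψ‖ : ℂ)) ^ 2 = ∑ i, inner ℂ (ψ i) (ψ i) := by
      intro H _ _ ψ
      rw [← inner_copies]
      exact (inner_self_eq_norm_sq_to_K ψ).symm
    have h : (‖φ‖ : ℂ) ^ 2 = 1 := by
      have h0 : ∀ i, inner ℂ (φ i) (φ i) =
          r * inner ℂ (ψ i) (ψ i) + r' * inner ℂ (ψ' i) (ψ' i) := by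
        intro i
        have := hφ i i 1 1 1 1
        rwa [hj.directSum_one, hl.directSum_one, opTensor_one, opTensor_one, opTensor_one] at this
      simp only [hn, h0, Finset.sum_add_distrib, ← Finset.mul_sum]
      rw [← hn, ← hn, hψ, hψ']
      simp only [Complex.ofReal_one, one_pow, mul_one]
      exact_mod_cast hrr
    have h' : ‖φ‖ ^ 2 = 1 := by exact_mod_cast h
    exact (pow_eq_one_iff_of_nonneg (norm_nonneg _) two_ne_zero).1 h'
  · rw [hof1, h1, h1', ← hsum]
    refine Finset.sum_congr rfl fun i _ => Finset.sum_congr rfl fun i' _ => congrArg _ ?_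
    rw [ampLeft_apply, ampLeft_apply, ampLeft_apply, ← hφ, hl.directSum_one]
  · rw [hof2, h2, h2', ← hsum]
    refine Finset.sum_congr rfl fun i _ => Finset.sum_congr rfl fun i' _ => congrArg _ ?_
    rw [ampRight_apply, ampRight_apply, ampRight_apply, ← hφ, hj.directSum_one]

end Steering

/-! ### Separation by steering games -/

namespace Steering

open OpMatrix Measurement TensorNorm

variable {k m d : ℕ}

/-- Steering data are hermitian functionals. -/
theorem apply_conjTranspose_of_mem_commutingData {s : FunctionalFamily k m d}
    (hs : s ∈ commutingData k m d) (V : Matrix (Fin d) (Fin d) ℂ) :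
    (∀ x a, s.1 x a V.conjTranspose = star (s.1 x a V)) ∧
      ∀ y b, s.2 y b V.conjTranspose = star (s.2 y b V) := by
  obtain ⟨H, _, _, _, A, B, ψ, hA, hB, -, -, h1, h2⟩ := mem_commutingData_iff.1 hs
  have h : ∀ T : H →L[ℂ] H, T.IsPositive →
      ∑ i, ∑ j, V.conjTranspose i j * inner ℂ (ψ i) (T (ψ j)) =
        star (∑ i, ∑ j, V i j * inner ℂ (ψ i) (T (ψ j))) := by
    intro T hT
    rw [star_sum, Finset.sum_comm]
    refine Finset.sum_congr rfl fun j _ => ?_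
    rw [star_sum]
    refine Finset.sum_congr rfl fun i _ => ?_
    rw [star_mul', Matrix.conjTranspose_apply]
    congr 1
    exact (hT.isSymmetric (ψ i) (ψ j)).symm.trans (inner_conj_symm _ _).symm
  exact ⟨fun x a => by rw [h1, h1]; exact h _ (hA.1 x a),
    fun y b => by rw [h2, h2]; exact h _ (hB.1 y b)⟩

/-- If commuting strategies are not better than tensor product strategies in any steering game, the
closure of the tensor product data is the set of all commuting data. Otherwise a hyperplane
separates a point of the latter from the former, and its hermitian part is a game. -/
theorem closure_tensorData_eq (hk : k ≠ 0) (hm : m ≠ 0) (hd : 1 ≤ d)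
    (h : ∀ V W : Fin k → Fin m → Matrix (Fin d) (Fin d) ℂ, (∀ x a, (V x a).IsHermitian) →
      (∀ y b, (W y b).IsHermitian) → tensorValue V W = commutativeValue V W) :
    closure (tensorData k m d) = commutingData k m d := by
  refine subset_antisymm
    (closure_minimal tensorData_subset_commutingData isClosed_commutingData) fun s hs => ?_
  have himage : coords s ∈ closure (coords '' tensorData k m d) → s ∈ closure (tensorData k m d) := by
    intro hc
    have h1 := image_closure_subset_closure_image continuous_ofCoords
      (Set.mem_image_of_mem ofCoords hc)
    rw [ofCoords_coords, Set.image_image] at h1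
    simpa only [ofCoords_coords, Set.image_id'] using h1
  refine himage (not_not.1 fun hnot => ?_)
  obtain ⟨f, u, hfu, huf⟩ := RCLike.geometric_hahn_banach_closed_point (𝕜 := ℂ)
    convex_coords_tensorData.closure isClosed_closure hnot
  let V₀ : Fin k → Fin m → Matrix (Fin d) (Fin d) ℂ := fun x a =>
    Matrix.of fun i j => f (Pi.single (.inl (x, a, i, j)) 1)
  let W₀ : Fin k → Fin m → Matrix (Fin d) (Fin d) ℂ := fun y b =>
    Matrix.of fun i j => f (Pi.single (.inr (y, b, i, j)) 1)
  let V : Fin k → Fin m → Matrix (Fin d) (Fin d) ℂ := fun x a => V₀ x a + (V₀ x a).conjTranspose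
  let W : Fin k → Fin m → Matrix (Fin d) (Fin d) ℂ := fun y b => W₀ y b + (W₀ y b).conjTranspose
  have hf : ∀ s, f (coords s) = ∑ x, ∑ a, s.1 x a (V₀ x a) + ∑ y, ∑ b, s.2 y b (W₀ y b) := by
    intro s
    have hsingle : ∀ p, (f.toLinearMap fun q => if p = q then 1 else 0) = f (Pi.single p 1) :=
      fun p => congrArg f (funext fun q => by simp [Pi.single_apply, eq_comm])
    have h1 := f.toLinearMap.pi_apply_eq_sum_univ (coords s)
    refine h1.trans ?_
    rw [Fintype.sum_sum_type]
    simp only [Fintype.sum_prod_type]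
    congr 1
    · refine Finset.sum_congr rfl fun x _ => Finset.sum_congr rfl fun a _ => ?_
      rw [apply_eq_sum_single]
      refine Finset.sum_congr rfl fun i _ => Finset.sum_congr rfl fun j _ => ?_
      rw [hsingle, smul_eq_mul, mul_comm]
      rfl
    · refine Finset.sum_congr rfl fun x _ => Finset.sum_congr rfl fun a _ => ?_
      rw [apply_eq_sum_single]
      refine Finset.sum_congr rfl fun i _ => Finset.sum_congr rfl fun j _ => ?_
      rw [hsingle, smul_eq_mul, mul_comm]
      rfl
  -- As the data are hermitian, `V₀ x a` and its adjoint contribute the same real part.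
  have hscore : ∀ s ∈ commutingData k m d, score V W s = 2 * (f (coords s)).re := by
    intro s hs
    have h1 : ∀ x a, (s.1 x a (V x a)).re = 2 * (s.1 x a (V₀ x a)).re := by
      intro x a
      rw [map_add, ((apply_conjTranspose_of_mem_commutingData hs _).1 x a), Complex.add_re,
        Complex.star_def, Complex.conj_re, two_mul]
    have h2 : ∀ x a, (s.2 x a (W x a)).re = 2 * (s.2 x a (W₀ x a)).re := by
      intro x a
      rw [map_add, ((apply_conjTranspose_of_mem_commutingData hs _).2 x a), Complex.add_re,
        Complex.star_def, Complex.conj_re, two_mul]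
    rw [score, hf]
    simp only [Complex.add_re, Complex.re_sum, h1, h2, mul_add, Finset.mul_sum]
  have hval := h V W (fun x a => Matrix.isHermitian_add_transpose_self _)
    (fun y b => Matrix.isHermitian_add_transpose_self _)
  have hk' : 1 / (2 * (k : ℝ)) ≠ 0 := by
    have : (k : ℝ) ≠ 0 := Nat.cast_ne_zero.2 hk
    positivity
  have hsup := mul_left_cancel₀ hk' hval
  have h3 : sSup (score V W '' tensorData k m d) ≤ 2 * u := by
    refine csSup_le ((tensorData_nonempty hm hd).image _) ?_
    rintro _ ⟨t, ht, rfl⟩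
    rw [hscore t (tensorData_subset_commutingData ht)]
    exact mul_le_mul_of_nonneg_left (hfu _ (subset_closure ⟨t, ht, rfl⟩)).le zero_le_two
  have h4 : 2 * (f (coords s)).re ≤ sSup (score V W '' commutingData k m d) := by
    rw [← hscore s hs]
    exact le_csSup (bddAbove_score V W) ⟨s, hs, rfl⟩
  have h5 : u < (f (coords s)).re := huf
  linarith

end Steering

/-! ### Representations of the group of the Bell scenario -/

namespace Steering

open MaxGroup

variable {k m : ℕ}

/-- Elements `w x` with `(w x)^m = 1` define a homomorphism on the group of the Bell scenario. -/
theorem exists_hom_gen {G : Type*} [Group G] (w : Fin k → G) (hw : ∀ x, w x ^ m = 1) :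
    ∃ f : BellGroup k m →* G, ∀ x, f (gen k m x) = w x := by
  let f : ∀ _ : Fin k, Multiplicative (ZMod m) →* G := fun x =>
    AddMonoidHom.toMultiplicativeLeft (ZMod.lift m (A := Additive G)
      (⟨zmultiplesHom (Additive G) (Additive.ofMul (w x)),
        by simpa using congrArg Additive.ofMul (hw x)⟩ : {f : ℤ →+ Additive G // f m = 0}))
  refine ⟨Monoid.CoprodI.lift f, fun x => ?_⟩
  rw [gen, Monoid.CoprodI.lift_of]
  have h1 : (1 : ZMod m) = ((1 : ℤ) : ZMod m) := by simp
  change Additive.toMul (ZMod.lift m _ (1 : ZMod m)) = w x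
  rw [h1, ZMod.lift_coe]
  simp

theorem closure_range_gen (hm : m ≠ 0) : Submonoid.closure (Set.range (gen k m)) = ⊤ := by
  have : NeZero m := ⟨hm⟩
  refine top_le_iff.1 fun g _ => ?_
  induction g using Monoid.CoprodI.induction_on with
  | one => exact one_mem _
  | of x z =>
    have hz : z = Multiplicative.ofAdd (1 : ZMod m) ^ (Multiplicative.toAdd z).val := by
      rw [← ofAdd_nsmul, nsmul_one, ZMod.natCast_zmod_val]
      rfl
    rw [hz, map_pow]
    exact pow_mem (Submonoid.subset_closure (Set.mem_range_self x)) _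
  | mul g h hg hh => exact mul_mem (hg trivial) (hh trivial)

theorem gen_pow_card (x : Fin k) : gen k m x ^ m = 1 := by
  rw [gen, ← map_pow, ← ofAdd_nsmul, nsmul_one, ZMod.natCast_self, ofAdd_zero, map_one]

end Steering

/-! ### Approximation of commuting representations by tensor products -/

namespace TensorNorm

open MaxGroup

variable {G : Type} [Group G]

theorem tmul_mem_span (a b : GroupAlgebra G) :
    (a : GroupCStar G) ⊗ₜ[ℂ] (b : GroupCStar G) ∈ Submodule.span ℂ (Set.range fun p : G × G =>
      (MaxGroup.of G p.1 : GroupCStar G) ⊗ₜ[ℂ] (MaxGroup.of G p.2 : GroupCStar G)) := by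
  have hsingle : ∀ (g : G) (c : ℂ), ((single g c : GroupAlgebra G) : GroupCStar G) =
      c • (MaxGroup.of G g : GroupCStar G) := by
    intro g c
    rw [coe_of, ← UniformSpace.Completion.coe_smul, smul_single, mul_one]
  induction a using MaxGroup.induction_linear with
  | h0 =>
    rw [UniformSpace.Completion.coe_zero, TensorProduct.zero_tmul]
    exact zero_mem _
  | hadd a a' ha ha' =>
    rw [UniformSpace.Completion.coe_add, TensorProduct.add_tmul]
    exact add_mem ha ha'
  | hs g c =>
    induction b using MaxGroup.induction_linear with
    | h0 =>
      rw [UniformSpace.Completion.coe_zero, TensorProduct.tmul_zero]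
      exact zero_mem _
    | hadd b b' hb hb' =>
      rw [UniformSpace.Completion.coe_add, TensorProduct.tmul_add]
      exact add_mem hb hb'
    | hs g' c' =>
      rw [hsingle, hsingle, TensorProduct.tmul_smul, ← TensorProduct.smul_tmul']
      exact Submodule.smul_mem _ _ (Submodule.smul_mem _ _ (Submodule.subset_span ⟨(g, g'), rfl⟩))

/-- The span of the tensors of group elements is dense in the maximal norm. -/
theorem exists_mem_span_maxNorm_le (x : GroupCStar G ⊗[ℂ] GroupCStar G) :
    ∀ ε : ℝ, 0 < ε → ∃ y ∈ Submodule.span ℂ (Set.range fun p : G × G =>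
      (MaxGroup.of G p.1 : GroupCStar G) ⊗ₜ[ℂ] (MaxGroup.of G p.2 : GroupCStar G)),
      maxNorm (x - y) ≤ ε := by
  induction x using TensorProduct.induction_on with
  | zero =>
    intro ε hε
    refine ⟨0, zero_mem _, ?_⟩
    rw [sub_zero, ← TensorProduct.tmul_zero (GroupCStar G) (0 : GroupCStar G)]
    exact (maxNorm_tmul_le _ _).trans (by simpa using hε.le)
  | add x x' hx hx' =>
    intro ε hε
    obtain ⟨y, hy, h⟩ := hx (ε / 2) (by positivity)
    obtain ⟨y', hy', h'⟩ := hx' (ε / 2) (by positivity)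
    refine ⟨y + y', add_mem hy hy', ?_⟩
    rw [add_sub_add_comm]
    exact (maxNorm_add_le _ _).trans (by linarith)
  | tmul a b =>
    intro ε hε
    obtain ⟨a', ha'⟩ := UniformSpace.Completion.denseRange_coe.exists_dist_lt a
      (show 0 < ε / 2 / (‖b‖ + 1) by positivity)
    obtain ⟨b', hb'⟩ := UniformSpace.Completion.denseRange_coe.exists_dist_lt b
      (show 0 < ε / 2 / (‖(a' : GroupCStar G)‖ + 1) by positivity)
    refine ⟨_, tmul_mem_span a' b', ?_⟩
    have h : a ⊗ₜ[ℂ] b - (a' : GroupCStar G) ⊗ₜ[ℂ] (b' : GroupCStar G) =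
        (a - a') ⊗ₜ[ℂ] b + (a' : GroupCStar G) ⊗ₜ[ℂ] (b - b') := by
      rw [TensorProduct.sub_tmul, TensorProduct.tmul_sub]
      abel
    rw [h]
    rw [dist_eq_norm, lt_div_iff₀ (by positivity)] at ha' hb'
    refine (maxNorm_add_le _ _).trans ((add_le_add (maxNorm_tmul_le _ _)
      (maxNorm_tmul_le _ _)).trans ?_)
    have h1 := norm_nonneg (a - a')
    have h2 := norm_nonneg (b - b')
    nlinarith

/-- It suffices to compare the norms of sums of tensors of group elements. -/
theorem MinEqMax.of_span (h : ∀ y ∈ Submodule.span ℂ (Set.range fun p : G × G =>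
    (MaxGroup.of G p.1 : GroupCStar G) ⊗ₜ[ℂ] (MaxGroup.of G p.2 : GroupCStar G)),
    maxNorm y ≤ minNorm y) : MinEqMax (GroupCStar G) (GroupCStar G) := by
  intro x
  refine le_antisymm (minNorm_le_maxNorm x) (le_of_forall_pos_le_add fun ε hε => ?_)
  obtain ⟨y, hy, hxy⟩ := exists_mem_span_maxNorm_le x (ε / 2) (by positivity)
  have hyx : maxNorm (y - x) ≤ maxNorm (x - y) :=
    maxNorm_le (maxNorm_nonneg _) fun H _ _ _ π σ h' => by
      rw [← neg_sub, map_neg, norm_neg]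
      exact norm_commRep_le_maxNorm π σ h' (x - y)
  calc maxNorm x = maxNorm (x - y + y) := by rw [sub_add_cancel]
    _ ≤ maxNorm (x - y) + maxNorm y := maxNorm_add_le _ _
    _ ≤ ε / 2 + minNorm y := add_le_add hxy (h y hy)
    _ = ε / 2 + minNorm (x + (y - x)) := by rw [add_sub_cancel]
    _ ≤ ε / 2 + (minNorm x + maxNorm (y - x)) := by
        gcongr
        exact (minNorm_add_le _ _).trans (by gcongr; exact minNorm_le_maxNorm _)
    _ ≤ minNorm x + ε := by linarith

end TensorNorm

namespace Steering

open OpMatrix Measurement TensorNorm MaxGroup Filter Topology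

variable {k m d : ℕ}

theorem apply_single_of_forall {f : WeakDual ℂ (Matrix (Fin d) (Fin d) ℂ)} {c : Fin d → Fin d → ℂ}
    (h : ∀ V, f V = ∑ i, ∑ j, V i j * c i j) (i j : Fin d) : f (Matrix.single i j 1) = c i j :=
  (h _).trans (functional_single c i j)

theorem sum_mul_inner_map {A H ι : Type*} [Ring A] [StarRing A] [Algebra ℂ A]
    [NormedAddCommGroup H] [InnerProductSpace ℂ H] [CompleteSpace H] [Fintype ι]
    (ρ : A →⋆ₐ[ℂ] (H →L[ℂ] H)) (c : ι → ℂ) (R : ι → A) (x y : H) :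
    ∑ a, c a * inner ℂ x (ρ (R a) y) = inner ℂ x (ρ (∑ a, c a • R a) y) := by
  rw [map_sum]
  simp only [map_smul, sum_apply, smul_apply, inner_sum, inner_smul_right]

theorem inner_smul_map_smul {H : Type*} [NormedAddCommGroup H] [InnerProductSpace ℂ H] (r : ℝ)
    (R : H →L[ℂ] H) (x y : H) :
    inner ℂ ((r : ℂ) • x) (R ((r : ℂ) • y)) = (r : ℂ) ^ 2 * inner ℂ x (R y) := by
  rw [map_smul, inner_smul_left, inner_smul_right, Complex.conj_ofReal]
  ring

/-- If tensor product data are dense in the commuting data, the Gram matrix of finitely many vectors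
and the matrix coefficients of the generators of two commuting representations are limits of such
matrices for tensor products of representations. Here the steering data are those of the spectral
measurements of the generators. -/
theorem exists_tensor_model_near_fin (hk : k ≠ 0) (hm : m ≠ 0)
    (hcl : closure (tensorData k m d) = commutingData k m d)
    {H : Type} [NormedAddCommGroup H] [InnerProductSpace ℂ H] [CompleteSpace H]
    (π σ : GroupCStar (BellGroup k m) →⋆ₐ[ℂ] (H →L[ℂ] H)) (hπσ : ∀ a b, Commute (π a) (σ b))
    (Ψ : Copies (Fin d) H) (hΨ : Ψ ≠ 0) {ε : ℝ} (hε : 0 < ε) :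
    ∃ (HA : Type) (_ : NormedAddCommGroup HA) (_ : InnerProductSpace ℂ HA) (_ : CompleteSpace HA)
      (HB : Type) (_ : NormedAddCommGroup HB) (_ : InnerProductSpace ℂ HB) (_ : CompleteSpace HB)
      (π' : GroupCStar (BellGroup k m) →⋆ₐ[ℂ] (HA →L[ℂ] HA))
      (σ' : GroupCStar (BellGroup k m) →⋆ₐ[ℂ] (HB →L[ℂ] HB))
      (Φ : Fin d → HilbertTensor HA HB), ∀ i j,
        ‖inner ℂ (Φ i) (Φ j) - inner ℂ (Ψ i) (Ψ j)‖ < ε ∧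
        (∀ x, ‖inner ℂ (Φ i) (ampLeft HA HB (π' (MaxGroup.of _ (gen k m x))) (Φ j)) -
          inner ℂ (Ψ i) (π (MaxGroup.of _ (gen k m x)) (Ψ j))‖ < ε) ∧
        ∀ x, ‖inner ℂ (Φ i) (ampRight HA HB (σ' (MaxGroup.of _ (gen k m x))) (Φ j)) -
          inner ℂ (Ψ i) (σ (MaxGroup.of _ (gen k m x)) (Ψ j))‖ < ε := by
  have hN : ‖Ψ‖ ≠ 0 := norm_ne_zero_iff.2 hΨ
  let e : Fin k → Fin m → GroupCStar (BellGroup k m) := fun x a =>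
    effect m (MaxGroup.of _ (gen k m x) : GroupCStar (BellGroup k m)) a
  have he1 : ∀ x, ∑ a, e x a = 1 := fun x => sum_effect hm (MaxGroup.of _ (gen k m x)).2.1
  have heu : ∀ x, ∑ a : Fin m, root m ^ (a : ℕ) • e x a = MaxGroup.of _ (gen k m x) := fun x =>
    sum_root_smul_effect hm (MaxGroup.of _ (gen k m x)).2.1 (by
      rw [← SubmonoidClass.coe_pow, ← map_pow, gen_pow_card, map_one]; rfl)
  have hpovm : ∀ π : GroupCStar (BellGroup k m) →⋆ₐ[ℂ] (H →L[ℂ] H),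
      IsPOVMFamily fun x a => π (e x a) := by
    refine fun π => ⟨fun x a => ?_, fun x => by rw [← map_sum, he1, map_one]⟩
    change (π (effect m _ a)).IsPositive
    rw [map_effect]
    exact effect_isPositive _ a
  -- Steering data are defined by unit vectors.
  let Ψ₁ : Copies (Fin d) H := ((‖Ψ‖⁻¹ : ℝ) : ℂ) • Ψ
  have hΨ₁ : ‖Ψ₁‖ = 1 := by
    rw [norm_smul, Complex.norm_real, norm_inv, norm_norm, inv_mul_cancel₀ hN]
  let s : FunctionalFamily k m d :=
    (fun x a => functional fun i j => inner ℂ (Ψ₁ i) (π (e x a) (Ψ₁ j)),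
      fun y b => functional fun i j => inner ℂ (Ψ₁ i) (σ (e y b) (Ψ₁ j)))
  have hs : s ∈ commutingData k m d := mem_commutingData_iff.2 ⟨H, _, _, inferInstance, _, _, Ψ₁,
    hpovm π, hpovm σ, fun x a y b => hπσ _ _, hΨ₁, fun x a V => functional_apply _ _,
    fun y b W => functional_apply _ _⟩
  rw [← hcl] at hs
  -- The matrix entries in question are continuous functions of the data.
  let f₁ : (Fin m → ℂ) → Fin k → Fin d → Fin d → FunctionalFamily k m d → ℂ := fun c x i j s' =>
    (‖Ψ‖ : ℂ) ^ 2 * ∑ a, c a * s'.1 x a (Matrix.single i j 1)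
  let f₂ : (Fin m → ℂ) → Fin k → Fin d → Fin d → FunctionalFamily k m d → ℂ := fun c x i j s' =>
    (‖Ψ‖ : ℂ) ^ 2 * ∑ a, c a * s'.2 x a (Matrix.single i j 1)
  have hf₁ : ∀ c x i j, ∀ᶠ s' in 𝓝 s, ‖f₁ c x i j s' - f₁ c x i j s‖ < ε := by
    intro c x i j
    have hcont : Continuous (f₁ c x i j) := continuous_const.mul
      (continuous_finsetSum _ fun a _ => continuous_const.mul (continuous_fst_eval x a _))
    have := (hcont.tendsto s).eventually (Metric.ball_mem_nhds _ hε)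
    simpa only [Metric.mem_ball, dist_eq_norm] using this
  have hf₂ : ∀ c x i j, ∀ᶠ s' in 𝓝 s, ‖f₂ c x i j s' - f₂ c x i j s‖ < ε := by
    intro c x i j
    have hcont : Continuous (f₂ c x i j) := continuous_const.mul
      (continuous_finsetSum _ fun a _ => continuous_const.mul (continuous_snd_eval x a _))
    have := (hcont.tendsto s).eventually (Metric.ball_mem_nhds _ hε)
    simpa only [Metric.mem_ball, dist_eq_norm] using this
  let x₀ : Fin k := ⟨0, Nat.pos_of_ne_zero hk⟩
  let ω : Fin m → ℂ := fun a => root m ^ (a : ℕ)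
  obtain ⟨s', hs', hs1, hs2, hs3⟩ := ((mem_closure_iff_frequently.1 hs).and_eventually
    ((eventually_all.2 fun i => eventually_all.2 fun j => hf₁ 1 x₀ i j).and
      ((eventually_all.2 fun x => eventually_all.2 fun i => eventually_all.2 fun j =>
        hf₁ ω x i j).and
      (eventually_all.2 fun x => eventually_all.2 fun i => eventually_all.2 fun j =>
        hf₂ ω x i j)))).exists
  obtain ⟨HA, _, _, _, HB, _, _, _, P, Q, ψ, hP, hQ, h1, h2⟩ := exists_pvm_of_mem_tensorData hm hs'
  obtain ⟨u, hu⟩ := exists_hom_gen (m := m)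
    (fun x => (⟨pvmUnitary (P x), (hP x).pvmUnitary_mem hm⟩ : unitary (HA →L[ℂ] HA)))
    (fun x => Subtype.ext ((hP x).pvmUnitary_pow_card hm))
  obtain ⟨v, hv⟩ := exists_hom_gen (m := m)
    (fun x => (⟨pvmUnitary (Q x), (hQ x).pvmUnitary_mem hm⟩ : unitary (HB →L[ℂ] HB)))
    (fun x => Subtype.ext ((hQ x).pvmUnitary_pow_card hm))
  have hΨinner : ∀ i j (R : H →L[ℂ] H), (‖Ψ‖ : ℂ) ^ 2 * inner ℂ (Ψ₁ i) (R (Ψ₁ j)) =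
      inner ℂ (Ψ i) (R (Ψ j)) := by
    intro i j R
    have hN' : (‖Ψ‖ : ℂ) ≠ 0 := by exact_mod_cast hN
    have h3 := inner_smul_map_smul ‖Ψ‖⁻¹ R (Ψ i) (Ψ j)
    rw [Complex.ofReal_inv] at h3
    change (‖Ψ‖ : ℂ) ^ 2 * inner ℂ (((‖Ψ‖⁻¹ : ℝ) : ℂ) • Ψ i) (R (((‖Ψ‖⁻¹ : ℝ) : ℂ) • Ψ j)) = _
    rw [Complex.ofReal_inv, h3, ← mul_assoc, ← mul_pow, mul_inv_cancel₀ hN', one_pow, one_mul]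
  have hs₁ : ∀ c x i j, f₁ c x i j s = inner ℂ (Ψ i) (π (∑ a, c a • e x a) (Ψ j)) := by
    intro c x i j
    have h3 : ∀ a, s.1 x a (Matrix.single i j 1) = inner ℂ (Ψ₁ i) (π (e x a) (Ψ₁ j)) :=
      fun a => functional_single (fun i j => inner ℂ (Ψ₁ i) (π (e x a) (Ψ₁ j))) i j
    rw [← hΨinner i j (π (∑ a, c a • e x a)), ← sum_mul_inner_map π c (e x) (Ψ₁ i) (Ψ₁ j)]
    simp only [f₁, h3]
  have hs₂ : ∀ c x i j, f₂ c x i j s = inner ℂ (Ψ i) (σ (∑ a, c a • e x a) (Ψ j)) := by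
    intro c x i j
    have h3 : ∀ a, s.2 x a (Matrix.single i j 1) = inner ℂ (Ψ₁ i) (σ (e x a) (Ψ₁ j)) :=
      fun a => functional_single (fun i j => inner ℂ (Ψ₁ i) (σ (e x a) (Ψ₁ j))) i j
    rw [← hΨinner i j (σ (∑ a, c a • e x a)), ← sum_mul_inner_map σ c (e x) (Ψ₁ i) (Ψ₁ j)]
    simp only [f₂, h3]
  have hs₁' : ∀ c x i j, f₁ c x i j s' = inner ℂ ((‖Ψ‖ : ℂ) • ψ i)
      (ampLeft HA HB (∑ a, c a • P x a) ((‖Ψ‖ : ℂ) • ψ j)) := by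
    intro c x i j
    have h3 : ∀ a, s'.1 x a (Matrix.single i j 1) = inner ℂ (ψ i) (ampLeft HA HB (P x a) (ψ j)) :=
      fun a => apply_single_of_forall (h1 x a) i j
    rw [inner_smul_map_smul, ← sum_mul_inner_map (ampLeft HA HB) c (P x) (ψ i) (ψ j)]
    simp only [f₁, h3]
  have hs₂' : ∀ c x i j, f₂ c x i j s' = inner ℂ ((‖Ψ‖ : ℂ) • ψ i)
      (ampRight HA HB (∑ a, c a • Q x a) ((‖Ψ‖ : ℂ) • ψ j)) := by
    intro c x i j
    have h3 : ∀ a, s'.2 x a (Matrix.single i j 1) = inner ℂ (ψ i) (ampRight HA HB (Q x a) (ψ j)) :=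
      fun a => apply_single_of_forall (h2 x a) i j
    rw [inner_smul_map_smul, ← sum_mul_inner_map (ampRight HA HB) c (Q x) (ψ i) (ψ j)]
    simp only [f₂, h3]
  refine ⟨HA, _, _, inferInstance, HB, _, _, inferInstance, liftCStar u, liftCStar v,
    fun i => (‖Ψ‖ : ℂ) • ψ i, fun i j => ⟨?_, fun x => ?_, fun x => ?_⟩⟩
  · have := hs1 i j
    rw [hs₁, hs₁'] at this
    simpa only [Pi.one_apply, one_smul, he1, (hP x₀).sum_eq, map_one, one_apply_eq_self] using this
  · have := hs2 x i j
    rw [hs₁, hs₁', heu] at this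
    rw [liftCStar_of, hu]
    exact this
  · have := hs3 x i j
    rw [hs₂, hs₂', heu] at this
    rw [liftCStar_of, hv]
    exact this

/-- The approximation by tensor products for the finite part `T` of a family of vectors. -/
theorem exists_tensor_model_near (hk : k ≠ 0) (hm : m ≠ 0)
    (hcl : ∀ d, 1 ≤ d → closure (tensorData k m d) = commutingData k m d)
    {H : Type} [NormedAddCommGroup H] [InnerProductSpace ℂ H] [CompleteSpace H]
    (π σ : GroupCStar (BellGroup k m) →⋆ₐ[ℂ] (H →L[ℂ] H)) (hπσ : ∀ a b, Commute (π a) (σ b))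
    {α : Type*} (Ψ : α → H) (hΨ : ∀ p, Ψ p ≠ 0) (T : Finset α) {ε : ℝ} (hε : 0 < ε) :
    ∃ (HA : Type) (_ : NormedAddCommGroup HA) (_ : InnerProductSpace ℂ HA) (_ : CompleteSpace HA)
      (HB : Type) (_ : NormedAddCommGroup HB) (_ : InnerProductSpace ℂ HB) (_ : CompleteSpace HB)
      (π' : GroupCStar (BellGroup k m) →⋆ₐ[ℂ] (HA →L[ℂ] HA))
      (σ' : GroupCStar (BellGroup k m) →⋆ₐ[ℂ] (HB →L[ℂ] HB))
      (Φ : α → HilbertTensor HA HB), ∀ p ∈ T, ∀ q ∈ T,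
        ‖inner ℂ (Φ p) (Φ q) - inner ℂ (Ψ p) (Ψ q)‖ < ε ∧
        (∀ x, ‖inner ℂ (Φ p) (ampLeft HA HB (π' (MaxGroup.of _ (gen k m x))) (Φ q)) -
          inner ℂ (Ψ p) (π (MaxGroup.of _ (gen k m x)) (Ψ q))‖ < ε) ∧
        ∀ x, ‖inner ℂ (Φ p) (ampRight HA HB (σ' (MaxGroup.of _ (gen k m x))) (Φ q)) -
          inner ℂ (Ψ p) (σ (MaxGroup.of _ (gen k m x)) (Ψ q))‖ < ε := by
  classical
  rcases T.eq_empty_or_nonempty with rfl | ⟨p₀, hp₀⟩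
  · exact ⟨H, _, _, inferInstance, H, _, _, inferInstance, π, σ, 0, by simp⟩
  have hd : 1 ≤ T.card := Finset.card_pos.2 ⟨p₀, hp₀⟩
  let Ψ' : Copies (Fin T.card) H := WithLp.toLp 2 fun i => Ψ (T.equivFin.symm i)
  have hΨ' : Ψ' ≠ 0 := by
    intro h
    have := congrArg (fun z : Copies (Fin T.card) H => z ⟨0, hd⟩) h
    exact hΨ _ this
  obtain ⟨HA, _, _, _, HB, _, _, _, π', σ', Φ, h⟩ :=
    exists_tensor_model_near_fin hk hm (hcl _ hd) π σ hπσ Ψ' hΨ' hε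
  refine ⟨HA, _, _, inferInstance, HB, _, _, inferInstance, π', σ',
    fun p => if hp : p ∈ T then Φ (T.equivFin ⟨p, hp⟩) else 0, fun p hp q hq => ?_⟩
  have := h (T.equivFin ⟨p, hp⟩) (T.equivFin ⟨q, hq⟩)
  simpa only [dif_pos hp, dif_pos hq, Ψ', Equiv.symm_apply_apply] using this

end Steering

namespace Steering

open OpMatrix Measurement TensorNorm MaxGroup Filter Topology

section Limits

variable {ι : Type*} {l : Filter ι} {K : ι → Type*} [∀ t, NormedAddCommGroup (K t)]
  [∀ t, InnerProductSpace ℂ (K t)] {H : Type*} [NormedAddCommGroup H] [InnerProductSpace ℂ H]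

theorem tendsto_norm_of_inner {φ : ∀ t, K t} {ξ : H}
    (h : Tendsto (fun t => inner ℂ (φ t) (φ t)) l (𝓝 (inner ℂ ξ ξ))) :
    Tendsto (fun t => ‖φ t‖) l (𝓝 ‖ξ‖) := by
  have h1 := (Complex.continuous_re.tendsto _).comp h
  have h2 := (Real.continuous_sqrt.tendsto _).comp h1
  rw [norm_eq_sqrt_re_inner (𝕜 := ℂ) ξ]
  exact h2.congr fun t => (norm_eq_sqrt_re_inner (𝕜 := ℂ) (φ t)).symm

/-- If the Gram matrix of `φ' t` and the image of `φ t` under an isometry converges to that of two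
equal vectors, the distance of the two vectors converges to zero. -/
theorem tendsto_norm_sub_isometry {φ φ' : ∀ t, K t} {w : ∀ t, K t →L[ℂ] K t}
    (hw : ∀ t z, ‖w t z‖ = ‖z‖) {ξ ξ' : H} (hξ : ‖ξ'‖ = ‖ξ‖)
    (h1 : Tendsto (fun t => inner ℂ (φ t) (φ t)) l (𝓝 (inner ℂ ξ ξ)))
    (h2 : Tendsto (fun t => inner ℂ (φ' t) (φ' t)) l (𝓝 (inner ℂ ξ' ξ')))
    (h3 : Tendsto (fun t => inner ℂ (φ' t) (w t (φ t))) l (𝓝 (inner ℂ ξ' ξ'))) :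
    Tendsto (fun t => ‖φ' t - w t (φ t)‖) l (𝓝 0) := by
  have h4 : Tendsto (fun t => ‖φ' t‖ ^ 2 - 2 * (inner ℂ (φ' t) (w t (φ t))).re + ‖φ t‖ ^ 2) l
      (𝓝 (‖ξ'‖ ^ 2 - 2 * (inner ℂ ξ' ξ').re + ‖ξ‖ ^ 2)) :=
    (((tendsto_norm_of_inner h2).pow 2).sub
      (((Complex.continuous_re.tendsto _).comp h3).const_mul 2)).add
      ((tendsto_norm_of_inner h1).pow 2)
  have h5 : (inner ℂ ξ' ξ').re = ‖ξ'‖ ^ 2 := inner_self_eq_norm_sq (𝕜 := ℂ) ξ'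
  have h6 : ‖ξ'‖ ^ 2 - 2 * (inner ℂ ξ' ξ').re + ‖ξ‖ ^ 2 = 0 := by rw [h5, hξ]; ring
  rw [h6] at h4
  have h7 := (Real.continuous_sqrt.tendsto _).comp h4
  rw [Real.sqrt_zero] at h7
  refine h7.congr fun t => ?_
  have h8 := norm_sub_sq (𝕜 := ℂ) (φ' t) (w t (φ t))
  rw [hw] at h8
  rw [Function.comp_apply]
  exact (congrArg Real.sqrt h8.symm).trans (Real.sqrt_sq (norm_nonneg _))

theorem tendsto_norm_sub_trans {a b c : ∀ t, K t} {w : ∀ t, K t →L[ℂ] K t}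
    (hw : ∀ t z, ‖w t z‖ = ‖z‖) (h1 : Tendsto (fun t => ‖a t - w t (b t)‖) l (𝓝 0))
    (h2 : Tendsto (fun t => ‖b t - c t‖) l (𝓝 0)) :
    Tendsto (fun t => ‖a t - w t (c t)‖) l (𝓝 0) := by
  have h3 := h1.add h2
  rw [add_zero] at h3
  refine squeeze_zero (fun t => norm_nonneg _) (fun t => ?_) h3
  calc ‖a t - w t (c t)‖ = ‖(a t - w t (b t)) + w t (b t - c t)‖ := by
        rw [map_sub, sub_add_sub_cancel]
    _ ≤ ‖a t - w t (b t)‖ + ‖w t (b t - c t)‖ := norm_add_le _ _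
    _ = _ := by rw [hw]

end Limits

variable {k m : ℕ}

/-- If tensor product data are dense in the commuting data, the two norms on `C⋆(Γ) ⊗ C⋆(Γ)` agree.
A vector `ψ` and two commuting representations are approximated through the family of all vectors
`π(g) σ(h) ψ`: the approximating vector with index `(g, h)` is close to `(π'(g) ⊗ σ'(h)) Φ(1, 1)`,
by induction on the lengths of `g` and `h`. -/
theorem minEqMax_bellGroup_of_closure (hk : k ≠ 0) (hm : m ≠ 0)
    (hcl : ∀ d, 1 ≤ d → closure (tensorData k m d) = commutingData k m d) :
    MinEqMax (GroupCStar (BellGroup k m)) (GroupCStar (BellGroup k m)) := by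
  refine MinEqMax.of_span fun y hy => maxNorm_le (minNorm_nonneg y) fun H _ _ _ π σ hπσ =>
    ContinuousLinearMap.opNorm_le_bound _ (minNorm_nonneg y) fun ψ => ?_
  by_cases hψ : ψ = 0
  · simp [hψ]
  let u : BellGroup k m → GroupCStar (BellGroup k m) := fun g => MaxGroup.of _ g
  have hu1 : u 1 = 1 := by simp [u]
  have humul : ∀ g h, u (g * h) = u g * u h := fun g h => by simp [u]
  have hnorm : ∀ {L : Type} [NormedAddCommGroup L] [InnerProductSpace ℂ L] [CompleteSpace L]
      (ρ : GroupCStar (BellGroup k m) →⋆ₐ[ℂ] (L →L[ℂ] L)) (g : BellGroup k m) (z : L),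
      ‖ρ (u g) z‖ = ‖z‖ := fun ρ g z =>
    ContinuousLinearMap.norm_map_of_mem_unitary (Unitary.map_mem ρ (MaxGroup.of _ g).2) z
  let Ψ : BellGroup k m × BellGroup k m → H := fun p => π (u p.1) (σ (u p.2) ψ)
  have hΨnorm : ∀ p, ‖Ψ p‖ = ‖ψ‖ := fun p => by simp only [Ψ, hnorm]
  have hΨ0 : ∀ p, Ψ p ≠ 0 := fun p => by
    rw [← norm_ne_zero_iff, hΨnorm, norm_ne_zero_iff]; exact hψ
  -- The index `t` consists of a finite set of pairs on which the model is good and of a natural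
  -- number that gives the tolerance.
  choose HA iA1 iA2 iA3 HB iB1 iB2 iB3 π' σ' Φ hΦ using
    fun t : Finset (BellGroup k m × BellGroup k m) × ℕ =>
      exists_tensor_model_near hk hm hcl π σ hπσ Ψ hΨ0 t.1 (ε := 1 / ((t.2 : ℝ) + 1))
        (by positivity)
  let τA : ∀ t, GroupCStar (BellGroup k m) →⋆ₐ[ℂ] _ := fun t => (ampLeft (HA t) (HB t)).comp (π' t)
  let τB : ∀ t, GroupCStar (BellGroup k m) →⋆ₐ[ℂ] _ := fun t => (ampRight (HA t) (HB t)).comp (σ' t)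
  have hlim : ∀ (f : Finset (BellGroup k m × BellGroup k m) × ℕ → ℂ) (z : ℂ) (p q),
      (∀ t, p ∈ t.1 → q ∈ t.1 → ‖f t - z‖ < 1 / ((t.2 : ℝ) + 1)) → Tendsto f atTop (𝓝 z) := by
    classical
    intro f z p q hf
    rw [tendsto_iff_norm_sub_tendsto_zero]
    have hsnd : Tendsto (fun t : Finset (BellGroup k m × BellGroup k m) × ℕ => t.2) atTop atTop := by
      rw [← prod_atTop_atTop_eq]
      exact tendsto_snd
    refine squeeze_zero' (Filter.Eventually.of_forall fun t => norm_nonneg _) ?_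
      (tendsto_one_div_add_atTop_nhds_zero_nat.comp hsnd)
    filter_upwards [eventually_ge_atTop (({p, q} : Finset _), 0)] with t ht
    exact (hf t (ht.1 (by simp)) (ht.1 (by simp))).le
  have hgram : ∀ p q, Tendsto (fun t => inner ℂ (Φ t p) (Φ t q)) atTop (𝓝 (inner ℂ (Ψ p) (Ψ q))) :=
    fun p q => hlim _ _ p q fun t hp hq => (hΦ t p hp q hq).1
  have hleft : ∀ x p, Tendsto (fun t => ‖Φ t (gen k m x * p.1, p.2) -
      τA t (u (gen k m x)) (Φ t p)‖) atTop (𝓝 0) := by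
    intro x p
    have hp : Ψ (gen k m x * p.1, p.2) = π (u (gen k m x)) (Ψ p) := by
      simp only [Ψ, humul, map_mul]; rfl
    refine tendsto_norm_sub_isometry (fun t z => hnorm (τA t) _ z)
      ((hΨnorm (gen k m x * p.1, p.2)).trans (hΨnorm p).symm) (hgram _ _) (hgram _ _)
      (hlim _ _ (gen k m x * p.1, p.2) p fun t hp' hq' => ?_)
    have := (hΦ t _ hp' _ hq').2.1 x
    rwa [← hp] at this
  have hright : ∀ x p, Tendsto (fun t => ‖Φ t (p.1, gen k m x * p.2) -
      τB t (u (gen k m x)) (Φ t p)‖) atTop (𝓝 0) := by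
    intro x p
    have hp : Ψ (p.1, gen k m x * p.2) = σ (u (gen k m x)) (Ψ p) := by
      have h := DFunLike.congr_fun (hπσ (u p.1) (u (gen k m x))).eq (σ (u p.2) ψ)
      simp only [Ψ, humul, map_mul]
      exact h
    refine tendsto_norm_sub_isometry (fun t z => hnorm (τB t) _ z)
      ((hΨnorm (p.1, gen k m x * p.2)).trans (hΨnorm p).symm) (hgram _ _) (hgram _ _)
      (hlim _ _ (p.1, gen k m x * p.2) p fun t hp' hq' => ?_)
    have := (hΦ t _ hp' _ hq').2.2 x
    rwa [← hp] at this
  have hD1 : ∀ h, Tendsto (fun t => ‖Φ t (1, h) - τB t (u h) (Φ t (1, 1))‖) atTop (𝓝 0) := by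
    intro h
    have hh : h ∈ Submonoid.closure (Set.range (gen k m)) := by
      rw [closure_range_gen hm]; trivial
    induction hh using Submonoid.closure_induction_left with
    | one => simp [hu1]
    | mul_left x hx h _ ih =>
      obtain ⟨x, rfl⟩ := hx
      refine (tendsto_norm_sub_trans (fun t z => hnorm (τB t) _ z) (hright x (1, h)) ih).congr
        fun t => ?_
      rw [humul, map_mul]; rfl
  have hD2 : ∀ g h, Tendsto (fun t => ‖Φ t (g, h) - τA t (u g) (τB t (u h) (Φ t (1, 1)))‖) atTop
      (𝓝 0) := by
    intro g h
    have hg : g ∈ Submonoid.closure (Set.range (gen k m)) := by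
      rw [closure_range_gen hm]; trivial
    induction hg using Submonoid.closure_induction_left with
    | one =>
      refine (hD1 h).congr fun t => ?_
      rw [hu1, map_one]; rfl
    | mul_left x hx g _ ih =>
      obtain ⟨x, rfl⟩ := hx
      refine (tendsto_norm_sub_trans (fun t z => hnorm (τA t) _ z) (hleft x (g, h)) ih).congr
        fun t => ?_
      rw [humul, map_mul]; rfl
  obtain ⟨c, rfl⟩ := Finsupp.mem_span_range_iff_exists_finsupp.1 hy
  set y := c.sum fun p a => a • u p.1 ⊗ₜ[ℂ] u p.2 with hydef
  have hcomm : commRep π σ hπσ y ψ = ∑ p ∈ c.support, c p • Ψ p := by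
    simp only [hydef, Finsupp.sum, map_sum, map_smul, commRep_tmul, sum_apply, smul_apply]
    rfl
  have hspat : ∀ t, spatialRep (π' t) (σ' t) y (Φ t (1, 1)) =
      ∑ p ∈ c.support, c p • τA t (u p.1) (τB t (u p.2) (Φ t (1, 1))) := by
    intro t
    rw [spatialRep_eq_commRep]
    simp only [hydef, Finsupp.sum, map_sum, map_smul, commRep_tmul, sum_apply, smul_apply]
    rfl
  have hlhs : Tendsto (fun t => ‖∑ p ∈ c.support, c p • Φ t p‖) atTop
      (𝓝 ‖∑ p ∈ c.support, c p • Ψ p‖) := by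
    refine tendsto_norm_of_inner ?_
    simp only [sum_inner, inner_sum, inner_smul_left, inner_smul_right]
    exact tendsto_finsetSum _ fun p _ => (tendsto_finsetSum _ fun q _ =>
      (hgram q p).const_mul _).const_mul _
  have hrhs : Tendsto (fun t => minNorm y * ‖Φ t (1, 1)‖ + ∑ p ∈ c.support, ‖c p‖ *
      ‖Φ t p - τA t (u p.1) (τB t (u p.2) (Φ t (1, 1)))‖) atTop
      (𝓝 (minNorm y * ‖Ψ (1, 1)‖ + ∑ p ∈ c.support, ‖c p‖ * 0)) :=
    ((tendsto_norm_of_inner (hgram _ _)).const_mul _).add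
      (tendsto_finsetSum _ fun p _ => (hD2 p.1 p.2).const_mul _)
  have hle := le_of_tendsto_of_tendsto' hlhs hrhs fun t => ?_
  · simp only [mul_zero, Finset.sum_const_zero, add_zero, hΨnorm] at hle
    exact (congrArg norm hcomm).trans_le hle
  · calc ‖∑ p ∈ c.support, c p • Φ t p‖
        = ‖spatialRep (π' t) (σ' t) y (Φ t (1, 1)) + ∑ p ∈ c.support,
            c p • (Φ t p - τA t (u p.1) (τB t (u p.2) (Φ t (1, 1))))‖ := by
          rw [hspat, ← Finset.sum_add_distrib]
          simp only [← smul_add, add_sub_cancel]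
      _ ≤ _ := by
          refine (norm_add_le _ _).trans (add_le_add ?_ ?_)
          · exact (ContinuousLinearMap.le_opNorm _ _).trans
              (mul_le_mul_of_nonneg_right (norm_spatialRep_le_minNorm _ _ _) (norm_nonneg _))
          · refine (norm_sum_le _ _).trans (Finset.sum_le_sum fun p _ => ?_)
            rw [norm_smul]

end Steering

end

theorem mainTheorem2 (k m : ℕ) (hk : 2 ≤ k) (hm : 2 ≤ m) (hΓ : ¬(k = 2 ∧ m = 2)) :
    List.TFAE [
      Steering.QWEP,
      TensorNorm.MinEqMax (MaxGroup.GroupCStar (Steering.BellGroup k m))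
        (MaxGroup.GroupCStar (Steering.BellGroup k m)),
      ∀ d : ℕ, 1 ≤ d → closure (Steering.tensorData k m d) = Steering.commutingData k m d,
      ∀ d : ℕ, 1 ≤ d → ∀ V W : Fin k → Fin m → Matrix (Fin d) (Fin d) ℂ,
        (∀ x a, (V x a).IsHermitian) → (∀ y b, (W y b).IsHermitian) →
          Steering.tensorValue V W = Steering.commutativeValue V W] := by
  tfae_have 1 → 4 := fun h d hd V W hV hW =>
    Steering.tensorValue_eq_of_qwep h (by omega) (by omega) hd hV hW
  tfae_have 4 → 3 := fun h d hd =>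
    Steering.closure_tensorData_eq (by omega) (by omega) hd (h d hd)
  tfae_have 3 → 2 := Steering.minEqMax_bellGroup_of_closure (by omega) (by omega)
  tfae_have 2 → 1 := Steering.qwep_of_minEqMax_bellGroup hk hm hΓ
  tfae_finish
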